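/- **Setting.** Let $\Gamma$ be a finite simple graph with vertex set $V$ and let $V^\pm=\{v,v^{-1}\mid v\in V\}$. For $x\in V^{\pm}$ write $lk(x)$, $st(x)$ for the link and star in $\Gamma$ of the underlying vertex, and call elements of $V^\pm$ adjacent if the underlying vertices are. *Partitions.* A *$\Gamma$-Whitehead pair* $(P,m)$ consists of $P\subset V^\pm$ with at least two elements and $m\in P$ with $m^{-1}\notin P$ such that (1) no element of $P$ is adjacent to $m$; (2) if $x\in P$, $x^{-1}\notin P$, then $lk(x)\subseteq st(m)$; (3) if $v,v^{-1}\in P$, then $w,w^{-1}\in P$ for all $w$ in the component of $v$ in $\Gamma\setminus st(m)$. With $lk(P)=lk(m)^\pm$ and $P^*=V^\pm\setminus(P\cup lk(P))$, it defines the *$\Gamma$-Whitehead partition* $\mathbf P=\{P,lk(P),P^*\}$ with *sides* $P,P^*$ and link $lk(\mathbf P)=lk(m)$; a vertex $v$ is a *singleton* of $\mathbf P$ if $v,v^{-1}$ lie in different sides. Partitions with pairs $(P,m)$, $(Q,n)$ *commute* if $m,n$ are adjacent (this does not depend on the choice of $m$ and $n$); they are *compatible* if they commute or some side of one is disjoint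 from some side of the other. Let $\mathcal P=\{\mathbf P_1,\dots,\mathbf P_k\}$ ($k\ge 0$) be a set of distinct, pairwise compatible $\Gamma$-Whitehead partitions. *Blowup.* A *region* $R=(P_1^\times,\dots,P_k^\times)$ is a choice of a side of each $\mathbf P_i$ such that, for $i\ne j$, $\mathbf P_i,\mathbf P_j$ commute or $P_i^\times\cap P_j^\times\ne\emptyset$. Put $I(R)=\bigcap_i (P_i^\times\cup lk(P_i))$ (so $I(R)=V^\pm$ if $k=0$). The *blowup* $\mathbb S^{\mathcal P}$ is the cube complex with one vertex $x_R$ for each region; an edge labelled $e_{\mathbf P_i}$ joining $x_R,x_{R'}$ whenever $R,R'$ differ exactly in the side of $\mathbf P_i$; for each $v\in V$ and each region $R$ with $v^{-1}\in I(R)$ an edge labelled $e_v$ from $x_R$ to $x_{R_v}$, where $R_v$ is obtained from $R$ by switching the sides of all $\mathbf P_i$ of which $v$ is a singleton; and an $m$-cube for each set of $m$ edges at a vertex with pairwise commuting labels, its parallel edges having equal labels. Here $e_v,e_w$ commute if $v,w$ are adjacent, $e_v,e_{\mathbf P_i}$ commute if $v\in lk(\mathbf P_i)$, and $e_{\mathbf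 P_i},e_{\mathbf P_j}$ commute if $\mathbf P_i,\mathbf P_j$ do. The *Salvetti complex* $\mathbb S$ is the subcomplex of the torus with one edge $e_v$ for each $v\in V$ consisting of the faces whose edges are labelled by pairwise adjacent vertices. *Collapses.* For a cube complex $X$, the *carrier* $\kappa(H)$ of a hyperplane $H$ is the subcomplex formed by the cubes meeting $H$ and their faces, and $H$ is a *carrier retract* if $\kappa(H)$ is isomorphic to $H\times[0,1]$ (via the canonical map $H\times [0,1]\to\kappa(H)$, i.e. without identifications). A set $\mathcal H$ of hyperplanes *has compatible carriers* if each $H\in\mathcal H$ is a carrier retract and every closed edge path in $X$ all of whose edges are dual to hyperplanes in $\mathcal H$ is null-homotopic. The *collapse* $X_{\mathcal H}$ is the cube complex obtained by projecting each cube $C$ orthogonally to the intersection of the mid-planes of $C$ that lie in hyperplanes of $\mathcal H$. *Tree-like sets.* For each link $L$ of a partition in $\mathcal P$ let $\mathcal P_L$ be the set of partitions in $\mathcal P$ with link $L$. The *base graph* $\mathfrak g_L$ is the subgraph of the 1-skeleton of $\mathbb S^{\mathcal P_L}$ formed by all vertices and all edges labelled $e_{\mathbf P}$ with $\mathbf P\in\mathcal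 P_L$ or $e_v$ with $lk(v)=L$. A set $\mathcal H$ of hyperplanes of $\mathbb S^{\mathcal P}$ is *tree-like* if $\mathcal H=\bigcup_L\mathcal H_L$, the union over all links $L$ of partitions in $\mathcal P$, where for each $L$ there is a set of hyperplanes of $\mathbb S^{\mathcal P_L}$ whose dual edges form a maximal tree in $\mathfrak g_L$, and $\mathcal H_L$ consists of the hyperplanes of $\mathbb S^{\mathcal P}$ dual to edges with the same labels. **Theorem.** Let $\mathcal H$ be a set of hyperplanes in $\mathbb S^{\mathcal P}$. Then $\mathcal H$ is tree-like if and only if $\mathcal H$ has compatible carriers and the collapse of $\mathbb S^{\mathcal P}$ along $\mathcal H$ is isomorphic, as a cube complex, to the Salvetti complex $\mathbb S$. -/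

import Mathlib

universe u v w

/-! ### Cube complexes -/

/-- A cube complex whose edge directions are labelled (by `Λ`) and oriented, in such a way that the
directions of one cube have distinct labels and parallel edges of a cube carry the same label and
the same orientation.  A cube `c` with `dirs c = A` is a copy of `[0,1]^A`; `face c a ε` is the
face on which the coordinate `a` is `0` (`ε = false`) or `1` (`ε = true`).  No injectivity is
required: faces of a cube may coincide.  By convention `face c a ε = c` when `a ∉ dirs c`. -/
structure CubeComplex (Λ : Type u) where
  Cube : Type v
  dirs : Cube → Set Λ
  finite_dirs : ∀ c, (dirs c).Finite
  face : Cube → Λ → Bool → Cube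
  face_of_notMem : ∀ c a ε, a ∉ dirs c → face c a ε = c
  dirs_face : ∀ c a ε, dirs (face c a ε) = dirs c \ {a}
  face_comm : ∀ c a b ε δ, a ≠ b → face (face c a ε) b δ = face (face c b δ) a ε

namespace CubeComplex

variable {Λ : Type u} {Λ' : Type w}

/-- An isomorphism of cube complexes: a bijection between the cubes together with, for each cube,
an isometry of cubes (a bijection `dir` of the coordinates, and a reflection `flip` of some of
them), compatible with passing to faces.  Labels and orientations need not be preserved. -/
structure Iso (X : CubeComplex Λ) (Y : CubeComplex Λ') where
  cube : X.Cube ≃ Y.Cube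
  dir : ∀ c, X.dirs c ≃ Y.dirs (cube c)
  flip : ∀ c, X.dirs c → Bool
  cube_face : ∀ c (a : X.dirs c) (ε : Bool),
    cube (X.face c a ε) = Y.face (cube c) (dir c a) (xor ε (flip c a))
  dir_face : ∀ c (a b : X.dirs c) (ε : Bool) (h : b.1 ∈ X.dirs (X.face c a ε)),
    (dir (X.face c a ε) ⟨b, h⟩ : Λ') = dir c b
  flip_face : ∀ c (a b : X.dirs c) (ε : Bool) (h : b.1 ∈ X.dirs (X.face c a ε)),
    flip (X.face c a ε) ⟨b, h⟩ = flip c b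

/-- `d` is a (not necessarily proper) face of `c`, of any codimension. -/
def IsFaceOf (X : CubeComplex Λ) (d c : X.Cube) : Prop :=
  Relation.ReflTransGen (fun x y => ∃ a ε, y = X.face x a ε) c d

/-- The subcomplex given by a set of cubes closed under passing to faces. -/
def subcomplex (X : CubeComplex Λ) (S : Set X.Cube)
    (hS : ∀ c ∈ S, ∀ a ε, X.face c a ε ∈ S) : CubeComplex Λ where
  Cube := S
  dirs c := X.dirs c
  finite_dirs c := X.finite_dirs c
  face c a ε := ⟨X.face c a ε, hS c c.2 a ε⟩
  face_of_notMem c a ε h := Subtype.ext (X.face_of_notMem c a ε h)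
  dirs_face c a ε := X.dirs_face c a ε
  face_comm c a b ε δ h := Subtype.ext (X.face_comm c a b ε δ h)

/-- The product `X × [0,1]`.  The interval has the cubes `some false = {0}`, `some true = {1}` and
`none = [0,1]`; its direction is labelled `none`. -/
def prodInterval (X : CubeComplex Λ) : CubeComplex (Option Λ) where
  Cube := X.Cube × Option Bool
  dirs c := {x | (∃ a ∈ X.dirs c.1, x = some a) ∨ (x = none ∧ c.2 = none)}
  finite_dirs c := by
    refine (((X.finite_dirs c.1).image some).union (Set.finite_singleton none)).subset ?_
    rintro x (⟨a, ha, rfl⟩ | ⟨rfl, -⟩)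
    · exact Or.inl ⟨a, ha, rfl⟩
    · exact Or.inr rfl
  face c x ε :=
    match x with
    | some a => (X.face c.1 a ε, c.2)
    | none => (c.1, c.2.or (some ε))
  face_of_notMem := by
    rintro ⟨c, t⟩ (_ | a) ε h
    · cases t <;> simp_all
    · have : a ∉ X.dirs c := fun ha => h (Or.inl ⟨a, ha, rfl⟩)
      exact Prod.ext (X.face_of_notMem c a ε this) rfl
  dirs_face := by
    rintro ⟨c, t⟩ (_ | a) ε <;> ext (_ | b) <;> cases t <;> simp [X.dirs_face]
  face_comm := by
    rintro ⟨c, t⟩ (_ | a) (_ | b) ε δ h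
    · exact absurd rfl h
    · rfl
    · rfl
    · have hab : a ≠ b := fun e => h (by rw [e])
      exact Prod.ext (X.face_comm c a b ε δ hab) rfl

/-! ### Hyperplanes -/

/-- A midcube: a cube together with one of its directions. -/
structure Midcube (X : CubeComplex Λ) where
  cube : X.Cube
  dir : Λ
  mem : dir ∈ X.dirs cube

/-- `q` is the codimension one face of the midcube `p` in some direction. -/
def Midcube.HasFace {X : CubeComplex Λ} (p q : X.Midcube) : Prop :=
  q.dir = p.dir ∧ ∃ b ε, b ≠ p.dir ∧ q.cube = X.face p.cube b ε

/-- Hyperplanes: connected components of the complex of midcubes (glued along faces). -/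
def Hyperplane (X : CubeComplex Λ) : Type _ := Quot (Midcube.HasFace (X := X))

/-- The hyperplane containing a given midcube. -/
def Midcube.hyperplane {X : CubeComplex Λ} (p : X.Midcube) : X.Hyperplane := Quot.mk _ p

/-- All edges dual to a hyperplane have the same label. -/
def Hyperplane.label {X : CubeComplex Λ} (H : X.Hyperplane) : Λ :=
  Quot.lift Midcube.dir (fun _ _ h => h.1.symm) H

/-- The face of a midcube in the direction `b` (itself, if `b` is not one of its directions). -/
noncomputable def Midcube.face {X : CubeComplex Λ} (p : X.Midcube) (b : Λ) (ε : Bool) :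
    X.Midcube where
  cube := open Classical in if b = p.dir then p.cube else X.face p.cube b ε
  dir := p.dir
  mem := by
    split_ifs with h
    · exact p.mem
    · rw [X.dirs_face]; exact ⟨p.mem, fun e => h e.symm⟩

theorem Midcube.ext' {X : CubeComplex Λ} {p q : X.Midcube} (h1 : p.cube = q.cube)
    (h2 : p.dir = q.dir) : p = q := by
  cases p; cases q; cases h1; cases h2; rfl

theorem Midcube.face_dir {X : CubeComplex Λ} (p : X.Midcube) (ε : Bool) : p.face p.dir ε = p :=
  Midcube.ext' (by simp [Midcube.face]) rfl

theorem Midcube.face_cube {X : CubeComplex Λ} (p : X.Midcube) {b : Λ} (ε : Bool) (h : b ≠ p.dir) :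
    (p.face b ε).cube = X.face p.cube b ε := by
  simp [Midcube.face, h]

theorem Midcube.hyperplane_face {X : CubeComplex Λ} (p : X.Midcube) (b : Λ) (ε : Bool) :
    (p.face b ε).hyperplane = p.hyperplane := by
  by_cases h : b = p.dir
  · rw [h, p.face_dir]
  · exact (Quot.sound ⟨rfl, b, ε, h, p.face_cube ε h⟩).symm

/-- A hyperplane as a cube complex of its own: its cubes are its midcubes. -/
noncomputable def hyperplaneComplex (X : CubeComplex Λ) (H : X.Hyperplane) : CubeComplex Λ where
  Cube := {p : X.Midcube // p.hyperplane = H}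
  dirs p := X.dirs p.1.cube \ {p.1.dir}
  finite_dirs p := (X.finite_dirs p.1.cube).subset Set.sdiff_subset
  face p b ε := ⟨p.1.face b ε, (p.1.hyperplane_face b ε).trans p.2⟩
  face_of_notMem := by
    rintro ⟨p, hp⟩ b ε h
    apply Subtype.ext
    by_cases hb : b = p.dir
    · exact hb ▸ p.face_dir ε
    · refine Midcube.ext' ?_ rfl
      exact (p.face_cube ε hb).trans (X.face_of_notMem _ b ε (fun hc => h ⟨hc, hb⟩))
  dirs_face := by
    rintro ⟨p, hp⟩ b ε
    change X.dirs (p.face b ε).cube \ {p.dir} = (X.dirs p.cube \ {p.dir}) \ {b}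
    by_cases hb : b = p.dir
    · subst hb; rw [p.face_dir]; simp
    · rw [p.face_cube ε hb, X.dirs_face, Set.sdiff_sdiff_comm]
  face_comm := by
    rintro ⟨p, hp⟩ b d ε δ h
    apply Subtype.ext
    change (p.face b ε).face d δ = (p.face d δ).face b ε
    by_cases hb : b = p.dir
    · subst hb
      rw [p.face_dir]
      exact ((p.face d δ).face_dir ε).symm
    · by_cases hd : d = p.dir
      · subst hd
        rw [p.face_dir]
        exact (p.face b ε).face_dir δ
      · refine Midcube.ext' ?_ rfl
        rw [(p.face b ε).face_cube δ hd, (p.face d δ).face_cube ε hb, p.face_cube ε hb,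
          p.face_cube δ hd]
        exact X.face_comm p.cube b d ε δ h

/-- The carrier of a hyperplane `H`: the subcomplex formed by all cubes that meet `H`, and their
faces. -/
def carrier (X : CubeComplex Λ) (H : X.Hyperplane) : CubeComplex Λ :=
  X.subcomplex {d | ∃ p : X.Midcube, p.hyperplane = H ∧ X.IsFaceOf d p.cube} (by
    rintro c ⟨p, hp, hc⟩ a ε
    exact ⟨p, hp, hc.tail ⟨a, ε, rfl⟩⟩)

/-- The canonical map from the cubes of `H × [0,1]` to the cubes of `X`. -/
def thicken (X : CubeComplex Λ) (p : X.Midcube) : Option Bool → X.Cube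
  | none => p.cube
  | some ε => X.face p.cube p.dir ε

/-- `H` is a carrier retract: its carrier is (canonically) isomorphic to `H × [0,1]`. -/
def IsCarrierRetract (X : CubeComplex Λ) (H : X.Hyperplane) : Prop :=
  ∃ f : Iso (X.hyperplaneComplex H).prodInterval (X.carrier H),
    ∀ (p : {p : X.Midcube // p.hyperplane = H}) (t : Option Bool),
      (f.cube (p, t)).1 = X.thicken p.1 t

/-! ### Edge paths and their homotopies -/

def IsVertex (X : CubeComplex Λ) (c : X.Cube) : Prop := X.dirs c = ∅

/-- An edge with a direction of travel: from its end with coordinate `start` to the other one. -/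
structure Dart (X : CubeComplex Λ) where
  edge : X.Cube
  label : Λ
  dirs_eq : X.dirs edge = {label}
  start : Bool

namespace Dart

variable {X : CubeComplex Λ}

def source (d : X.Dart) : X.Cube := X.face d.edge d.label d.start

def target (d : X.Dart) : X.Cube := X.face d.edge d.label (!d.start)

/-- The same edge, travelled backwards. -/
def symm (d : X.Dart) : X.Dart := ⟨d.edge, d.label, d.dirs_eq, !d.start⟩

/-- The hyperplane dual to the edge. -/
def hyperplane (d : X.Dart) : X.Hyperplane :=
  Midcube.hyperplane ⟨d.edge, d.label, by rw [d.dirs_eq]; rfl⟩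

end Dart

/-- `l` is an edge path from `x` to `y`. -/
def IsEdgePath (X : CubeComplex Λ) : X.Cube → List X.Dart → X.Cube → Prop
  | x, [], y => x = y
  | x, d :: l, y => d.source = x ∧ X.IsEdgePath d.target l y

/-- The edge of the square `s` in the direction `a` on which the coordinate `b` is `β`, travelled
from the end where the coordinate `a` is `α`. -/
def squareDart (X : CubeComplex Λ) (s : X.Cube) (a b : Λ) (hab : a ≠ b) (hs : X.dirs s = {a, b})
    (α β : Bool) : X.Dart where
  edge := X.face s b β
  label := a
  dirs_eq := by
    rw [X.dirs_face, hs]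
    ext x
    simp only [Set.mem_sdiff, Set.mem_insert_iff, Set.mem_singleton_iff]
    constructor
    · rintro ⟨rfl | rfl, h⟩
      · rfl
      · exact absurd rfl h
    · rintro rfl
      exact ⟨Or.inl rfl, hab⟩
  start := α

/-- Elementary homotopies: removing a backtrack, and pushing two consecutive edges of a square
across that square. -/
inductive Move (X : CubeComplex Λ) : List X.Dart → List X.Dart → Prop
  | backtrack (l r : List X.Dart) (d : X.Dart) : Move X (l ++ d :: d.symm :: r) (l ++ r)
  | square (l r : List X.Dart) (s : X.Cube) (a b : Λ) (hab : a ≠ b) (hs : X.dirs s = {a, b})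
      (α β : Bool) :
      Move X
        (l ++ X.squareDart s a b hab hs α β ::
          X.squareDart s b a hab.symm (hs.trans (Set.pair_comm a b)) β (!α) :: r)
        (l ++ X.squareDart s b a hab.symm (hs.trans (Set.pair_comm a b)) β α ::
          X.squareDart s a b hab hs α (!β) :: r)

/-- Homotopy, relative to the endpoints, of edge paths from `x` to `y`. -/
def Homotopic (X : CubeComplex Λ) (x y : X.Cube) : List X.Dart → List X.Dart → Prop :=
  Relation.EqvGen fun p q => X.IsEdgePath x p y ∧ X.IsEdgePath x q y ∧ X.Move p q

/-- Every hyperplane in `𝓗` is a carrier retract, and every closed edge path whose edges are dual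
to hyperplanes in `𝓗` is null homotopic. -/
def HasCompatibleCarriers (X : CubeComplex Λ) (𝓗 : Set X.Hyperplane) : Prop :=
  (∀ H ∈ 𝓗, X.IsCarrierRetract H) ∧
    ∀ (x : X.Cube) (p : List X.Dart), X.IsVertex x → X.IsEdgePath x p x →
      (∀ d ∈ p, d.hyperplane ∈ 𝓗) → X.Homotopic x x p []

/-- The set `T` of edges is a maximal tree in the graph formed by all vertices of `X` and the edges
in `g`: it consists of edges in `g`, any two vertices are joined by a path in `T`, and there is no
nonempty closed path without backtracking in `T`. -/
def IsMaximalTree (X : CubeComplex Λ) (g T : Set X.Cube) : Prop :=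
  T ⊆ g ∧
    (∀ x y, X.IsVertex x → X.IsVertex y →
      ∃ p : List X.Dart, X.IsEdgePath x p y ∧ ∀ d ∈ p, d.edge ∈ T) ∧
    ∀ (x : X.Cube) (p : List X.Dart), X.IsEdgePath x p x → (∀ d ∈ p, d.edge ∈ T) →
      p.IsChain (fun d e => e ≠ d.symm) → p = []

/-! ### Collapsing along hyperplanes -/

/-- In the collapse along `𝓗`, a cube meeting a hyperplane of `𝓗` is identified, by the orthogonal
projection, with its two faces opposite in the corresponding direction. -/
def CollapseRel (X : CubeComplex Λ) (𝓗 : Set X.Hyperplane) (c d : X.Cube) : Prop :=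
  ∃ p : X.Midcube, p.hyperplane ∈ 𝓗 ∧ c = p.cube ∧ ∃ ε, d = X.face p.cube p.dir ε

/-- The directions of a cube that are not dual to a hyperplane in `𝓗`. -/
def keptDirs (X : CubeComplex Λ) (𝓗 : Set X.Hyperplane) (c : X.Cube) : Set Λ :=
  {a | ∃ h : a ∈ X.dirs c, Midcube.hyperplane ⟨c, a, h⟩ ∉ 𝓗}

theorem hyperplane_of_face (X : CubeComplex Λ) (c : X.Cube) (a b : Λ) (ε : Bool) (hab : a ≠ b)
    (h : a ∈ X.dirs c) (h' : a ∈ X.dirs (X.face c b ε)) :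
    Midcube.hyperplane ⟨X.face c b ε, a, h'⟩ = Midcube.hyperplane ⟨c, a, h⟩ :=
  (Quot.sound ⟨rfl, b, ε, hab.symm, rfl⟩).symm

theorem keptDirs_face (X : CubeComplex Λ) (𝓗 : Set X.Hyperplane) (c : X.Cube) (b : Λ) (ε : Bool) :
    X.keptDirs 𝓗 (X.face c b ε) = X.keptDirs 𝓗 c \ {b} := by
  ext a
  constructor
  · rintro ⟨h, hH⟩
    have h2 := h
    rw [X.dirs_face] at h2
    refine ⟨⟨h2.1, ?_⟩, h2.2⟩
    rwa [← X.hyperplane_of_face c a b ε h2.2 h2.1 h]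
  · rintro ⟨⟨h, hH⟩, hab⟩
    have h2 : a ∈ X.dirs (X.face c b ε) := by rw [X.dirs_face]; exact ⟨h, hab⟩
    refine ⟨h2, ?_⟩
    rwa [X.hyperplane_of_face c a b ε hab h h2]

theorem keptDirs_eq_of_rel (X : CubeComplex Λ) (𝓗 : Set X.Hyperplane) (c d : X.Cube)
    (h : X.CollapseRel 𝓗 c d) : X.keptDirs 𝓗 c = X.keptDirs 𝓗 d := by
  obtain ⟨⟨c', b, hb⟩, hH, rfl, ε, rfl⟩ := h
  rw [keptDirs_face, Set.sdiff_singleton_eq_self]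
  rintro ⟨_, h⟩
  exact h hH

theorem mk_face_of_notMem_keptDirs (X : CubeComplex Λ) (𝓗 : Set X.Hyperplane) (c : X.Cube) (a : Λ)
    (ε : Bool) (h : a ∉ X.keptDirs 𝓗 c) :
    Quot.mk (X.CollapseRel 𝓗) (X.face c a ε) = Quot.mk (X.CollapseRel 𝓗) c := by
  by_cases ha : a ∈ X.dirs c
  · have hH : Midcube.hyperplane ⟨c, a, ha⟩ ∈ 𝓗 := by
      by_contra hn
      exact h ⟨ha, hn⟩
    exact (Quot.sound ⟨⟨c, a, ha⟩, hH, rfl, ε, rfl⟩).symm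
  · rw [X.face_of_notMem c a ε ha]

/-- The collapse of `X` along a set `𝓗` of hyperplanes: every cube is projected to the intersection
of its mid-planes that lie in `𝓗`. -/
def collapse (X : CubeComplex Λ) (𝓗 : Set X.Hyperplane) : CubeComplex Λ where
  Cube := Quot (X.CollapseRel 𝓗)
  dirs := Quot.lift (X.keptDirs 𝓗) (X.keptDirs_eq_of_rel 𝓗)
  finite_dirs := by
    rintro ⟨c⟩
    exact (X.finite_dirs c).subset (fun a h => h.1)
  face q a ε := Quot.lift (fun c => Quot.mk (X.CollapseRel 𝓗) (X.face c a ε)) (by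
    rintro c' d ⟨⟨_, b, hb⟩, hH, rfl, δ, rfl⟩
    have hb' : b ∉ X.keptDirs 𝓗 c' := fun h => h.2 hH
    by_cases hab : b = a
    · subst hab
      rw [X.face_of_notMem (X.face c' b δ) b ε (by rw [X.dirs_face]; exact fun h => h.2 rfl)]
      exact (X.mk_face_of_notMem_keptDirs 𝓗 c' b ε hb').trans
        (X.mk_face_of_notMem_keptDirs 𝓗 c' b δ hb').symm
    · change Quot.mk _ (X.face c' a ε) = Quot.mk _ (X.face (X.face c' b δ) a ε)
      rw [X.face_comm c' b a δ ε hab]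
      refine (X.mk_face_of_notMem_keptDirs 𝓗 _ b δ ?_).symm
      rw [keptDirs_face]
      exact fun h => hb' h.1) q
  face_of_notMem := by
    rintro ⟨c⟩ a ε h
    exact X.mk_face_of_notMem_keptDirs 𝓗 c a ε h
  dirs_face := by
    rintro ⟨c⟩ a ε
    exact X.keptDirs_face 𝓗 c a ε
  face_comm := by
    rintro ⟨c⟩ a b ε δ h
    exact congrArg (Quot.mk _) (X.face_comm c a b ε δ h)

end CubeComplex

/-! ### The Salvetti complex -/

/-- The Salvetti complex of the right-angled Artin group of `Γ`: the subcomplex of the torus with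
one edge for each vertex of `Γ`, with one cube for each set of pairwise adjacent vertices. -/
def salvetti {V : Type u} [Finite V] (Γ : SimpleGraph V) : CubeComplex V where
  Cube := {A : Set V // A.Pairwise Γ.Adj}
  dirs A := A.1
  finite_dirs _ := Set.toFinite _
  face A a _ := ⟨A.1 \ {a}, A.2.mono Set.sdiff_subset⟩
  face_of_notMem _ _ _ h := Subtype.ext (Set.sdiff_singleton_eq_self h)
  dirs_face _ _ _ := rfl
  face_comm _ _ _ _ _ _ := Subtype.ext Set.sdiff_sdiff_comm

/-! ### Whitehead partitions

The element `v` of `V^±` is `(v, true)`, and `v⁻¹` is `(v, false)`. -/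

/-- The inverse of an element of `V^±`. -/
def invLetter {V : Type u} (x : V × Bool) : V × Bool := (x.1, !x.2)

/-- `(P, m)` is a `Γ`-Whitehead pair. -/
structure IsWhiteheadPair {V : Type u} (Γ : SimpleGraph V) (P : Set (V × Bool)) (m : V × Bool) :
    Prop where
  nontrivial : P.Nontrivial
  mem : m ∈ P
  inv_notMem : invLetter m ∉ P
  not_adj : ∀ x ∈ P, ¬ Γ.Adj m.1 x.1
  /-- If `x ∈ P` and `x⁻¹ ∉ P` then `lk x ⊆ st m`. -/
  le_of_single : ∀ x ∈ P, invLetter x ∉ P → Γ.neighborSet x.1 ⊆ insert m.1 (Γ.neighborSet m.1)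
  /-- If `v, v⁻¹ ∈ P` then `w, w⁻¹ ∈ P` for all `w` in the component of `v` in `Γ ∖ st m`. -/
  component : ∀ v w : ↥((insert m.1 (Γ.neighborSet m.1))ᶜ : Set V),
    (v.1, true) ∈ P → (v.1, false) ∈ P →
    (Γ.induce (insert m.1 (Γ.neighborSet m.1))ᶜ).Reachable v w →
    (w.1, true) ∈ P ∧ (w.1, false) ∈ P

/-- A `Γ`-Whitehead partition `{P, lk P, P*}`, given by a side `P` and an `m` such that `(P, m)` is
a `Γ`-Whitehead pair.  See `SamePartition` for equality of partitions. -/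
structure WhiteheadPartition {V : Type u} (Γ : SimpleGraph V) where
  P : Set (V × Bool)
  m : V × Bool
  isPair : IsWhiteheadPair Γ P m

namespace WhiteheadPartition

variable {V : Type u} {Γ : SimpleGraph V}

/-- The link of the partition, as a set of vertices of `Γ`. -/
def lk (p : WhiteheadPartition Γ) : Set V := Γ.neighborSet p.m.1

/-- The two sides: `P` for `false`, and `P* = V^± ∖ (P ∪ lk P)` for `true`. -/
def side (p : WhiteheadPartition Γ) : Bool → Set (V × Bool)
  | false => p.P
  | true => {x | x ∉ p.P ∧ x.1 ∉ p.lk}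

/-- The vertices `v` such that `v` and `v⁻¹` lie in different sides. -/
def single (p : WhiteheadPartition Γ) : Set V :=
  {v | ∃ b, (v, true) ∈ p.side b ∧ (v, false) ∈ p.side !b}

/-- The partitions coincide, that is, they have the same (unordered) sides. -/
def SamePartition (p q : WhiteheadPartition Γ) : Prop := ∃ b, p.P = q.side b

/-- The partitions commute: `max P` and `max Q` are adjacent.  (All elements of `max P` have the
same link, so that it does not matter which element is used.) -/
def Commuting (p q : WhiteheadPartition Γ) : Prop := Γ.Adj p.m.1 q.m.1

/-- The partitions commute, or some side of the one is disjoint from some side of the other. -/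
def Compatible (p q : WhiteheadPartition Γ) : Prop :=
  p.Commuting q ∨ ∃ b b', Disjoint (p.side b) (q.side b')

theorem fst_notMem_lk (p : WhiteheadPartition Γ) (b : Bool) {x : V × Bool} (h : x ∈ p.side b) :
    x.1 ∉ p.lk := by
  cases b
  · exact p.isPair.not_adj x h
  · exact h.2

theorem neighborSet_subset_lk (p : WhiteheadPartition Γ) {v : V} (h : v ∈ p.single) :
    Γ.neighborSet v ⊆ p.lk := by
  obtain ⟨b, h1, h2⟩ := h
  have hv : v ∉ p.lk := p.fst_notMem_lk b h1
  have key : Γ.neighborSet v ⊆ insert p.m.1 (Γ.neighborSet p.m.1) := by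
    cases b
    · exact p.isPair.le_of_single _ h1 h2.1
    · exact p.isPair.le_of_single _ h2 h1.1
  intro w hw
  rcases key hw with rfl | h
  · exact absurd (Γ.adj_symm hw) hv
  · exact h

theorem mem_side_of_notMem_single (p : WhiteheadPartition Γ) {v : V} (hv : v ∉ p.single) (s t b : Bool)
    (h : (v, s) ∈ p.side b) : (v, t) ∈ p.side b := by
  have hl : v ∉ p.lk := p.fst_notMem_lk b h
  have hc : ∀ t, (v, t) ∈ p.side false ∨ (v, t) ∈ p.side true := fun t => by
    by_cases h' : (v, t) ∈ p.P
    · exact Or.inl h'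
    · exact Or.inr ⟨h', hl⟩
  have key : ∀ s b, (v, s) ∈ p.side b → (v, !s) ∈ p.side b := by
    intro s b h
    by_contra hn
    have h2 : (v, !s) ∈ p.side !b := by
      cases b
      · exact (hc _).resolve_left hn
      · exact (hc _).resolve_right hn
    cases s
    · exact hv ⟨!b, h2, by simpa using h⟩
    · exact hv ⟨b, h, h2⟩
  by_cases hst : t = s
  · rwa [hst]
  · have : t = !s := by cases t <;> cases s <;> simp_all
    rw [this]
    exact key s b h

end WhiteheadPartition

/-! ### Blowups -/

section Blowup

variable {V : Type u} {ι : Type w} {Γ : SimpleGraph V}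

/-- A choice of a side for each partition is a region if any two of the partitions commute or have
intersecting chosen sides. -/
def IsRegion (Φ : ι → WhiteheadPartition Γ) (R : ι → Bool) : Prop :=
  ∀ i j, i ≠ j → (Φ i).Commuting (Φ j) ∨ ((Φ i).side (R i) ∩ (Φ j).side (R j)).Nonempty

/-- The set `I(R) ⊆ V^±`. -/
def regionLetters (Φ : ι → WhiteheadPartition Γ) (R : ι → Bool) : Set (V × Bool) :=
  {x | ∀ i, x ∈ (Φ i).side (R i) ∨ x.1 ∈ (Φ i).lk}

/-- The partitions whose side changes along an edge with the given label: `inl i` is the label of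
the edges of the `i`-th partition, `inr v` is the label `e_v`. -/
def crossed (Φ : ι → WhiteheadPartition Γ) : ι ⊕ V → Set ι
  | Sum.inl i => {i}
  | Sum.inr v => {i | v ∈ (Φ i).single}

open Classical in
/-- Switch sides of all partitions that an edge with label `a` crosses. -/
noncomputable def switch (Φ : ι → WhiteheadPartition Γ) (a : ι ⊕ V) (R : ι → Bool) : ι → Bool :=
  fun i => if i ∈ crossed Φ a then !R i else R i

/-- Commuting labels. -/
def LabelsCommute (Φ : ι → WhiteheadPartition Γ) : ι ⊕ V → ι ⊕ V → Prop
  | Sum.inl i, Sum.inl j => (Φ i).Commuting (Φ j)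
  | Sum.inl i, Sum.inr v => v ∈ (Φ i).lk
  | Sum.inr v, Sum.inl i => v ∈ (Φ i).lk
  | Sum.inr v, Sum.inr w => Γ.Adj v w

/-- There is an edge with the given label that starts at the vertex `x_R`.  The edges labelled by
the `i`-th partition go from the side `P` to the side `P*`; those labelled `e_v` go from a region
`R` with `v⁻¹ ∈ I(R)` to a region with `v ∈ I(R)`. -/
def EdgeStarts (Φ : ι → WhiteheadPartition Γ) (R : ι → Bool) : ι ⊕ V → Prop
  | Sum.inl i => R i = false ∧ IsRegion Φ (switch Φ (Sum.inl i) R)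
  | Sum.inr v => (v, false) ∈ regionLetters Φ R

/-- The cubes of the blowup: a cube is given by a region `R` and a set of pairwise commuting labels
of edges that start at `x_R`. -/
structure BlowupCube (Φ : ι → WhiteheadPartition Γ) where
  region : ι → Bool
  labels : Set (ι ⊕ V)
  isRegion : IsRegion Φ region
  commute : labels.Pairwise (LabelsCommute Φ)
  starts : ∀ a ∈ labels, EdgeStarts Φ region a

theorem BlowupCube.ext' {Φ : ι → WhiteheadPartition Γ} {c d : BlowupCube Φ}
    (h1 : c.region = d.region) (h2 : c.labels = d.labels) : c = d := by
  cases c; cases d; cases h1; cases h2; rfl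

theorem switch_comm (Φ : ι → WhiteheadPartition Γ) (a b : ι ⊕ V) (R : ι → Bool) :
    switch Φ a (switch Φ b R) = switch Φ b (switch Φ a R) := by
  funext i
  simp only [switch]
  split_ifs <;> rfl

theorem isRegion_switch (Φ : ι → WhiteheadPartition Γ) (R : ι → Bool) (hR : IsRegion Φ R)
    (a : ι ⊕ V) (ha : EdgeStarts Φ R a) : IsRegion Φ (switch Φ a R) := by
  rcases a with i | v
  · exact ha.2
  have hflip : ∀ k, v ∈ (Φ k).single → (v, true) ∈ (Φ k).side (!R k) := by
    rintro k ⟨b, h1, h2⟩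
    rcases ha k with h | h
    · have hb : R k = !b := by
        revert h h2 h1
        cases b <;> cases R k <;> intro h1 h2 h <;> simp_all [WhiteheadPartition.side]
      rw [hb]; simpa using h1
    · exact absurd h ((Φ k).fst_notMem_lk _ h2)
  have hmix : ∀ i j, v ∈ (Φ i).single → v ∉ (Φ j).single →
      (Φ i).Commuting (Φ j) ∨ ((Φ i).side (!R i) ∩ (Φ j).side (R j)).Nonempty := by
    intro i j hi hj
    rcases ha j with h | h
    · exact Or.inr ⟨(v, true), hflip i hi, (Φ j).mem_side_of_notMem_single hj _ _ _ h⟩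
    · exact Or.inl ((Φ i).neighborSet_subset_lk hi (Γ.adj_symm h))
  intro i j hij
  by_cases hi : v ∈ (Φ i).single <;> by_cases hj : v ∈ (Φ j).single <;>
    simp only [switch, crossed, Set.mem_ofPred_eq, hi, hj, if_true, if_false]
  · exact Or.inr ⟨(v, true), hflip i hi, hflip j hj⟩
  · exact hmix i j hi hj
  · rcases hmix j i hj hi with h | h
    · exact Or.inl (Γ.adj_symm h)
    · exact Or.inr (by rwa [Set.inter_comm])
  · exact hR i j hij

theorem switch_eq_of_notMem (Φ : ι → WhiteheadPartition Γ) (R : ι → Bool) (a : ι ⊕ V) (i : ι)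
    (h : i ∉ crossed Φ a) : switch Φ a R i = R i := by
  simp [switch, h]

theorem edgeStarts_switch (Φ : ι → WhiteheadPartition Γ) (R : ι → Bool) (a b : ι ⊕ V) (hab : a ≠ b) (hc : LabelsCommute Φ a b) (ha : EdgeStarts Φ R a)
    (hb : EdgeStarts Φ R b) : EdgeStarts Φ (switch Φ a R) b := by
  have hletters : ∀ v, b = Sum.inr v → EdgeStarts Φ (switch Φ a R) b := by
    rintro v rfl k
    by_cases hk : k ∈ crossed Φ a
    · right
      rcases a with i | u
      · have : k = i := hk
        subst this
        exact hc
      · exact (Φ k).neighborSet_subset_lk hk hc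
    · rw [switch_eq_of_notMem Φ R a k hk]
      exact hb k
  rcases b with j | v
  · have hj : j ∉ crossed Φ a := by
      rcases a with i | u
      · intro h
        exact hab (by rw [show j = i from h])
      · rintro ⟨b, h1, h2⟩
        exact (Φ j).fst_notMem_lk b h1 hc
    refine ⟨by rw [switch_eq_of_notMem Φ R a j hj]; exact hb.1, ?_⟩
    classical
    rcases a with i | u
    · intro k l hkl
      have hij : i ≠ j := fun e => hab (by rw [e])
      have hval : ∀ k, switch Φ (Sum.inl j) (switch Φ (Sum.inl i) R) k =
          if k = j then switch Φ (Sum.inl j) R k else switch Φ (Sum.inl i) R k := by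
        intro k
        by_cases h1 : k = j
        · simp [switch, crossed, h1, hij.symm]
        · simp [switch, crossed, h1]
      have hval' : ∀ k, k ≠ i → switch Φ (Sum.inl j) (switch Φ (Sum.inl i) R) k =
          switch Φ (Sum.inl j) R k := by
        intro k h2
        simp [switch, crossed, h2]
      by_cases hki : k = i
      · by_cases hlj : l = j
        · subst hki hlj; exact Or.inl hc
        · have hkj : k ≠ j := fun e => hij (hki.symm.trans e)
          rw [hval k, hval l, if_neg hkj, if_neg hlj]
          exact ha.2 k l hkl
      · by_cases hli : l = i
        · by_cases hkj : k = j
          · subst hkj hli; exact Or.inl (Γ.adj_symm hc)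
          · have hlj : l ≠ j := fun e => hij (hli.symm.trans e)
            rw [hval k, hval l, if_neg hkj, if_neg hlj]
            exact ha.2 k l hkl
        · rw [hval' k hki, hval' l hli]
          exact hb.2 k l hkl
    · rw [switch_comm]
      refine isRegion_switch Φ _ hb.2 (Sum.inr u) ?_
      intro k
      by_cases hk : k = j
      · right; rw [hk]; exact hc
      · rw [switch_eq_of_notMem Φ R (Sum.inl j) k hk]
        exact ha k
  · exact hletters v rfl

open Classical in
/-- The blowup of the Salvetti complex along the family `Φ` of partitions. -/
noncomputable def blowup [Finite V] [Finite ι] (Φ : ι → WhiteheadPartition Γ) :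
    CubeComplex (ι ⊕ V) where
  Cube := BlowupCube Φ
  dirs c := c.labels
  finite_dirs c := Set.toFinite _
  face c a ε :=
    { region := if a ∈ c.labels ∧ ε = true then switch Φ a c.region else c.region
      labels := c.labels \ {a}
      isRegion := by
        split_ifs with h
        · exact isRegion_switch Φ _ c.isRegion a (c.starts a h.1)
        · exact c.isRegion
      commute := c.commute.mono Set.sdiff_subset
      starts := by
        rintro b ⟨hb, hba⟩
        split_ifs with h
        · have hab : a ≠ b := fun e => hba e.symm
          exact edgeStarts_switch Φ _ a b hab (c.commute h.1 hb hab) (c.starts a h.1)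
            (c.starts b hb)
        · exact c.starts b hb }
  face_of_notMem c a ε h := BlowupCube.ext' (by simp [h]) (Set.sdiff_singleton_eq_self h)
  dirs_face _ _ _ := rfl
  face_comm c a b ε δ h := by
    apply BlowupCube.ext'
    · have h' : b ≠ a := h.symm
      by_cases ha : a ∈ c.labels <;> by_cases hb : b ∈ c.labels <;> cases ε <;> cases δ <;>
        simp [ha, hb, h, h', switch_comm Φ a b]
    · exact Set.sdiff_sdiff_comm

/-- The subfamily of all partitions in `Φ` with link `L`. -/
def linkClass (Φ : ι → WhiteheadPartition Γ) (L : Set V) :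
    {i // (Φ i).lk = L} → WhiteheadPartition Γ := fun i => Φ i

variable [Finite V] [Finite ι]

/-- The edges of the base graph of the partitions with link `L`: the edges of the blowup along
these partitions that are labelled by one of these partitions, or by `e_v` with `lk v = L`.
(The vertices of the base graph are all the vertices of this blowup.) -/
def baseGraph (Φ : ι → WhiteheadPartition Γ) (L : Set V) : Set (blowup (linkClass Φ L)).Cube :=
  {e | (∃ i, (blowup (linkClass Φ L)).dirs e = {Sum.inl i}) ∨
    ∃ v, Γ.neighborSet v = L ∧ (blowup (linkClass Φ L)).dirs e = {Sum.inr v}}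

/-- A set of hyperplanes in the blowup along the partitions with link `L` is tree-like if the edges
dual to it form a maximal tree in the base graph. -/
def IsTreeLikeAt (Φ : ι → WhiteheadPartition Γ) (L : Set V)
    (𝓕 : Set (blowup (linkClass Φ L)).Hyperplane) : Prop :=
  (blowup (linkClass Φ L)).IsMaximalTree (baseGraph Φ L)
    {e | ∃ d : (blowup (linkClass Φ L)).Dart, d.edge = e ∧ d.hyperplane ∈ 𝓕}

/-- The lift to the blowup along all of `Φ` of a set of hyperplanes in the blowup along the
partitions with link `L`: the hyperplanes dual to edges with the same labels. -/
def liftHyperplanes (Φ : ι → WhiteheadPartition Γ) (L : Set V)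
    (𝓕 : Set (blowup (linkClass Φ L)).Hyperplane) : Set (blowup Φ).Hyperplane :=
  {H | ∃ F ∈ 𝓕, H.label = Sum.map Subtype.val id F.label}

/-- A set of hyperplanes in the blowup is tree-like if it is the union, over all links `L` of
partitions in `Φ`, of lifts of tree-like sets of hyperplanes in the blowups along the partitions
with link `L`. -/
def IsTreeLike (Φ : ι → WhiteheadPartition Γ) (𝓗 : Set (blowup Φ).Hyperplane) : Prop :=
  ∃ 𝓕 : ∀ L : Set V, Set (blowup (linkClass Φ L)).Hyperplane,
    (∀ L ∈ Set.range (fun i => (Φ i).lk), IsTreeLikeAt Φ L (𝓕 L)) ∧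
    𝓗 = ⋃ L ∈ Set.range (fun i => (Φ i).lk), liftHyperplanes Φ L (𝓕 L)

end Blowup

/-! A hyperplane of the blowup is determined by its label in `ι ⊕ V`, and every label occurs, so a
set of hyperplanes is a set `T` of labels. A region is a 0-1 vector indexed by the partitions, and
along every edge labelled `a` this vector changes by the same `boundary` of `a` in `ι → ℚ`. Among
partitions with a common link no two commute. Then each partition labels exactly one edge, every
function on the regions is affine in this vector (`exists_affine`), and a set of labels of base
graph edges gives a maximal tree exactly when its boundaries form a basis (`isMaximalTree_iff`).
Thus being tree-like becomes linear algebra, one link at a time (`IsTreeLikeLabels`,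
`isTreeLike_iff`).

Regions are handled through gates: an edge labelled `a` starts at `R` exactly when `R` chooses a
prescribed side of each partition that does not commute with `a` (`edgeStarts_iff`). The main
consequence for tree-like `T` is `labelJoined_of_eqOn`: for a family `U` of partitions closed under
enlarging links, two regions that agree outside `U` are joined by edges with labels in `T` whose
links occur in `U`. Taking for `U` the partitions that commute with all of a set `B` of labels, such
a path can be swept by a cube with labels `B`.

Let `T` be tree-like. A closed path in `T` is contracted by induction on `U`: its projection to the
tree of a minimal link `L` has a backtrack; the piece of the path between the two edges is replaced
by one that commutes with them, across which the first edge slides until the two cancel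
(`homotopic_nil`). In the collapse a cube is determined by its labels outside `T` (`collapse_ext`).
For each link there are as many such labels as vertices of `Γ`, because bases have equal
cardinality; a bijection that preserves links preserves adjacency, which yields the Salvetti complex
(`nonempty_iso`).

Conversely, an isomorphism with the Salvetti complex makes the collapse have one vertex, so the
boundaries of `T` span. It also matches the labels outside `T` with the vertices of `Γ`, sending
commuting labels to adjacent vertices. Counting makes the boundaries of `T` a basis, and a nonzero
term of the determinant assigns to each partition a label in `T` that crosses it, whose link is
therefore contained in that of the partition. Double counting edges of `Γ` shows that these
inclusions are equalities (`SimpleGraph.neighborSet_eq_of_equiv`). Finally the matrix of boundaries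
is block triangular for the inclusion of links, so each diagonal block is invertible, which is the
tree-like condition. -/

/-! ### Sides of Whitehead partitions: adjacency and disjointness -/

namespace WhiteheadPartition

variable {V : Type u} {Γ : SimpleGraph V}

/-- The letter `m` or `m⁻¹`, whichever lies in the given side. -/
def base (p : WhiteheadPartition Γ) : Bool → V × Bool
  | false => p.m
  | true => invLetter p.m

theorem base_fst (p : WhiteheadPartition Γ) (b : Bool) : (p.base b).1 = p.m.1 := by
  cases b <;> rfl

theorem m_notMem_lk (p : WhiteheadPartition Γ) : p.m.1 ∉ p.lk := fun h => Γ.loopless.irrefl _ h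

theorem base_mem (p : WhiteheadPartition Γ) (b : Bool) : p.base b ∈ p.side b := by
  cases b
  · exact p.isPair.mem
  · exact ⟨p.isPair.inv_notMem, p.m_notMem_lk⟩

theorem notMem_side_not (p : WhiteheadPartition Γ) {b : Bool} {x : V × Bool} (h : x ∈ p.side b) :
    x ∉ p.side !b := by
  cases b
  · exact fun h' => h'.1 h
  · exact h.1

theorem mem_side_not (p : WhiteheadPartition Γ) {b : Bool} {x : V × Bool} (h : x ∉ p.side b)
    (hx : x.1 ∉ p.lk) : x ∈ p.side !b := by
  cases b
  · exact ⟨h, hx⟩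
  · by_contra h'
    exact h ⟨h', hx⟩

theorem mem_side_of_notMem_side_not (p : WhiteheadPartition Γ) {b : Bool} {x : V × Bool}
    (h : x ∉ p.side !b) (hx : x.1 ∉ p.lk) : x ∈ p.side b := by
  simpa using p.mem_side_not h hx

theorem side_unique (p : WhiteheadPartition Γ) {b c : Bool} {x : V × Bool} (hb : x ∈ p.side b)
    (hc : x ∈ p.side c) : b = c := by
  by_contra h
  have : c = !b := by revert h; cases b <;> cases c <;> simp
  exact p.notMem_side_not hb (this ▸ hc)

/-- Outside the link, edges of `Γ` never cross a partition. If `x⁻¹` were not in `P`, then `lk x ⊆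
st m` would force `y` to be `m` or in the link; so `P` contains both `x` and `x⁻¹`, and the
component condition carries this over to `y`. The other side follows by exchanging `x` and `y`. -/
theorem mem_side_of_adj (p : WhiteheadPartition Γ) {b : Bool} {x : V × Bool} {y : V} (s : Bool)
    (hx : x ∈ p.side b) (hxy : Γ.Adj x.1 y) (hy : y ∉ p.lk) : (y, s) ∈ p.side b := by
  have key : ∀ (x : V × Bool) (y : V) (s : Bool), x ∈ p.P → Γ.Adj x.1 y → y ∉ p.lk →
      (y, s) ∈ p.P := by
    intro x y s hx hxy hy
    have hxl : x.1 ∉ p.lk := p.isPair.not_adj x hx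
    have hym : y ≠ p.m.1 := by
      rintro rfl
      exact hxl (Γ.adj_symm hxy)
    have hinv : invLetter x ∈ p.P := by
      by_contra h
      rcases p.isPair.le_of_single x hx h hxy with h | h
      · exact hym h
      · exact hy h
    have hxm : x.1 ≠ p.m.1 := by
      intro h
      have : x = p.m ∨ x = invLetter p.m := by
        obtain ⟨v, s⟩ := x
        obtain ⟨m, t⟩ : ∃ m, m = p.m := ⟨_, rfl⟩
        have h2 : v = p.m.1 := h
        subst h2
        rcases hm : p.m with ⟨m, t⟩
        cases s <;> cases t <;> simp [invLetter]
      rcases this with h | h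
      · exact p.isPair.inv_notMem (h ▸ hinv)
      · exact p.isPair.inv_notMem (h ▸ hx)
    have hboth : (x.1, true) ∈ p.P ∧ (x.1, false) ∈ p.P := by
      obtain ⟨v, s⟩ := x
      cases s
      · exact ⟨hinv, hx⟩
      · exact ⟨hx, hinv⟩
    have := p.isPair.component ⟨x.1, by rintro (h | h); exacts [hxm h, hxl h]⟩
      ⟨y, by rintro (h | h); exacts [hym h, hy h]⟩ hboth.1 hboth.2
      (SimpleGraph.Adj.reachable (by simpa using hxy))
    cases s
    · exact this.2
    · exact this.1
  cases b
  · exact key x y s hx hxy hy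
  · refine ⟨fun h => ?_, hy⟩
    exact hx.1 (key (y, s) x.1 x.2 h (Γ.adj_symm hxy) hx.2)

theorem not_commuting_symm {p q : WhiteheadPartition Γ} (h : ¬ p.Commuting q) : ¬ q.Commuting p :=
  fun h' => h (Γ.adj_symm h')

theorem base_notMem_lk {p q : WhiteheadPartition Γ} (h : ¬ p.Commuting q) (b : Bool) :
    (p.base b).1 ∉ q.lk := by
  rw [base_fst]
  exact fun h' => h (Γ.adj_symm h')

/-- The letters `m` and `m⁻¹` of `p` are pushed into different sides of `q`, so `m` is a singleton
of `q`. -/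
theorem lk_subset_of_disjoint {p q : WhiteheadPartition Γ} (h : ¬ p.Commuting q) {b c : Bool}
    (h1 : Disjoint (p.side b) (q.side c)) (h2 : Disjoint (p.side !b) (q.side !c)) :
    p.lk ⊆ q.lk := by
  have e1 : p.base b ∈ q.side !c := q.mem_side_not
    (Set.disjoint_left.1 h1 (p.base_mem b)) (base_notMem_lk h b)
  have e2 : p.base (!b) ∈ q.side c := q.mem_side_of_notMem_side_not
    (Set.disjoint_left.1 h2 (p.base_mem _)) (base_notMem_lk h _)
  have hs : p.m.1 ∈ q.single := by
    by_contra hs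
    have e1' : (p.m.1, (p.base b).2) ∈ q.side !c := by rw [← p.base_fst b]; exact e1
    have e2' : (p.m.1, (p.base !b).2) ∈ q.side c := by rw [← p.base_fst !b]; exact e2
    exact q.notMem_side_not e2' (q.mem_side_of_notMem_single hs _ _ _ e1')
  exact q.neighborSet_subset_lk hs

/-- Two different partitions that do not commute have at most one pair of disjoint sides. -/
theorem disjoint_side_unique {p q : WhiteheadPartition Γ} (h : ¬ p.Commuting q)
    (hne : ¬ p.SamePartition q) {b c b' c' : Bool} (h1 : Disjoint (p.side b) (q.side c))
    (h2 : Disjoint (p.side b') (q.side c')) : b' = b ∧ c' = c := by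
  -- Two disjoint pairs cannot share a side: its base letter would lie in neither side of the other
  -- partition, nor in the link.
  have hb : ∀ b c, Disjoint (p.side b) (q.side c) → Disjoint (p.side b) (q.side !c) → False := by
    intro b c h1 h2
    exact Set.disjoint_left.1 h2 (p.base_mem b) (q.mem_side_not
      (Set.disjoint_left.1 h1 (p.base_mem b)) (base_notMem_lk h b))
  have hc : ∀ b c, Disjoint (p.side b) (q.side c) → Disjoint (p.side !b) (q.side c) → False := by
    intro b c h1 h2
    exact Set.disjoint_right.1 h2 (q.base_mem c) (p.mem_side_not
      (Set.disjoint_right.1 h1 (q.base_mem c)) (base_notMem_lk (not_commuting_symm h) c))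
  -- Two complementary disjoint pairs force equal links, and then equal partitions.
  have hbc : Disjoint (p.side !b) (q.side !c) → False := by
    intro h2
    have hl : p.lk = q.lk := Set.Subset.antisymm (lk_subset_of_disjoint h h1 h2)
      (lk_subset_of_disjoint (not_commuting_symm h) h1.symm h2.symm)
    have key : p.side b = q.side !c := by
      ext x
      constructor
      · intro hx
        exact q.mem_side_not (Set.disjoint_left.1 h1 hx) (hl ▸ p.fst_notMem_lk b hx)
      · intro hx
        exact p.mem_side_of_notMem_side_not (Set.disjoint_right.1 h2 hx)
          (hl ▸ q.fst_notMem_lk _ hx)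
    have key' : p.side (!b) = q.side c := by
      ext x
      constructor
      · intro hx
        exact q.mem_side_of_notMem_side_not (Set.disjoint_left.1 h2 hx)
          (hl ▸ p.fst_notMem_lk _ hx)
      · intro hx
        exact p.mem_side_not (Set.disjoint_right.1 h1 hx) (hl ▸ q.fst_notMem_lk _ hx)
    cases b
    · exact hne ⟨_, key⟩
    · exact hne ⟨_, key'⟩
  by_cases e1 : b' = b
  · subst e1
    refine ⟨rfl, ?_⟩
    by_contra e2
    have : c' = !c := by revert e2; cases c <;> cases c' <;> simp
    subst this
    exact hb _ _ h1 h2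
  · have : b' = !b := by revert e1; cases b <;> cases b' <;> simp
    subst this
    by_cases e2 : c' = c
    · subst e2
      exact (hc _ _ h1 h2).elim
    · have : c' = !c := by revert e2; cases c <;> cases c' <;> simp
      subst this
      exact (hbc h2).elim

/-- The side of `p` need not lie in the opposite side of `q`, since it may meet `lk q`. But a letter
there is adjacent to the base of `q`, which would then lie in the side of `p` as well, against the
first disjointness. -/
theorem disjoint_side_trans {p q r : WhiteheadPartition Γ} (h : ¬ p.Commuting q) {b c d : Bool}
    (h1 : Disjoint (p.side b) (q.side c)) (h2 : Disjoint (q.side !c) (r.side d)) :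
    Disjoint (p.side b) (r.side d) := by
  rw [Set.disjoint_left]
  intro x hx hx'
  by_cases hl : x.1 ∈ q.lk
  · have : q.base c ∈ p.side b := by
      have := p.mem_side_of_adj (y := q.m.1) (q.base c).2 hx (Γ.adj_symm hl)
        (fun h' => h h')
      rwa [← q.base_fst c] at this
    exact Set.disjoint_left.1 h1 this (q.base_mem c)
  · exact Set.disjoint_left.1 h2 (q.mem_side_not (Set.disjoint_left.1 h1 hx) hl) hx'

end WhiteheadPartition

/-! ### Gates: where the edges with a given label start -/

section Gates

variable {V : Type u} {ι : Type w} {Γ : SimpleGraph V}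

/-- The partitions are pairwise distinct and compatible. -/
def IsCompatibleFamily (Φ : ι → WhiteheadPartition Γ) : Prop :=
  ∀ i j, i ≠ j → ¬ (Φ i).SamePartition (Φ j) ∧ (Φ i).Compatible (Φ j)

/-- A vertex of `Γ` with the same link as the label. -/
def labelVertex (Φ : ι → WhiteheadPartition Γ) : ι ⊕ V → V
  | Sum.inl i => (Φ i).m.1
  | Sum.inr v => v

theorem labelsCommute_iff (Φ : ι → WhiteheadPartition Γ) (a b : ι ⊕ V) :
    LabelsCommute Φ a b ↔ Γ.Adj (labelVertex Φ a) (labelVertex Φ b) := by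
  rcases a with i | v <;> rcases b with j | w
  · rfl
  · rfl
  · exact Γ.adj_comm _ _
  · rfl

/-- The link of a label. -/
def labelLink (Φ : ι → WhiteheadPartition Γ) (a : ι ⊕ V) : Set V :=
  Γ.neighborSet (labelVertex Φ a)

theorem labelsCommute_iff_mem (Φ : ι → WhiteheadPartition Γ) (a b : ι ⊕ V) :
    LabelsCommute Φ a b ↔ labelVertex Φ a ∈ labelLink Φ b :=
  (labelsCommute_iff Φ a b).trans (Γ.adj_comm _ _)

/-- This inclusion is what makes the matrix of boundaries triangular with respect to links. -/
theorem labelLink_subset_of_mem_crossed {Φ : ι → WhiteheadPartition Γ} {a : ι ⊕ V} {i : ι}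
    (h : i ∈ crossed Φ a) : labelLink Φ a ⊆ (Φ i).lk := by
  rcases a with j | v
  · have : i = j := h
    subst this
    exact subset_rfl
  · exact (Φ i).neighborSet_subset_lk h

theorem switch_of_mem {Φ : ι → WhiteheadPartition Γ} {a : ι ⊕ V} {i : ι} (R : ι → Bool)
    (h : i ∈ crossed Φ a) : switch Φ a R i = !R i := by
  simp [switch, h]

theorem switch_switch (Φ : ι → WhiteheadPartition Γ) (a : ι ⊕ V) (R : ι → Bool) :
    switch Φ a (switch Φ a R) = R := by
  funext i
  simp only [switch]
  split_ifs <;> simp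

theorem switch_inl_self (Φ : ι → WhiteheadPartition Γ) (i : ι) (R : ι → Bool) :
    switch Φ (Sum.inl i) R i = !R i :=
  switch_of_mem R rfl

theorem switch_inl_of_ne (Φ : ι → WhiteheadPartition Γ) {i j : ι} (h : j ≠ i) (R : ι → Bool) :
    switch Φ (Sum.inl i) R j = R j :=
  switch_eq_of_notMem Φ R _ _ h

theorem labelVertex_notMem_lk_of_mem_crossed {Φ : ι → WhiteheadPartition Γ} {a : ι ⊕ V} {i : ι}
    (h : i ∈ crossed Φ a) : labelVertex Φ a ∉ (Φ i).lk := by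
  rcases a with j | v
  · have : i = j := h
    subst this
    exact (Φ i).m_notMem_lk
  · obtain ⟨b, h1, -⟩ := h
    exact (Φ i).fst_notMem_lk b h1

open Classical in
/-- The side of the `j`-th partition in which all edges with label `a` start, if `a` does not
commute with this partition. -/
noncomputable def gateSide (Φ : ι → WhiteheadPartition Γ) : ι ⊕ V → ι → Bool
  | Sum.inl i, j => decide (j ≠ i ∧ ∃ b, Disjoint ((Φ i).side b) ((Φ j).side false))
  | Sum.inr v, j => decide ((v, false) ∉ (Φ j).side false)

open Classical in
/-- The region closest to `R` at which an edge with label `a` starts. -/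
noncomputable def gate (Φ : ι → WhiteheadPartition Γ) (a : ι ⊕ V) (R : ι → Bool) : ι → Bool :=
  fun i => if labelVertex Φ a ∈ (Φ i).lk then R i else gateSide Φ a i

theorem gate_of_mem {Φ : ι → WhiteheadPartition Γ} {a : ι ⊕ V} {i : ι} (R : ι → Bool)
    (h : labelVertex Φ a ∈ (Φ i).lk) : gate Φ a R i = R i := if_pos h

theorem gate_of_notMem {Φ : ι → WhiteheadPartition Γ} {a : ι ⊕ V} {i : ι} (R : ι → Bool)
    (h : labelVertex Φ a ∉ (Φ i).lk) : gate Φ a R i = gateSide Φ a i := if_neg h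

theorem gateSide_inl_self (Φ : ι → WhiteheadPartition Γ) (i : ι) :
    gateSide Φ (Sum.inl i) i = false := by
  simp [gateSide]

theorem mem_side_gateSide_inr {Φ : ι → WhiteheadPartition Γ} {v : V} {j : ι}
    (h : v ∉ (Φ j).lk) : (v, false) ∈ (Φ j).side (gateSide Φ (Sum.inr v) j) := by
  by_cases h' : (v, false) ∈ (Φ j).side false
  · simp [gateSide, h']
  · have := (Φ j).mem_side_not h' h
    simpa [gateSide, h'] using this

variable {Φ : ι → WhiteheadPartition Γ}

theorem IsCompatibleFamily.exists_disjoint (hΦ : IsCompatibleFamily Φ) {i j : ι} (hij : i ≠ j)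
    (h : ¬ (Φ i).Commuting (Φ j)) : ∃ b c, Disjoint ((Φ i).side b) ((Φ j).side c) :=
  (hΦ i j hij).2.resolve_left h

theorem IsCompatibleFamily.unique (hΦ : IsCompatibleFamily Φ) {i j : ι} (hij : i ≠ j)
    (h : ¬ (Φ i).Commuting (Φ j)) {b c b' c' : Bool}
    (h1 : Disjoint ((Φ i).side b) ((Φ j).side c))
    (h2 : Disjoint ((Φ i).side b') ((Φ j).side c')) : b' = b ∧ c' = c :=
  WhiteheadPartition.disjoint_side_unique h (hΦ i j hij).1 h1 h2

theorem IsCompatibleFamily.exists_disjoint_gateSide (hΦ : IsCompatibleFamily Φ) {i j : ι}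
    (hij : i ≠ j) (h : ¬ (Φ i).Commuting (Φ j)) :
    ∃ b, Disjoint ((Φ i).side b) ((Φ j).side !(gateSide Φ (Sum.inl i) j)) := by
  by_cases h' : ∃ b, Disjoint ((Φ i).side b) ((Φ j).side false)
  · simp [gateSide, h', hij.symm]
  · obtain ⟨b, c, hbc⟩ := hΦ.exists_disjoint hij h
    cases c
    · exact (h' ⟨b, hbc⟩).elim
    · refine ⟨b, ?_⟩
      simpa [gateSide, h', hij.symm] using hbc

theorem IsCompatibleFamily.eq_gateSide (hΦ : IsCompatibleFamily Φ) {i j : ι}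
    (hij : i ≠ j) (h : ¬ (Φ i).Commuting (Φ j)) {c : Bool}
    (hc : ∀ b, ¬ Disjoint ((Φ i).side b) ((Φ j).side c)) : c = gateSide Φ (Sum.inl i) j := by
  obtain ⟨b, hb⟩ := hΦ.exists_disjoint_gateSide hij h
  by_contra hne
  have : c = !(gateSide Φ (Sum.inl i) j) := by
    revert hne; cases c <;> cases gateSide Φ (Sum.inl i) j <;> simp
  exact hc b (this ▸ hb)

/-- The unique disjoint pair of sides involves the side opposite to the gate side, so the gate side
allows both choices at `i`. -/
theorem IsCompatibleFamily.not_disjoint_gateSide (hΦ : IsCompatibleFamily Φ) {i j : ι}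
    (hij : i ≠ j) (h : ¬ (Φ i).Commuting (Φ j)) (b : Bool) :
    ¬ Disjoint ((Φ i).side b) ((Φ j).side (gateSide Φ (Sum.inl i) j)) := by
  intro hd
  obtain ⟨b', hb'⟩ := hΦ.exists_disjoint_gateSide hij h
  have := (hΦ.unique hij h hb' hd).2
  simp at this

theorem IsRegion.not_disjoint {R : ι → Bool} (hR : IsRegion Φ R) {i j : ι} (hij : i ≠ j)
    (h : ¬ (Φ i).Commuting (Φ j)) : ¬ Disjoint ((Φ i).side (R i)) ((Φ j).side (R j)) := by
  rw [Set.not_disjoint_iff_nonempty_inter]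
  exact (hR i j hij).resolve_left h

theorem isRegion_iff {R : ι → Bool} : IsRegion Φ R ↔ ∀ i j, i ≠ j →
    ¬ (Φ i).Commuting (Φ j) → ¬ Disjoint ((Φ i).side (R i)) ((Φ j).side (R j)) := by
  refine ⟨fun hR i j => hR.not_disjoint, fun h i j hij => ?_⟩
  rw [or_iff_not_imp_left, ← Set.not_disjoint_iff_nonempty_inter]
  exact h i j hij

/-- For a partition label, both ends of the edge must be regions, so the chosen side of each
non-commuting partition has to meet both sides of the crossed one; only one side does. For `e_v` the
prescribed side is the one containing `v⁻¹`. -/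
theorem IsCompatibleFamily.edgeStarts_iff (hΦ : IsCompatibleFamily Φ) {R : ι → Bool}
    (hR : IsRegion Φ R) (a : ι ⊕ V) :
    EdgeStarts Φ R a ↔ ∀ i, labelVertex Φ a ∉ (Φ i).lk → R i = gateSide Φ a i := by
  rcases a with i | v
  · constructor
    · rintro ⟨h0, h1⟩ j hj
      by_cases hij : i = j
      · subst hij
        rw [h0, gateSide_inl_self]
      · have hnc : ¬ (Φ i).Commuting (Φ j) := fun h => hj (Γ.adj_symm h)
        refine hΦ.eq_gateSide hij hnc fun b => ?_
        cases b
        · have := hR.not_disjoint hij hnc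
          rwa [h0] at this
        · have := h1.not_disjoint hij hnc
          rwa [switch_inl_self, switch_inl_of_ne Φ (Ne.symm hij), h0] at this
    · intro h
      have h0 : R i = false := by
        rw [h i (Φ i).m_notMem_lk, gateSide_inl_self]
      refine ⟨h0, isRegion_iff.2 fun k l hkl hnc => ?_⟩
      have key : ∀ l, i ≠ l → ¬ (Φ i).Commuting (Φ l) → ∀ b,
          ¬ Disjoint ((Φ i).side b) ((Φ l).side (R l)) := by
        intro l hl hnc b
        rw [h l (fun h' => hnc (Γ.adj_symm h'))]
        exact hΦ.not_disjoint_gateSide hl hnc b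
      by_cases hk : k = i
      · subst hk
        rw [switch_inl_of_ne Φ (Ne.symm hkl)]
        exact key l hkl hnc _
      · rw [switch_inl_of_ne Φ hk]
        by_cases hl : l = i
        · subst hl
          rw [disjoint_comm]
          exact key k hkl.symm (WhiteheadPartition.not_commuting_symm hnc) _
        · rw [switch_inl_of_ne Φ hl]
          exact hR.not_disjoint hkl hnc
  · constructor
    · intro h i hi
      exact (Φ i).side_unique ((h i).resolve_right hi) (mem_side_gateSide_inr hi)
    · intro h i
      by_cases hi : v ∈ (Φ i).lk
      · exact Or.inr hi
      · left
        rw [h i hi]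
        exact mem_side_gateSide_inr hi

theorem IsCompatibleFamily.exists_mem_gateSide (hΦ : IsCompatibleFamily Φ) {a : ι ⊕ V} {j : ι}
    (h : labelVertex Φ a ∉ (Φ j).lk) : ∃ s, (labelVertex Φ a, s) ∈ (Φ j).side (gateSide Φ a j) := by
  rcases a with i | v
  · by_cases hij : i = j
    · subst hij
      rw [gateSide_inl_self]
      exact ⟨_, (Φ i).isPair.mem⟩
    · obtain ⟨b, hb⟩ := hΦ.exists_disjoint_gateSide hij (fun h' => h (Γ.adj_symm h'))
      have h1 := Set.disjoint_left.1 hb ((Φ i).base_mem b)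
      have h2 := (Φ j).mem_side_of_notMem_side_not h1 (by rwa [(Φ i).base_fst b])
      refine ⟨((Φ i).base b).2, ?_⟩
      have e : (labelVertex Φ (Sum.inl i), ((Φ i).base b).2) = (Φ i).base b :=
        Prod.ext ((Φ i).base_fst b).symm rfl
      rwa [e]
  · exact ⟨false, mem_side_gateSide_inr h⟩

theorem IsCompatibleFamily.mem_gateSide_of_adj (hΦ : IsCompatibleFamily Φ) {a : ι ⊕ V} {j : ι}
    (h : labelVertex Φ a ∉ (Φ j).lk) {y : V} (hy : Γ.Adj (labelVertex Φ a) y) (hyj : y ∉ (Φ j).lk)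
    (s : Bool) : (y, s) ∈ (Φ j).side (gateSide Φ a j) := by
  obtain ⟨t, ht⟩ := hΦ.exists_mem_gateSide h
  exact (Φ j).mem_side_of_adj s ht hy hyj

/-- Commuting labels have adjacent vertices, and adjacent vertices outside the link lie in the same
side. -/
theorem IsCompatibleFamily.gateSide_eq_of_commute (hΦ : IsCompatibleFamily Φ) {a b : ι ⊕ V}
    {j : ι} (hab : Γ.Adj (labelVertex Φ a) (labelVertex Φ b))
    (ha : labelVertex Φ a ∉ (Φ j).lk) (hb : labelVertex Φ b ∉ (Φ j).lk) :
    gateSide Φ a j = gateSide Φ b j := by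
  obtain ⟨t, ht⟩ := hΦ.exists_mem_gateSide hb
  exact (Φ j).side_unique (hΦ.mem_gateSide_of_adj ha hab hb t) ht

/-- Disjoint gate sides at `j` and `k` would, by transitivity through `j`, make a side of `i`
disjoint from the gate side at `k`. For a vertex label, `v⁻¹` lies in both gate sides. -/
theorem IsCompatibleFamily.gateSide_not_disjoint (hΦ : IsCompatibleFamily Φ) {a : ι ⊕ V} {j k : ι}
    (hjk : j ≠ k) (hnc : ¬ (Φ j).Commuting (Φ k)) (hj : labelVertex Φ a ∉ (Φ j).lk)
    (hk : labelVertex Φ a ∉ (Φ k).lk) :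
    ¬ Disjoint ((Φ j).side (gateSide Φ a j)) ((Φ k).side (gateSide Φ a k)) := by
  rcases a with i | v
  · by_cases hij : i = j
    · subst hij
      exact hΦ.not_disjoint_gateSide hjk hnc _
    by_cases hik : i = k
    · subst hik
      rw [disjoint_comm]
      exact hΦ.not_disjoint_gateSide hjk.symm (WhiteheadPartition.not_commuting_symm hnc) _
    have hnij : ¬ (Φ i).Commuting (Φ j) := fun h => hj (Γ.adj_symm h)
    have hnik : ¬ (Φ i).Commuting (Φ k) := fun h => hk (Γ.adj_symm h)
    obtain ⟨b, hb⟩ := hΦ.exists_disjoint_gateSide hij hnij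
    obtain ⟨c, hc⟩ := hΦ.exists_disjoint_gateSide hik hnik
    intro hd
    have h1 := WhiteheadPartition.disjoint_side_trans hnij hb (by simpa using hd)
    have := (hΦ.unique hik hnik hc h1).2
    simp at this
  · rw [Set.not_disjoint_iff]
    exact ⟨_, mem_side_gateSide_inr hj, mem_side_gateSide_inr hk⟩

/-- If just one of the partitions commutes with `a`, both its base letters are adjacent to the
vertex of `a`, hence lie in the gate side of the other. The disjunctive hypothesis lets gates also
repair choices that are not yet regions. -/
theorem IsCompatibleFamily.gate_not_disjoint (hΦ : IsCompatibleFamily Φ) (a : ι ⊕ V)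
    {R : ι → Bool} {j k : ι}
    (hjk : j ≠ k) (hnc : ¬ (Φ j).Commuting (Φ k)) (h : labelVertex Φ a ∉ (Φ j).lk ∨
      labelVertex Φ a ∉ (Φ k).lk ∨ ¬ Disjoint ((Φ j).side (R j)) ((Φ k).side (R k))) :
    ¬ Disjoint ((Φ j).side (gate Φ a R j)) ((Φ k).side (gate Φ a R k)) := by
  have mixed : ∀ j k, ¬ (Φ j).Commuting (Φ k) → labelVertex Φ a ∉ (Φ j).lk →
      labelVertex Φ a ∈ (Φ k).lk →
      ¬ Disjoint ((Φ j).side (gate Φ a R j)) ((Φ k).side (gate Φ a R k)) := by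
    intro j k hnc hj hk
    rw [gate_of_notMem R hj, Set.not_disjoint_iff]
    refine ⟨(Φ k).base (gate Φ a R k), ?_, (Φ k).base_mem _⟩
    have e : (Φ k).base (gate Φ a R k) = ((Φ k).m.1, ((Φ k).base (gate Φ a R k)).2) :=
      Prod.ext ((Φ k).base_fst _) rfl
    rw [e]
    exact hΦ.mem_gateSide_of_adj hj (Γ.adj_symm hk) (fun h' => hnc h') _
  by_cases hj : labelVertex Φ a ∈ (Φ j).lk
  · by_cases hk : labelVertex Φ a ∈ (Φ k).lk
    · rw [gate_of_mem R hj, gate_of_mem R hk]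
      exact (h.resolve_left (not_not.2 hj)).resolve_left (not_not.2 hk)
    · rw [disjoint_comm]
      exact mixed k j (WhiteheadPartition.not_commuting_symm hnc) hk hj
  · by_cases hk : labelVertex Φ a ∈ (Φ k).lk
    · exact mixed j k hnc hj hk
    · rw [gate_of_notMem R hj, gate_of_notMem R hk]
      exact hΦ.gateSide_not_disjoint hjk hnc hj hk

theorem IsCompatibleFamily.isRegion_gate (hΦ : IsCompatibleFamily Φ) (a : ι ⊕ V)
    {R : ι → Bool} (hR : IsRegion Φ R) : IsRegion Φ (gate Φ a R) :=
  isRegion_iff.2 fun _ _ hij hnc =>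
    hΦ.gate_not_disjoint a hij hnc (Or.inr (Or.inr (hR.not_disjoint hij hnc)))

theorem IsCompatibleFamily.edgeStarts_gate (hΦ : IsCompatibleFamily Φ) (a : ι ⊕ V)
    {R : ι → Bool} (hR : IsRegion Φ R) : EdgeStarts Φ (gate Φ a R) a :=
  (hΦ.edgeStarts_iff (hΦ.isRegion_gate a hR) a).2 fun _ hi => gate_of_notMem R hi

theorem IsCompatibleFamily.exists_isRegion [Finite ι] (hΦ : IsCompatibleFamily Φ) :
    ∃ R, IsRegion Φ R := by
  classical
  have := Fintype.ofFinite ι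
  have key : ∀ s : Finset ι, ∃ R : ι → Bool, ∀ i ∈ s, ∀ j, i ≠ j → ¬ (Φ i).Commuting (Φ j) →
      ¬ Disjoint ((Φ i).side (R i)) ((Φ j).side (R j)) := by
    intro s
    induction s using Finset.induction_on with
    | empty => exact ⟨fun _ => false, by simp⟩
    | insert k s hk ih =>
      obtain ⟨R, hR⟩ := ih
      -- Gating at `k` repairs all pairs that involve `k` and keeps intact the pairs that were
      -- already good.
      refine ⟨gate Φ (Sum.inl k) R, fun i hi j hij hnc => hΦ.gate_not_disjoint _ hij hnc ?_⟩
      rcases Finset.mem_insert.1 hi with rfl | hi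
      · exact Or.inl (Φ i).m_notMem_lk
      · exact Or.inr (Or.inr (hR i hi j hij hnc))
  obtain ⟨R, hR⟩ := key Finset.univ
  exact ⟨R, isRegion_iff.2 fun i j => hR i (Finset.mem_univ i) j⟩

/-- Gates for the labels are applied one after the other; a gate for a label that commutes with `b`
does not disturb the sides that `b` requires. -/
theorem IsCompatibleFamily.exists_edgeStarts_of_pairwise [Finite ι] (hΦ : IsCompatibleFamily Φ)
    {A : Set (ι ⊕ V)} (hA : A.Finite) (hc : A.Pairwise (LabelsCommute Φ)) :
    ∃ R, IsRegion Φ R ∧ ∀ a ∈ A, EdgeStarts Φ R a := by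
  induction A, hA using Set.Finite.induction_on with
  | empty =>
    obtain ⟨R, hR⟩ := hΦ.exists_isRegion
    exact ⟨R, hR, by simp⟩
  | @insert a A ha _ ih =>
    obtain ⟨R, hR, hs⟩ := ih (hc.mono (Set.subset_insert a A))
    refine ⟨gate Φ a R, hΦ.isRegion_gate a hR, ?_⟩
    rintro b (rfl | hb)
    · exact hΦ.edgeStarts_gate b hR
    · refine (hΦ.edgeStarts_iff (hΦ.isRegion_gate a hR) b).2 fun i hi => ?_
      by_cases hai : labelVertex Φ a ∈ (Φ i).lk
      · rw [gate_of_mem R hai]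
        exact (hΦ.edgeStarts_iff hR b).1 (hs b hb) i hi
      · rw [gate_of_notMem R hai]
        refine hΦ.gateSide_eq_of_commute ?_ hai hi
        refine (labelsCommute_iff Φ a b).1 (hc (Set.mem_insert a A) (Set.mem_insert_of_mem a hb) ?_)
        rintro rfl
        exact ha hb

theorem IsCompatibleFamily.edgeStarts_congr (hΦ : IsCompatibleFamily Φ) {R R' : ι → Bool}
    (hR : IsRegion Φ R) (hR' : IsRegion Φ R') {a : ι ⊕ V}
    (h : ∀ i, labelVertex Φ a ∉ (Φ i).lk → R i = R' i) (ha : EdgeStarts Φ R a) :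
    EdgeStarts Φ R' a := by
  rw [hΦ.edgeStarts_iff hR'] 
  rw [hΦ.edgeStarts_iff hR] at ha
  exact fun i hi => (h i hi).symm.trans (ha i hi)

/-- Every partition crossed by `b` has a link containing `lk b`, so it commutes with `a`. -/
theorem switch_eq_of_commute {a b : ι ⊕ V} (hab : LabelsCommute Φ a b) (R : ι → Bool) {i : ι}
    (hi : labelVertex Φ a ∉ (Φ i).lk) : switch Φ b R i = R i := by
  refine switch_eq_of_notMem Φ R b i fun h => hi ?_
  exact labelLink_subset_of_mem_crossed h ((labelsCommute_iff_mem Φ a b).1 hab)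

end Gates

/-! ### Moving between regions one partition at a time -/

section Flips

variable {V : Type u} {ι : Type w} {Γ : SimpleGraph V} {Φ : ι → WhiteheadPartition Γ}

/-- The obstructions to switching a side form a strict partial order, so some partition on which `R`
and `R'` differ is obstructed by no other such partition. One on which they agree cannot obstruct
it, since `R'` is a region. -/
theorem IsCompatibleFamily.exists_flip [Finite ι] (hΦ : IsCompatibleFamily Φ) {R R' : ι → Bool}
    (hR : IsRegion Φ R) (hR' : IsRegion Φ R') (hne : R ≠ R') :
    ∃ i, R i ≠ R' i ∧ IsRegion Φ (switch Φ (Sum.inl i) R) := by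
  -- The side chosen at `j` blocks switching the side at `i`.
  let r : ι → ι → Prop := fun j i => i ≠ j ∧ ¬ (Φ i).Commuting (Φ j) ∧
    Disjoint ((Φ i).side !(R i)) ((Φ j).side (R j))
  have htrans : ∀ k j i, r k j → r j i → r k i := by
    rintro k j i ⟨h1, h2, h3⟩ ⟨h4, h5, h6⟩
    -- Otherwise two complementary pairs of sides of the partitions `i` and `j` would be disjoint.
    have hik : i ≠ k := by
      rintro rfl
      have := hΦ.unique h4 h5 h6 h3.symm
      simp at this
    refine ⟨hik, fun hc => ?_, WhiteheadPartition.disjoint_side_trans h5 h6 h3⟩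
    -- `i` and `k` commute, `j` commutes with none of them
    have e1 : (Φ i).base (!R i) ∈ (Φ j).side !(R j) := (Φ j).mem_side_not
      (Set.disjoint_left.1 h6 ((Φ i).base_mem _)) (WhiteheadPartition.base_notMem_lk h5 _)
    have e2 := (Φ j).mem_side_of_adj (y := (Φ k).m.1) ((Φ k).base (R k)).2 e1
      (by rw [(Φ i).base_fst]; exact hc) (fun h => h2 h)
    rw [← (Φ k).base_fst (R k)] at e2
    exact Set.disjoint_left.1 h3 e2 ((Φ k).base_mem _)
  have hwf : IsStrictOrder ι r :=
    { irrefl := fun i h => h.1 rfl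
      trans := fun k j i => htrans k j i }
  obtain ⟨i, hi, hmin⟩ := (Finite.wellFounded_of_trans_of_irrefl r).has_min
    {i | R i ≠ R' i} (by
      by_contra h
      rw [Set.not_nonempty_iff_eq_empty, Set.eq_empty_iff_forall_notMem] at h
      exact hne (funext fun i => by simpa using h i))
  refine ⟨i, hi, ?_⟩
  have hi' : R' i = !R i := by
    revert hi; change R i ≠ R' i → _; cases R i <;> cases R' i <;> simp
  have key : ∀ j, i ≠ j → ¬ (Φ i).Commuting (Φ j) →
      ¬ Disjoint ((Φ i).side !(R i)) ((Φ j).side (R j)) := by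
    intro j hij hnc hd
    by_cases hj : R j = R' j
    · have := hR'.not_disjoint hij hnc
      rw [hi', ← hj] at this
      exact this hd
    · exact hmin j hj ⟨hij, hnc, hd⟩
  refine isRegion_iff.2 fun k l hkl hnc => ?_
  by_cases hk : k = i
  · subst hk
    rw [switch_inl_self, switch_inl_of_ne Φ (Ne.symm hkl)]
    exact key l hkl hnc
  · rw [switch_inl_of_ne Φ hk]
    by_cases hl : l = i
    · subst hl
      rw [switch_inl_self, disjoint_comm]
      exact key k hkl.symm (WhiteheadPartition.not_commuting_symm hnc)
    · rw [switch_inl_of_ne Φ hl]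
      exact hR.not_disjoint hkl hnc

/-- Any two regions are connected by switching, one by one, the sides of the partitions for which
they differ. -/
theorem IsCompatibleFamily.flip_induction [Finite ι] (hΦ : IsCompatibleFamily Φ)
    {C : (ι → Bool) → Prop} {R' : ι → Bool} (hR' : IsRegion Φ R') (h0 : C R')
    (hstep : ∀ R i, IsRegion Φ R → R i ≠ R' i → IsRegion Φ (switch Φ (Sum.inl i) R) →
      C (switch Φ (Sum.inl i) R) → C R) {R : ι → Bool} (hR : IsRegion Φ R) : C R := by
  classical
  have := Fintype.ofFinite ι
  induction hn : (Finset.univ.filter fun i => R i ≠ R' i).card using Nat.strong_induction_on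
    generalizing R with
  | _ n ih =>
    by_cases hne : R = R'
    · rwa [hne]
    obtain ⟨i, hi, hs⟩ := hΦ.exists_flip hR hR' hne
    refine hstep R i hR hi hs (ih _ ?_ hs rfl)
    rw [← hn]
    refine Finset.card_lt_card ⟨fun j => ?_, fun hsub => ?_⟩
    · simp only [Finset.mem_filter, Finset.mem_univ, true_and]
      intro hj
      by_cases hij : j = i
      · rwa [hij]
      · rwa [switch_inl_of_ne Φ hij] at hj
    · have := hsub (Finset.mem_filter.2 ⟨Finset.mem_univ i, hi⟩)
      simp only [Finset.mem_filter, Finset.mem_univ, true_and, switch_inl_self] at this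
      revert hi this
      cases R i <;> cases R' i <;> simp

end Flips

/-! ### Edge paths in a cube complex -/

namespace CubeComplex

section Paths

variable {Λ : Type u} {X : CubeComplex.{u, v} Λ}

theorem Dart.symm_symm (d : X.Dart) : d.symm.symm = d := by
  cases d
  simp [Dart.symm]

theorem Dart.source_symm (d : X.Dart) : d.symm.source = d.target := rfl

theorem Dart.target_symm (d : X.Dart) : d.symm.target = d.source := by
  rw [← d.symm.source_symm, d.symm_symm]

theorem Dart.ext' {d e : X.Dart} (h1 : d.edge = e.edge) (h2 : d.start = e.start) : d = e := by
  obtain ⟨c, a, h, s⟩ := d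
  obtain ⟨c', a', h', s'⟩ := e
  obtain rfl : c = c' := h1
  obtain rfl : s = s' := h2
  obtain rfl : a = a' := Set.singleton_injective (h.symm.trans h')
  rfl

theorem Dart.isVertex_source (d : X.Dart) : X.IsVertex d.source := by
  change X.dirs (X.face _ _ _) = ∅
  rw [X.dirs_face, d.dirs_eq, Set.sdiff_self]

theorem Dart.isVertex_target (d : X.Dart) : X.IsVertex d.target :=
  d.symm.isVertex_source

theorem isEdgePath_append {p q : List X.Dart} {x y : X.Cube} :
    X.IsEdgePath x (p ++ q) y ↔ ∃ z, X.IsEdgePath x p z ∧ X.IsEdgePath z q y := by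
  induction p generalizing x with
  | nil => simp [IsEdgePath]
  | cons d p ih =>
    simp only [List.cons_append, IsEdgePath, ih]
    constructor
    · rintro ⟨h, z, h1, h2⟩
      exact ⟨z, ⟨h, h1⟩, h2⟩
    · rintro ⟨z, ⟨h, h1⟩, h2⟩
      exact ⟨h, z, h1, h2⟩

/-- The edge path, travelled backwards. -/
def reversePath (p : List X.Dart) : List X.Dart := (p.map Dart.symm).reverse

theorem reversePath_cons (d : X.Dart) (p : List X.Dart) :
    reversePath (d :: p) = reversePath p ++ [d.symm] := by
  simp [reversePath]

theorem isEdgePath_reversePath {p : List X.Dart} {x y : X.Cube} (h : X.IsEdgePath x p y) :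
    X.IsEdgePath y (reversePath p) x := by
  induction p generalizing x with
  | nil => exact Eq.symm h
  | cons d p ih =>
    rw [reversePath_cons, isEdgePath_append]
    exact ⟨_, ih h.2, rfl, d.target_symm.trans h.1⟩

theorem label_of_mem_reversePath {p : List X.Dart} {d : X.Dart} (h : d ∈ reversePath p) :
    ∃ e ∈ p, e.label = d.label := by
  simp only [reversePath, List.mem_reverse, List.mem_map] at h
  obtain ⟨e, he, rfl⟩ := h
  exact ⟨e, he, rfl⟩

theorem Dart.hyperplane_label (d : X.Dart) : d.hyperplane.label = d.label := rfl

end Paths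

end CubeComplex

/-! ### Vertices, edges and hyperplanes of the blowup -/

section BlowupGraph

variable {V : Type u} {ι : Type w} {Γ : SimpleGraph V} {Φ : ι → WhiteheadPartition Γ}

open CubeComplex

/-- The vertex of the blowup given by a region. -/
def vertexCube {R : ι → Bool} (hR : IsRegion Φ R) : BlowupCube Φ where
  region := R
  labels := ∅
  isRegion := hR
  commute := Set.pairwise_empty _
  starts := fun _ h => h.elim

/-- The edge of the blowup starting at a given region. -/
def edgeCube {R : ι → Bool} (hR : IsRegion Φ R) {a : ι ⊕ V} (ha : EdgeStarts Φ R a) :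
    BlowupCube Φ where
  region := R
  labels := {a}
  isRegion := hR
  commute := Set.pairwise_singleton _ _
  starts := by rintro _ rfl; exact ha

/-! ### Connectedness of regions along edges with given labels -/

/-- There is an edge with label in `T` from `R` to `R'`. -/
def LabelStep (Φ : ι → WhiteheadPartition Γ) (T : Set (ι ⊕ V)) (R R' : ι → Bool) : Prop :=
  IsRegion Φ R ∧ ∃ a ∈ T, EdgeStarts Φ R a ∧ R' = switch Φ a R

/-- There is an edge path with labels in `T` from `R` to `R'`. -/
def LabelJoined (Φ : ι → WhiteheadPartition Γ) (T : Set (ι ⊕ V)) : (ι → Bool) → (ι → Bool) → Prop :=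
  Relation.EqvGen (LabelStep Φ T)

theorem LabelJoined.mono {T T' : Set (ι ⊕ V)} (hT : T ⊆ T') {R R' : ι → Bool} (h : LabelJoined Φ T R R') :
    LabelJoined Φ T' R R' :=
  Relation.EqvGen.mono (r := LabelStep Φ T) (p := LabelStep Φ T')
    (fun _ _ ⟨h, a, ha, h'⟩ => ⟨h, a, hT ha, h'⟩) _ _ h

theorem LabelJoined.isRegion_iff {T : Set (ι ⊕ V)} {R R' : ι → Bool} (h : LabelJoined Φ T R R') :
    IsRegion Φ R ↔ IsRegion Φ R' := by
  induction h with
  | rel R R' h =>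
    obtain ⟨h, a, -, ha, rfl⟩ := h
    exact ⟨fun _ => isRegion_switch Φ R h a ha, fun _ => h⟩
  | refl => rfl
  | symm _ _ _ ih => exact ih.symm
  | trans _ _ _ _ _ ih1 ih2 => exact ih1.trans ih2

variable [Finite V] [Finite ι]

theorem blowup_face_region (c : BlowupCube Φ) {a : ι ⊕ V} (ha : a ∈ c.labels) (ε : Bool) :
    BlowupCube.region ((blowup Φ).face c a ε) = if ε = true then switch Φ a c.region else c.region := by
  simp [blowup, ha]

theorem blowup_face_labels (c : BlowupCube Φ) (a : ι ⊕ V) (ε : Bool) :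
    BlowupCube.labels ((blowup Φ).face c a ε) = c.labels \ {a} := rfl

theorem blowup_face_eq {c d : BlowupCube Φ} {a : ι ⊕ V} (ha : a ∈ c.labels) {ε : Bool}
    (h1 : (if ε = true then switch Φ a c.region else c.region) = d.region)
    (h2 : c.labels \ {a} = d.labels) : (blowup Φ).face c a ε = d :=
  BlowupCube.ext' ((blowup_face_region c ha ε).trans h1) h2

theorem isVertex_vertexCube {R : ι → Bool} (hR : IsRegion Φ R) :
    (blowup Φ).IsVertex (vertexCube hR) := rfl

theorem eq_vertexCube {c : (blowup Φ).Cube} (hc : (blowup Φ).IsVertex c) :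
    c = vertexCube (BlowupCube.isRegion c) :=
  BlowupCube.ext' rfl hc

/-- The edge of the blowup starting at a given region, with a direction of travel. -/
def edgeDart {R : ι → Bool} (hR : IsRegion Φ R) {a : ι ⊕ V} (ha : EdgeStarts Φ R a)
    (s : Bool) : (blowup Φ).Dart where
  edge := edgeCube hR ha
  label := a
  dirs_eq := rfl
  start := s

theorem edgeDart_source {R : ι → Bool} (hR : IsRegion Φ R) {a : ι ⊕ V} (ha : EdgeStarts Φ R a) :
    (edgeDart hR ha false).source = vertexCube hR :=
  blowup_face_eq (c := edgeCube hR ha) (Set.mem_singleton a) rfl (Set.sdiff_self)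

theorem edgeDart_target {R : ι → Bool} (hR : IsRegion Φ R) {a : ι ⊕ V} (ha : EdgeStarts Φ R a) :
    (edgeDart hR ha false).target = vertexCube (isRegion_switch Φ R hR a ha) :=
  blowup_face_eq (c := edgeCube hR ha) (Set.mem_singleton a) rfl (Set.sdiff_self)

theorem dart_starts (d : (blowup Φ).Dart) : EdgeStarts Φ (BlowupCube.region d.edge) d.label := by
  refine BlowupCube.starts d.edge _ ?_
  have : BlowupCube.labels d.edge = {d.label} := d.dirs_eq
  rw [this]
  rfl

theorem dart_source_region (d : (blowup Φ).Dart) : BlowupCube.region d.source =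
    if d.start = true then switch Φ d.label (BlowupCube.region d.edge)
    else BlowupCube.region d.edge := by
  refine blowup_face_region d.edge ?_ d.start
  have : BlowupCube.labels d.edge = {d.label} := d.dirs_eq
  rw [this]
  rfl

theorem dart_target_region (d : (blowup Φ).Dart) : BlowupCube.region d.target =
    switch Φ d.label (BlowupCube.region d.source) := by
  rw [← d.source_symm, dart_source_region, dart_source_region]
  change (if (!d.start) = true then switch Φ d.label (BlowupCube.region d.edge)
    else BlowupCube.region d.edge) = _
  cases d.start <;> simp [switch_switch]

/-! ### Hyperplanes of the blowup are given by their labels -/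

/-- The two edges are opposite sides of the square at `R` with labels `a` and `b`. -/
theorem hyperplane_edge_eq {R : ι → Bool} (hR : IsRegion Φ R) {a b : ι ⊕ V}
    (ha : EdgeStarts Φ R a) (hb : EdgeStarts Φ R b) (hab : a ≠ b) (hc : LabelsCommute Φ a b)
    (hR' : IsRegion Φ (switch Φ b R)) (ha' : EdgeStarts Φ (switch Φ b R) a) :
    (edgeDart hR ha false).hyperplane = (edgeDart hR' ha' false).hyperplane := by
  let c : BlowupCube Φ :=
    { region := R
      labels := {a, b}
      isRegion := hR
      commute := by
        rw [Set.pairwise_pair]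
        exact fun _ => ⟨hc, (labelsCommute_iff Φ b a).2
          (Γ.adj_symm ((labelsCommute_iff Φ a b).1 hc))⟩
      starts := by rintro _ (rfl | rfl) <;> assumption }
  have hb' : b ∈ c.labels := Or.inr rfl
  have hd : c.labels \ {b} = {a} := by
    ext x
    simp only [c, Set.mem_sdiff, Set.mem_insert_iff, Set.mem_singleton_iff]
    constructor
    · rintro ⟨h | h, h'⟩
      · exact h
      · exact (h' h).elim
    · rintro rfl
      exact ⟨Or.inl rfl, hab⟩
  let p : (blowup Φ).Midcube := ⟨c, a, Or.inl rfl⟩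
  have e1 : p.hyperplane = (edgeDart hR ha false).hyperplane :=
    Quot.sound ⟨rfl, b, false, hab.symm, (blowup_face_eq (c := c) hb' rfl hd).symm⟩
  have e2 : p.hyperplane = (edgeDart hR' ha' false).hyperplane :=
    Quot.sound ⟨rfl, b, true, hab.symm, (blowup_face_eq (c := c) hb' rfl hd).symm⟩
  rw [← e1, e2]

/-- Both regions choose the gate sides of `a`, so the flips that connect them only concern
partitions that commute with `a`. Each flip sweeps the edge across a square. -/
theorem IsCompatibleFamily.hyperplane_edge_unique (hΦ : IsCompatibleFamily Φ) {R R' : ι → Bool}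
    (hR : IsRegion Φ R) (hR' : IsRegion Φ R') {a : ι ⊕ V} (ha : EdgeStarts Φ R a)
    (ha' : EdgeStarts Φ R' a) :
    (edgeDart hR ha false).hyperplane = (edgeDart hR' ha' false).hyperplane := by
  have key := hΦ.flip_induction (C := fun R => ∀ (hR : IsRegion Φ R) (ha : EdgeStarts Φ R a),
    (edgeDart hR ha false).hyperplane = (edgeDart hR' ha' false).hyperplane) hR'
    (fun _ _ => rfl) ?_ hR
  · exact key hR ha
  intro R i hR hi hS ih _ ha
  have hai : labelVertex Φ a ∈ (Φ i).lk := by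
    by_contra h
    exact hi (((hΦ.edgeStarts_iff hR a).1 ha i h).trans ((hΦ.edgeStarts_iff hR' a).1 ha' i h).symm)
  have hne : a ≠ Sum.inl i := by
    rintro rfl
    exact (Φ i).m_notMem_lk hai
  have hc : LabelsCommute Φ a (Sum.inl i) := (labelsCommute_iff_mem Φ _ _).2 hai
  have hSa : EdgeStarts Φ (switch Φ (Sum.inl i) R) a := by
    refine hΦ.edgeStarts_congr hR hS (fun j hj => ?_) ha
    exact (switch_eq_of_commute hc R hj).symm
  rw [← ih hS hSa]
  by_cases h0 : R i = false
  · exact hyperplane_edge_eq hR ha (b := Sum.inl i) ⟨h0, hS⟩ hne hc hS hSa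
  -- The edge across the `i`-th partition starts at the switched region, so the square is based
  -- there.
  · have hb : EdgeStarts Φ (switch Φ (Sum.inl i) R) (Sum.inl i) :=
      ⟨by rw [switch_inl_self]; simpa using h0, by rwa [switch_switch]⟩
    have := hyperplane_edge_eq hS hSa hb hne hc (by rwa [switch_switch]) (by rwa [switch_switch])
    rw [this]
    congr 1
    refine Dart.ext' (BlowupCube.ext' ?_ rfl) rfl
    exact (switch_switch Φ _ R).symm

/-- Repeatedly taking the faces on which the other coordinates are `0` leads to the edge at the
initial corner of the cube. -/
theorem hyperplane_eq_edge (p : (blowup Φ).Midcube) :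
    p.hyperplane = (edgeDart (BlowupCube.isRegion p.cube)
      (BlowupCube.starts p.cube _ p.mem) false).hyperplane := by
  induction hn : (BlowupCube.labels p.cube \ {p.dir}).ncard using Nat.strong_induction_on
    generalizing p with
  | _ n ih =>
    rcases Set.eq_empty_or_nonempty (BlowupCube.labels p.cube \ {p.dir}) with h | ⟨b, hb, hbd⟩
    · refine congrArg Midcube.hyperplane (Midcube.ext' (BlowupCube.ext' rfl ?_) rfl)
      exact Set.Subset.antisymm (Set.sdiff_eq_empty.1 h) (Set.singleton_subset_iff.2 p.mem)
    · have hne : b ≠ p.dir := hbd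
      have e := ih _ ?_ (p.face b false) rfl
      · rw [← p.hyperplane_face b false, e]
        congr 1
        refine Dart.ext' (BlowupCube.ext' ?_ rfl) rfl
        change BlowupCube.region (p.face b false).cube = _
        rw [p.face_cube false hne, blowup_face_region _ hb]
        rfl
      · have hl : BlowupCube.labels (p.face b false).cube = BlowupCube.labels p.cube \ {b} :=
          congrArg BlowupCube.labels (p.face_cube false hne)
        rw [← hn, hl]
        refine Set.ncard_lt_ncard ⟨fun x hx => ⟨hx.1.1, hx.2⟩, fun h => ?_⟩ (Set.toFinite _)
        exact (h ⟨hb, hne⟩).1.2 rfl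

theorem IsCompatibleFamily.hyperplane_ext (hΦ : IsCompatibleFamily Φ)
    {H H' : (blowup Φ).Hyperplane} (h : H.label = H'.label) : H = H' := by
  obtain ⟨p, rfl⟩ := Quot.exists_rep H
  obtain ⟨q, rfl⟩ := Quot.exists_rep H'
  obtain ⟨c, a, ha⟩ := p
  obtain ⟨d, b, hb⟩ := q
  obtain rfl : a = b := h
  exact (hyperplane_eq_edge ⟨c, a, ha⟩).trans
    ((hΦ.hyperplane_edge_unique _ _ _ _).trans (hyperplane_eq_edge ⟨d, a, hb⟩).symm)

theorem IsCompatibleFamily.exists_hyperplane (hΦ : IsCompatibleFamily Φ) (a : ι ⊕ V) :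
    ∃ H : (blowup Φ).Hyperplane, H.label = a := by
  obtain ⟨R, hR⟩ := hΦ.exists_isRegion
  exact ⟨(edgeDart (hΦ.isRegion_gate a hR) (hΦ.edgeStarts_gate a hR) false).hyperplane, rfl⟩

/-- The labels of the hyperplanes in a set. -/
def hyperplaneLabels (𝓗 : Set (blowup Φ).Hyperplane) : Set (ι ⊕ V) := Hyperplane.label '' 𝓗

theorem IsCompatibleFamily.mem_iff_label_mem (hΦ : IsCompatibleFamily Φ)
    {𝓗 : Set (blowup Φ).Hyperplane} {H : (blowup Φ).Hyperplane} :
    H ∈ 𝓗 ↔ H.label ∈ hyperplaneLabels 𝓗 := by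
  refine ⟨fun h => ⟨H, h, rfl⟩, ?_⟩
  rintro ⟨H', h, e⟩
  rwa [← hΦ.hyperplane_ext e]

theorem labelJoined_of_dart {T : Set (ι ⊕ V)} (d : (blowup Φ).Dart) (hd : d.label ∈ T) :
    LabelJoined Φ T (BlowupCube.region d.source) (BlowupCube.region d.target) := by
  have key : LabelStep Φ T (BlowupCube.region d.edge)
      (switch Φ d.label (BlowupCube.region d.edge)) :=
    ⟨BlowupCube.isRegion d.edge, _, hd, dart_starts d, rfl⟩
  rw [dart_target_region, dart_source_region]
  cases d.start
  · exact .rel _ _ key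
  · simp only [if_true, switch_switch]
    exact .symm _ _ (.rel _ _ key)

theorem labelJoined_of_isEdgePath {T : Set (ι ⊕ V)} {p : List (blowup Φ).Dart} {x y : (blowup Φ).Cube}
    (h : (blowup Φ).IsEdgePath x p y) (hp : ∀ d ∈ p, d.label ∈ T) :
    LabelJoined Φ T (BlowupCube.region x) (BlowupCube.region y) := by
  induction p generalizing x with
  | nil =>
    rw [show x = y from h]
    exact .refl _
  | cons d p ih =>
    refine .trans _ _ _ ?_ (ih h.2 fun e he => hp e (List.mem_cons_of_mem d he))
    rw [← h.1]
    exact labelJoined_of_dart d (hp d List.mem_cons_self)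

theorem LabelJoined.exists_isEdgePath {T : Set (ι ⊕ V)} {R R' : ι → Bool} (h : LabelJoined Φ T R R')
    (hR : IsRegion Φ R) (hR' : IsRegion Φ R') :
    ∃ p : List (blowup Φ).Dart, (blowup Φ).IsEdgePath (vertexCube hR) p (vertexCube hR') ∧
      ∀ d ∈ p, d.label ∈ T := by
  induction h with
  | rel R R' h =>
    obtain ⟨h, a, ha, hs, rfl⟩ := h
    refine ⟨[edgeDart hR hs false], ⟨edgeDart_source hR hs, edgeDart_target hR hs⟩, ?_⟩
    intro d hd
    rw [List.mem_singleton.1 hd]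
    exact ha
  | refl => exact ⟨[], rfl, by simp⟩
  | symm _ _ _ ih =>
    obtain ⟨p, hp, hp'⟩ := ih hR' hR
    refine ⟨reversePath p, isEdgePath_reversePath hp, fun d hd => ?_⟩
    obtain ⟨e, he, h⟩ := label_of_mem_reversePath hd
    exact h ▸ hp' e he
  | trans R S R' h1 _ ih1 ih2 =>
    have hS := (LabelJoined.isRegion_iff h1).1 hR
    obtain ⟨p, hp, hp'⟩ := ih1 hR hS
    obtain ⟨q, hq, hq'⟩ := ih2 hS hR'
    refine ⟨p ++ q, isEdgePath_append.2 ⟨_, hp, hq⟩, fun d hd => ?_⟩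
    rcases List.mem_append.1 hd with hd | hd
    · exact hp' d hd
    · exact hq' d hd

end BlowupGraph

/-! ### Splitting lists -/

section Lists

variable {α : Type u}

theorem List.exists_split_of_mem {P : α → Prop} {l : List α} (h : ∃ x ∈ l, P x) :
    ∃ l₁ x l₂, l = l₁ ++ x :: l₂ ∧ P x ∧ ∀ y ∈ l₁, ¬ P y := by
  induction l with
  | nil => simp at h
  | cons a l ih =>
    by_cases ha : P a
    · exact ⟨[], a, l, rfl, ha, by simp⟩
    · obtain ⟨l₁, x, l₂, rfl, hx, h1⟩ := ih (by
        obtain ⟨x, hx, hP⟩ := h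
        rcases List.mem_cons.1 hx with rfl | hx
        · exact (ha hP).elim
        · exact ⟨x, hx, hP⟩)
      refine ⟨a :: l₁, x, l₂, rfl, hx, fun y hy => ?_⟩
      rcases List.mem_cons.1 hy with rfl | hy
      · exact ha
      · exact h1 y hy

theorem List.exists_split_of_not_isChain {R : α → α → Prop} {l : List α} (h : ¬ l.IsChain R) :
    ∃ l₁ x y l₂, l = l₁ ++ x :: y :: l₂ ∧ ¬ R x y := by
  induction l with
  | nil => exact (h List.IsChain.nil).elim
  | cons a l ih =>
    cases l with
    | nil => exact (h (List.IsChain.singleton a)).elim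
    | cons b l =>
      by_cases hab : R a b
      · obtain ⟨l₁, x, y, l₂, h1, h2⟩ := ih fun h' => h (List.isChain_cons_cons.2 ⟨hab, h'⟩)
        exact ⟨a :: l₁, x, y, l₂, by rw [h1]; rfl, h2⟩
      · exact ⟨[], a, b, l, rfl, hab⟩

end Lists

/-! ### Boundary vectors: maximal trees as bases -/

section Boundary

variable {V : Type u} {ι : Type w} {Γ : SimpleGraph V}

open CubeComplex

/-- The indicator function of the partitions of which a region chooses the side `P*`. -/
def regionVec (R : ι → Bool) : ι → ℚ := fun i => if R i = true then 1 else 0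

open Classical in
/-- The change of `regionVec` along the edges with a given label. -/
noncomputable def boundary (Φ : ι → WhiteheadPartition Γ) : ι ⊕ V → ι → ℚ
  | Sum.inl i => Pi.single i 1
  | Sum.inr v => fun i => (if (v, true) ∈ (Φ i).side true then 1 else 0) -
      (if (v, false) ∈ (Φ i).side true then 1 else 0)

variable {Φ : ι → WhiteheadPartition Γ}

theorem boundary_of_notMem_crossed {a : ι ⊕ V} {i : ι} (h : i ∉ crossed Φ a) :
    boundary Φ a i = 0 := by
  classical
  rcases a with j | v
  · exact Pi.single_eq_of_ne h 1
  · have hv : v ∉ (Φ i).single := h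
    have : (v, true) ∈ (Φ i).side true ↔ (v, false) ∈ (Φ i).side true :=
      ⟨(Φ i).mem_side_of_notMem_single hv _ _ _, (Φ i).mem_side_of_notMem_single hv _ _ _⟩
    simp [boundary, this]

/-- The change does not depend on the region: a crossed partition is always crossed in the same
direction, from its side `P` for its own label and from the side of `v⁻¹` for `e_v`. -/
theorem regionVec_switch_sub {R : ι → Bool} {a : ι ⊕ V} (h : EdgeStarts Φ R a) :
    regionVec (switch Φ a R) - regionVec R = boundary Φ a := by
  classical
  funext i
  by_cases hi : i ∈ crossed Φ a
  · simp only [Pi.sub_apply, regionVec, switch_of_mem R hi]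
    rcases a with j | v
    · obtain rfl : i = j := hi
      simp [boundary, h.1]
    · have hl : v ∉ (Φ i).lk := labelVertex_notMem_lk_of_mem_crossed hi
      have h1 : (v, false) ∈ (Φ i).side (R i) := (h i).resolve_right hl
      have h2 : (v, true) ∈ (Φ i).side !(R i) := by
        refine (Φ i).mem_side_not (fun h' => ?_) hl
        obtain ⟨b, hb, hb'⟩ := hi
        have e1 := (Φ i).side_unique hb h'
        have e2 := (Φ i).side_unique hb' h1
        rw [e1] at e2
        simp at e2
      cases hR : R i
      · rw [hR] at h1 h2
        have h3 := (Φ i).notMem_side_not h1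
        simp only [Bool.not_false] at h2 h3
        simp [boundary, h2, h3]
      · rw [hR] at h1 h2
        have h3 := (Φ i).notMem_side_not h2
        simp only [Bool.not_true, Bool.not_false] at h2 h3
        simp [boundary, h1, h3]
  · simp only [Pi.sub_apply, regionVec, switch_eq_of_notMem Φ R a i hi,
      boundary_of_notMem_crossed hi, sub_self]

theorem LabelJoined.regionVec_sub_mem {T : Set (ι ⊕ V)} {R R' : ι → Bool}
    (h : LabelJoined Φ T R R') :
    regionVec R' - regionVec R ∈ Submodule.span ℚ (boundary Φ '' T) := by
  induction h with
  | rel R R' h =>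
    obtain ⟨-, a, ha, hs, rfl⟩ := h
    rw [regionVec_switch_sub hs]
    exact Submodule.subset_span ⟨a, ha, rfl⟩
  | refl => simp
  | symm _ _ _ ih => rw [← neg_sub]; exact Submodule.neg_mem _ ih
  | trans _ _ _ _ _ ih1 ih2 =>
    rw [← sub_add_sub_cancel]
    exact Submodule.add_mem _ ih2 ih1

variable [Finite ι]

/-- Each standard basis vector is the difference of the ends of an edge labelled by the partition,
and these ends are joined by labels in `T`. -/
theorem IsCompatibleFamily.span_boundary_eq_top (hΦ : IsCompatibleFamily Φ) {T : Set (ι ⊕ V)}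
    (h : ∀ R R', IsRegion Φ R → IsRegion Φ R' → LabelJoined Φ T R R') :
    Submodule.span ℚ (boundary Φ '' T) = ⊤ := by
  classical
  rw [eq_top_iff, ← (Pi.basisFun ℚ ι).span_eq, Submodule.span_le]
  rintro _ ⟨i, rfl⟩
  obtain ⟨R, hR⟩ := hΦ.exists_isRegion
  have hs := hΦ.edgeStarts_gate (Sum.inl i) hR
  have hR' := hΦ.isRegion_gate (Sum.inl i) hR
  have := (h _ _ hR' (isRegion_switch Φ _ hR' _ hs)).regionVec_sub_mem
  rw [regionVec_switch_sub hs] at this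
  rw [Pi.basisFun_apply, SetLike.mem_coe]
  simpa only [boundary] using this

/-- If no two of the partitions commute, then each function on the regions is affine. -/
theorem IsCompatibleFamily.exists_affine (hΦ : IsCompatibleFamily Φ)
    (hN : ∀ i j, ¬ (Φ i).Commuting (Φ j)) (f : (ι → Bool) → ℚ) :
    ∃ φ : (ι → ℚ) →ₗ[ℚ] ℚ, ∀ R R', IsRegion Φ R → IsRegion Φ R' →
      f R' - f R = φ (regionVec R' - regionVec R) := by
  classical
  -- The slope of `f` across the only edge with label `Sum.inl i`.
  let c : ι → ℚ := fun i => f (switch Φ (Sum.inl i) (gateSide Φ (Sum.inl i))) -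
    f (gateSide Φ (Sum.inl i))
  let φ : (ι → ℚ) →ₗ[ℚ] ℚ := (Pi.basisFun ℚ ι).constr ℚ c
  have hφ : ∀ i, φ (boundary Φ (Sum.inl i)) = c i := by
    intro i
    have := (Pi.basisFun ℚ ι).constr_basis ℚ c i
    rw [Pi.basisFun_apply] at this
    simpa only [boundary] using this
  have hedge : ∀ R i, IsRegion Φ R → EdgeStarts Φ R (Sum.inl i) →
      f (switch Φ (Sum.inl i) R) - f R = φ (regionVec (switch Φ (Sum.inl i) R) - regionVec R) := by
    intro R i hR hs
    -- Since no partition commutes with the `i`-th, the starting region of its edge is completely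
    -- prescribed.
    have : R = gateSide Φ (Sum.inl i) := funext fun j =>
      (hΦ.edgeStarts_iff hR _).1 hs j (hN j i)
    rw [regionVec_switch_sub hs, hφ, this]
  refine ⟨φ, fun R R' hR hR' => ?_⟩
  refine hΦ.flip_induction (C := fun R => f R' - f R = φ (regionVec R' - regionVec R)) hR'
    (by simp) ?_ hR
  intro R i hR _ hS ih
  have key : f (switch Φ (Sum.inl i) R) - f R =
      φ (regionVec (switch Φ (Sum.inl i) R) - regionVec R) := by
    cases h0 : R i
    · exact hedge R i hR ⟨h0, hS⟩
    · have := hedge (switch Φ (Sum.inl i) R) i hS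
        ⟨by rw [switch_inl_self, h0]; rfl, by rwa [switch_switch]⟩
      rw [switch_switch] at this
      rw [← neg_sub, this, ← map_neg, neg_sub]
  rw [← sub_add_sub_cancel, key, ih, ← map_add, sub_add_sub_cancel]

/-- The indicator function of the component of `R` is affine; its linear part vanishes on the
boundaries of `T`, hence everywhere, so the function is constant. -/
theorem IsCompatibleFamily.labelJoined_of_span (hΦ : IsCompatibleFamily Φ)
    (hN : ∀ i j, ¬ (Φ i).Commuting (Φ j)) {T : Set (ι ⊕ V)}
    (hT : Submodule.span ℚ (boundary Φ '' T) = ⊤) (R R' : ι → Bool) (hR : IsRegion Φ R)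
    (hR' : IsRegion Φ R') : LabelJoined Φ T R R' := by
  classical
  obtain ⟨φ, hφ⟩ := hΦ.exists_affine hN fun S => if LabelJoined Φ T R S then 1 else 0
  have h0 : φ = 0 := by
    rw [← LinearMap.ker_eq_top, eq_top_iff, ← hT, Submodule.span_le]
    rintro _ ⟨a, ha, rfl⟩
    have hs := hΦ.edgeStarts_gate a hR
    have hS := hΦ.isRegion_gate a hR
    have := hφ _ _ hS (isRegion_switch Φ _ hS _ hs)
    rw [regionVec_switch_sub hs] at this
    rw [SetLike.mem_coe, LinearMap.mem_ker, ← this]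
    have h1 : LabelJoined Φ T (gate Φ a R) (switch Φ a (gate Φ a R)) :=
      .rel _ _ ⟨hS, a, ha, hs, rfl⟩
    have h2 : LabelJoined Φ T R (switch Φ a (gate Φ a R)) ↔ LabelJoined Φ T R (gate Φ a R) :=
      ⟨fun h => .trans _ _ _ h (.symm _ _ h1), fun h => .trans _ _ _ h h1⟩
    simp only [h2, sub_self]
  have := hφ R R' hR hR'
  rw [h0] at this
  have h1 : LabelJoined Φ T R R := .refl _
  by_contra h2
  simp [h1, h2] at this

variable [Finite V]

theorem dart_regionVec_of_start_false (d : (blowup Φ).Dart) (h : d.start = false) :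
    regionVec (BlowupCube.region d.target) - regionVec (BlowupCube.region d.source) =
      boundary Φ d.label := by
  rw [dart_target_region, dart_source_region, h]
  exact regionVec_switch_sub (dart_starts d)

theorem dart_regionVec_of_start_true (d : (blowup Φ).Dart) (h : d.start = true) :
    regionVec (BlowupCube.region d.target) - regionVec (BlowupCube.region d.source) =
      -boundary Φ d.label := by
  rw [dart_target_region, dart_source_region, h]
  simp only [if_true, switch_switch]
  rw [← regionVec_switch_sub (dart_starts d), neg_sub]

theorem dart_regionVec_eq_of_boundary (ψ : (ι → ℚ) →ₗ[ℚ] ℚ) (d : (blowup Φ).Dart)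
    (h : ψ (boundary Φ d.label) = 0) :
    ψ (regionVec (BlowupCube.region d.target)) = ψ (regionVec (BlowupCube.region d.source)) := by
  rw [← sub_eq_zero, ← map_sub]
  cases hs : d.start
  · rw [dart_regionVec_of_start_false d hs, h]
  · rw [dart_regionVec_of_start_true d hs, map_neg, h, neg_zero]

theorem isEdgePath_regionVec_eq (ψ : (ι → ℚ) →ₗ[ℚ] ℚ) {p : List (blowup Φ).Dart}
    {x y : (blowup Φ).Cube} (hp : (blowup Φ).IsEdgePath x p y)
    (h : ∀ d ∈ p, ψ (boundary Φ d.label) = 0) :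
    ψ (regionVec (BlowupCube.region y)) = ψ (regionVec (BlowupCube.region x)) := by
  induction p generalizing x with
  | nil => rw [show x = y from hp]
  | cons d p ih =>
    rw [ih hp.2 fun e he => h e (List.mem_cons_of_mem d he),
      dart_regionVec_eq_of_boundary ψ d (h d List.mem_cons_self), hp.1]

theorem exists_dual_of_linearIndepOn {κ E : Type*} [AddCommGroup E] [Module ℚ E] {f : κ → E}
    {s : Set κ} (h : LinearIndepOn ℚ f s) {t : κ} (ht : t ∈ s) :
    ∃ ψ : E →ₗ[ℚ] ℚ, ψ (f t) = 1 ∧ ∀ a ∈ s, a ≠ t → ψ (f a) = 0 := by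
  classical
  have h' : LinearIndependent ℚ (fun x : s => f x) := h
  let b := Module.Basis.span h'
  obtain ⟨ψ, hψ⟩ := LinearMap.exists_extend (b.coord ⟨t, ht⟩)
  have key : ∀ a : s, ψ (f a) = b.coord ⟨t, ht⟩ (b a) := by
    intro a
    rw [← hψ, LinearMap.comp_apply, Submodule.subtype_apply]
    exact congrArg (fun y => ψ (Subtype.val y)) (Module.Basis.span_apply h' a).symm
  refine ⟨ψ, by simp [key ⟨t, ht⟩], fun a ha hat => ?_⟩
  rw [key ⟨a, ha⟩, Module.Basis.coord_apply, Module.Basis.repr_self, Finsupp.single_eq_of_ne]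
  exact fun e => hat (congrArg Subtype.val e).symm

/-- A functional dual to the label of the first edge changes along that edge, so the label must
recur. The hypothesis `hT` leaves only one edge with this label, and its next passage must be
backwards. The piece in between is a shorter closed path, hence empty by induction, and a backtrack
appears. -/
theorem IsCompatibleFamily.acyclic_of_linearIndepOn (hΦ : IsCompatibleFamily Φ) {T : Set (ι ⊕ V)}
    (hT : ∀ a ∈ T, ∀ i, labelVertex Φ a ∉ (Φ i).lk) (hli : LinearIndepOn ℚ (boundary Φ) T)
    (x : (blowup Φ).Cube) (p : List (blowup Φ).Dart) (hp : (blowup Φ).IsEdgePath x p x)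
    (hpT : ∀ d ∈ p, d.label ∈ T) (hc : p.IsChain fun d e => e ≠ d.symm) : p = [] := by
  induction hn : p.length using Nat.strong_induction_on generalizing p x with
  | _ n ih =>
    rcases p with _ | ⟨d, p⟩
    · rfl
    exfalso
    have hd := hpT d List.mem_cons_self
    obtain ⟨ψ, h1, h0⟩ := exists_dual_of_linearIndepOn hli hd
    have hne : ψ (regionVec (BlowupCube.region d.target)) ≠
        ψ (regionVec (BlowupCube.region d.source)) := by
      rw [← sub_ne_zero, ← map_sub]
      cases hs : d.start
      · rw [dart_regionVec_of_start_false d hs, h1]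
        norm_num
      · rw [dart_regionVec_of_start_true d hs, map_neg, h1]
        norm_num
    obtain ⟨rfl, hp2⟩ := hp
    have hex : ∃ e ∈ p, e.label = d.label := by
      by_contra hex
      push Not at hex
      exact hne (isEdgePath_regionVec_eq ψ hp2 fun e he =>
        h0 _ (hpT e (List.mem_cons_of_mem d he)) (hex e he)).symm
    obtain ⟨q, e, r, rfl, he, hq⟩ := List.exists_split_of_mem hex
    obtain ⟨z, hz1, hz2, -⟩ := isEdgePath_append.1 hp2
    have hz := isEdgePath_regionVec_eq ψ hz1 fun e he => h0 _ (hpT e (by simp [he])) (hq e he)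
    -- Every partition is non-commuting with this label, so its sides at the start of the edge are
    -- all prescribed.
    have hedge : e.edge = d.edge := by
      refine BlowupCube.ext' (funext fun i => ?_) ?_
      · rw [(hΦ.edgeStarts_iff (BlowupCube.isRegion e.edge) _).1 (dart_starts e) i
          (he ▸ hT _ hd i), (hΦ.edgeStarts_iff (BlowupCube.isRegion d.edge) _).1 (dart_starts d) i
          (hT _ hd i), he]
      · exact e.dirs_eq.trans (he ▸ d.dirs_eq.symm)
    -- A second passage in the same direction would start at the wrong value of `ψ`, which has not
    -- changed along `q`.
    have hes : e = d.symm := by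
      refine Dart.ext' hedge ?_
      by_contra hs
      have hs' : e.start = d.start := by
        revert hs
        change e.start ≠ !d.start → _
        cases e.start <;> cases d.start <;> simp
      rw [Dart.ext' hedge hs'] at hz2
      rw [hz2] at hne
      exact hne hz.symm
    subst hes
    have hz3 : d.target = z := hz2
    subst hz3
    have hq0 : q = [] := by
      refine ih _ ?_ _ q hz1 (fun e he => hpT e (by simp [he])) ?_ rfl
      · rw [← hn]
        simp
      · exact (hc.tail).left_of_append
    subst hq0
    exact (List.isChain_cons_cons.1 hc).1 rfl

open Classical in
/-- The number of times an edge path travels along edges labelled `t`, counted with sign. -/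
noncomputable def signedCount (t : ι ⊕ V) (p : List (blowup Φ).Dart) : ℚ :=
  (p.map fun d => if d.label = t then (if d.start = true then -1 else 1) else 0).sum

theorem signedCount_append (t : ι ⊕ V) (p q : List (blowup Φ).Dart) :
    signedCount t (p ++ q) = signedCount t p + signedCount t q := by
  simp [signedCount]

theorem signedCount_cons (t : ι ⊕ V) (d : (blowup Φ).Dart) (p : List (blowup Φ).Dart) :
    signedCount t (d :: p) = signedCount t [d] + signedCount t p :=
  signedCount_append t [d] p

theorem signedCount_symm (t : ι ⊕ V) (d : (blowup Φ).Dart) :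
    signedCount t [d.symm] = -signedCount t [d] := by
  by_cases h : d.label = t <;> cases hs : d.start <;> simp [signedCount, Dart.symm, h, hs]

theorem signedCount_reversePath (t : ι ⊕ V) (p : List (blowup Φ).Dart) :
    signedCount t (reversePath p) = -signedCount t p := by
  induction p with
  | nil => simp [signedCount, reversePath]
  | cons d p ih =>
    rw [reversePath_cons, signedCount_append, ih, signedCount_symm, signedCount_cons t d p]
    ring

/-- Backtracks contribute zero; removing them one by one leaves the empty path. -/
theorem signedCount_eq_zero_of_acyclic {T : Set (ι ⊕ V)} (t : ι ⊕ V)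
    (hac : ∀ (x : (blowup Φ).Cube) (p : List (blowup Φ).Dart), (blowup Φ).IsEdgePath x p x →
      (∀ d ∈ p, d.label ∈ T) → p.IsChain (fun d e => e ≠ d.symm) → p = [])
    (x : (blowup Φ).Cube) (p : List (blowup Φ).Dart) (hp : (blowup Φ).IsEdgePath x p x)
    (hpT : ∀ d ∈ p, d.label ∈ T) : signedCount t p = 0 := by
  induction hn : p.length using Nat.strong_induction_on generalizing p with
  | _ n ih =>
    by_cases hc : p.IsChain fun d e => e ≠ d.symm
    · rw [hac x p hp hpT hc]
      simp [signedCount]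
    · obtain ⟨l, d, e, r, rfl, he⟩ := List.exists_split_of_not_isChain hc
      obtain rfl : e = d.symm := not_not.1 he
      have := ih _ ?_ (l ++ r) ?_ ?_ rfl
      · rw [signedCount_append, signedCount_cons, signedCount_cons t d.symm, signedCount_symm]
        rw [signedCount_append] at this
        linarith
      · rw [← hn]
        simp
      · obtain ⟨z, h1, h2, -, h3⟩ := isEdgePath_append.1 hp
        rw [d.target_symm, h2] at h3
        exact isEdgePath_append.2 ⟨z, h1, h3⟩
      · intro a ha
        refine hpT a ?_
        rcases List.mem_append.1 ha with h | h <;> simp [h]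

/-- The signed number of passages along `t` on a path in `T` from a base region is an affine
function of the endpoint. Its linear part is dual to `t`: it is `1` on the boundary of `t` and `0`
on the other boundaries of `T`. -/
theorem IsCompatibleFamily.linearIndepOn_of_isTree (hΦ : IsCompatibleFamily Φ)
    (hN : ∀ i j, ¬ (Φ i).Commuting (Φ j)) {T : Set (ι ⊕ V)}
    (hcon : ∀ R R', IsRegion Φ R → IsRegion Φ R' → LabelJoined Φ T R R')
    (hac : ∀ (x : (blowup Φ).Cube) (p : List (blowup Φ).Dart), (blowup Φ).IsEdgePath x p x →
      (∀ d ∈ p, d.label ∈ T) → p.IsChain (fun d e => e ≠ d.symm) → p = []) :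
    LinearIndepOn ℚ (boundary Φ) T := by
  classical
  obtain ⟨R₀, hR₀⟩ := hΦ.exists_isRegion
  have hpath : ∀ R : {R // IsRegion Φ R}, ∃ p : List (blowup Φ).Dart,
      (blowup Φ).IsEdgePath (vertexCube hR₀) p (vertexCube R.2) ∧ ∀ d ∈ p, d.label ∈ T :=
    fun R => (hcon R₀ R.1 hR₀ R.2).exists_isEdgePath hR₀ R.2
  choose q hq hqT using hpath
  have hdual : ∀ t : ι ⊕ V, ∃ φ : (ι → ℚ) →ₗ[ℚ] ℚ, ∀ a ∈ T,
      φ (boundary Φ a) = if a = t then 1 else 0 := by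
    intro t
    obtain ⟨φ, hφ⟩ := hΦ.exists_affine hN
      fun R => if hR : IsRegion Φ R then signedCount t (q ⟨R, hR⟩) else 0
    refine ⟨φ, fun a ha => ?_⟩
    have hs := hΦ.edgeStarts_gate a hR₀
    have hS := hΦ.isRegion_gate a hR₀
    have hS' := isRegion_switch Φ _ hS _ hs
    have h1 := hφ _ _ hS hS'
    rw [regionVec_switch_sub hs, dif_pos hS, dif_pos hS'] at h1
    -- The closed path out to the start of the edge `a`, along this edge, and back from its end.
    have h2 := signedCount_eq_zero_of_acyclic t hac (vertexCube hR₀)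
      (q ⟨_, hS⟩ ++ edgeDart hS hs false :: reversePath (q ⟨_, hS'⟩)) ?_ ?_
    · rw [signedCount_append, signedCount_cons, signedCount_reversePath] at h2
      rw [← h1]
      have h3 : signedCount t [edgeDart hS hs false] = if a = t then 1 else 0 := by
        simp [signedCount, edgeDart]
      rw [← h3]
      linarith
    · refine isEdgePath_append.2 ⟨_, hq ⟨_, hS⟩, edgeDart_source hS hs, ?_⟩
      rw [edgeDart_target]
      exact isEdgePath_reversePath (hq ⟨_, hS'⟩)
    · intro d hd
      rcases List.mem_append.1 hd with hd | hd
      · exact hqT _ d hd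
      · rcases List.mem_cons.1 hd with rfl | hd
        · exact ha
        · obtain ⟨e, he, h⟩ := label_of_mem_reversePath hd
          exact h ▸ hqT _ e he
  change LinearIndependent ℚ (fun x : T => boundary Φ x)
  have := Fintype.ofFinite T
  rw [Fintype.linearIndependent_iff]
  intro g hg t
  obtain ⟨φ, hφ⟩ := hdual t
  have := congrArg φ hg
  rw [map_sum, map_zero] at this
  simp only [map_smul, hφ _ (Subtype.coe_prop _), smul_eq_mul, mul_ite, mul_one, mul_zero,
    Subtype.coe_inj, Finset.sum_ite_eq', Finset.mem_univ, if_true] at this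
  exact this

end Boundary

/-! ### Tree-like sets of hyperplanes as bases, link by link -/

section LinkClasses

variable {V : Type u} {ι : Type w} {Γ : SimpleGraph V} {Φ : ι → WhiteheadPartition Γ}

open CubeComplex

theorem labelVertex_notMem_lk {a : ι ⊕ V} {i : ι} (h : labelLink Φ a = (Φ i).lk) :
    labelVertex Φ a ∉ (Φ i).lk := by
  rw [← h]
  exact fun h' => Γ.loopless.irrefl _ h'

theorem labelLink_linkClass (L : Set V) (a : {i // (Φ i).lk = L} ⊕ V) :
    labelLink (linkClass Φ L) a = labelLink Φ (Sum.map Subtype.val id a) := by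
  cases a <;> rfl

theorem labelMap_injective {p : ι → Prop} :
    Function.Injective (Sum.map Subtype.val id : {i // p i} ⊕ V → ι ⊕ V) :=
  Sum.map_injective.2 ⟨Subtype.val_injective, Function.injective_id⟩

theorem IsCompatibleFamily.subfamily (hΦ : IsCompatibleFamily Φ) (L : Set V) :
    IsCompatibleFamily (linkClass Φ L) :=
  fun i j hij => hΦ i j fun h => hij (Subtype.ext h)

/-- Partitions with equal links cannot be adjacent, since a vertex is not in its own link. -/
theorem linkClass_not_commuting (L : Set V) (i j : {i // (Φ i).lk = L}) :
    ¬ (linkClass Φ L i).Commuting (linkClass Φ L j) := by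
  intro h
  have h' : (Φ j).m.1 ∈ (Φ i).lk := h
  exact (Φ j).m_notMem_lk (i.2.trans j.2.symm ▸ h')

/-- The labels in `T` with link `L`, as labels for the blowup along the partitions with link `L`. -/
def linkLabels (Φ : ι → WhiteheadPartition Γ) (T : Set (ι ⊕ V)) (L : Set V) :
    Set ({i // (Φ i).lk = L} ⊕ V) :=
  {a | Sum.map Subtype.val id a ∈ T ∧ labelLink (linkClass Φ L) a = L}

variable [Finite V] [Finite ι]

theorem dart_label_eq_of_edge_eq {d e : (blowup Φ).Dart} (h : d.edge = e.edge) :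
    d.label = e.label :=
  Set.singleton_injective (d.dirs_eq.symm.trans ((congrArg _ h).trans e.dirs_eq))

theorem IsCompatibleFamily.isMaximalTree_iff (hΦ : IsCompatibleFamily Φ)
    (hN : ∀ i j, ¬ (Φ i).Commuting (Φ j)) {F : Set (ι ⊕ V)}
    (hF : ∀ a ∈ F, ∀ i, labelVertex Φ a ∉ (Φ i).lk) {g : Set (blowup Φ).Cube} :
    (blowup Φ).IsMaximalTree g {e | ∃ d : (blowup Φ).Dart, d.edge = e ∧ d.label ∈ F} ↔
      (∀ d : (blowup Φ).Dart, d.label ∈ F → d.edge ∈ g) ∧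
      LinearIndepOn ℚ (boundary Φ) F ∧ Submodule.span ℚ (boundary Φ '' F) = ⊤ := by
  have hmem : ∀ p : List (blowup Φ).Dart, (∀ d ∈ p, d.edge ∈
      {e | ∃ d : (blowup Φ).Dart, d.edge = e ∧ d.label ∈ F}) ↔ ∀ d ∈ p, d.label ∈ F := by
    refine fun p => forall₂_congr fun d _ => ⟨?_, fun h => ⟨d, rfl, h⟩⟩
    rintro ⟨e, he, h⟩
    rwa [← dart_label_eq_of_edge_eq he]
  simp only [IsMaximalTree, hmem]
  have hsub : {e | ∃ d : (blowup Φ).Dart, d.edge = e ∧ d.label ∈ F} ⊆ g ↔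
      ∀ d : (blowup Φ).Dart, d.label ∈ F → d.edge ∈ g := by
    constructor
    · exact fun h d hd => h ⟨d, rfl, hd⟩
    · rintro h _ ⟨d, rfl, hd⟩
      exact h d hd
  rw [hsub]
  refine and_congr_right fun _ => ⟨?_, ?_⟩
  · rintro ⟨h1, h2⟩
    have hcon : ∀ R R', IsRegion Φ R → IsRegion Φ R' → LabelJoined Φ F R R' := by
      intro R R' hR hR'
      obtain ⟨p, hp, hpF⟩ := h1 _ _ (isVertex_vertexCube hR) (isVertex_vertexCube hR')
      exact labelJoined_of_isEdgePath hp hpF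
    exact ⟨hΦ.linearIndepOn_of_isTree hN hcon h2, hΦ.span_boundary_eq_top hcon⟩
  · rintro ⟨h1, h2⟩
    refine ⟨fun x y hx hy => ?_, hΦ.acyclic_of_linearIndepOn hF h1⟩
    rw [eq_vertexCube hx, eq_vertexCube hy]
    exact (hΦ.labelJoined_of_span hN h2 _ _ (BlowupCube.isRegion x)
      (BlowupCube.isRegion y)).exists_isEdgePath _ _

theorem IsCompatibleFamily.isTreeLikeAt_iff (hΦ : IsCompatibleFamily Φ) {L : Set V}
    {𝓕 : Set (blowup (linkClass Φ L)).Hyperplane} :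
    IsTreeLikeAt Φ L 𝓕 ↔
      (∀ a ∈ hyperplaneLabels 𝓕, labelLink (linkClass Φ L) a = L) ∧
      LinearIndepOn ℚ (boundary (linkClass Φ L)) (hyperplaneLabels 𝓕) ∧
      Submodule.span ℚ (boundary (linkClass Φ L) '' hyperplaneLabels 𝓕) = ⊤ := by
  have hΨ := hΦ.subfamily L
  have hset : {e | ∃ d : (blowup (linkClass Φ L)).Dart, d.edge = e ∧ d.hyperplane ∈ 𝓕} =
      {e | ∃ d : (blowup (linkClass Φ L)).Dart, d.edge = e ∧
        d.label ∈ hyperplaneLabels 𝓕} := by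
    simp only [hΨ.mem_iff_label_mem, Dart.hyperplane_label]
  have hbase : (∀ d : (blowup (linkClass Φ L)).Dart, d.label ∈ hyperplaneLabels 𝓕 →
      d.edge ∈ baseGraph Φ L) ↔
      ∀ a ∈ hyperplaneLabels 𝓕, labelLink (linkClass Φ L) a = L := by
    constructor
    · intro h a ha
      obtain ⟨R, hR⟩ := hΨ.exists_isRegion
      rcases h (edgeDart (hΨ.isRegion_gate a hR) (hΨ.edgeStarts_gate a hR) false) ha with
        ⟨i, hi⟩ | ⟨v, hv, hi⟩
      · obtain rfl : a = Sum.inl i := Set.singleton_injective hi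
        exact i.2
      · obtain rfl : a = Sum.inr v := Set.singleton_injective hi
        exact hv
    · intro h d hd
      have := h _ hd
      rcases hl : d.label with i | v
      · exact Or.inl ⟨i, hl ▸ d.dirs_eq⟩
      · rw [hl] at this
        exact Or.inr ⟨v, this, hl ▸ d.dirs_eq⟩
  rw [IsTreeLikeAt, hset]
  constructor
  · intro h
    have hL := hbase.1 fun d hd => h.1 ⟨d, rfl, hd⟩
    have := (hΨ.isMaximalTree_iff (linkClass_not_commuting L) fun a ha i =>
      labelVertex_notMem_lk ((hL a ha).trans i.2.symm)).1 h
    exact ⟨hL, this.2⟩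
  · rintro ⟨hL, h⟩
    exact (hΨ.isMaximalTree_iff (linkClass_not_commuting L) fun a ha i =>
      labelVertex_notMem_lk ((hL a ha).trans i.2.symm)).2 ⟨hbase.2 hL, h⟩

/-- The labels in `T` whose link is `L` form a maximal tree in the base graph, for each link `L` of
a partition, and all other labels are not in `T`. -/
structure IsTreeLikeLabels (Φ : ι → WhiteheadPartition Γ) (T : Set (ι ⊕ V)) : Prop where
  exists_link : ∀ a ∈ T, ∃ i, (Φ i).lk = labelLink Φ a
  linearIndepOn : ∀ L, LinearIndepOn ℚ (boundary (linkClass Φ L)) (linkLabels Φ T L)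
  span_eq_top : ∀ L, Submodule.span ℚ (boundary (linkClass Φ L) '' linkLabels Φ T L) = ⊤

/-- The tree for the link `L` is recovered from the union as its labels with link `L`, since base
graphs for different links have no labels in common. -/
theorem IsCompatibleFamily.isTreeLike_iff (hΦ : IsCompatibleFamily Φ)
    {𝓗 : Set (blowup Φ).Hyperplane} :
    IsTreeLike Φ 𝓗 ↔ IsTreeLikeLabels Φ (hyperplaneLabels 𝓗) := by
  constructor
  · rintro ⟨𝓕, h1, h2⟩
    have h3 : ∀ L ∈ Set.range (fun i => (Φ i).lk), ∀ a ∈ hyperplaneLabels (𝓕 L),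
        labelLink (linkClass Φ L) a = L := fun L hL => (hΦ.isTreeLikeAt_iff.1 (h1 L hL)).1
    have h4 : ∀ a ∈ hyperplaneLabels 𝓗, ∃ L ∈ Set.range (fun i => (Φ i).lk),
        ∃ b ∈ hyperplaneLabels (𝓕 L), a = Sum.map Subtype.val id b := by
      rintro _ ⟨H, hH, rfl⟩
      rw [h2, Set.mem_iUnion₂] at hH
      obtain ⟨L, hL, F, hF, h⟩ := hH
      exact ⟨L, hL, F.label, ⟨F, hF, rfl⟩, h⟩
    have hlink : ∀ a ∈ hyperplaneLabels 𝓗, ∃ i, (Φ i).lk = labelLink Φ a := by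
      intro a ha
      obtain ⟨L, ⟨i, rfl⟩, b, hb, rfl⟩ := h4 a ha
      exact ⟨i, by rw [← labelLink_linkClass, h3 _ ⟨i, rfl⟩ b hb]⟩
    have h5 : ∀ L ∈ Set.range (fun i => (Φ i).lk),
        linkLabels Φ (hyperplaneLabels 𝓗) L = hyperplaneLabels (𝓕 L) := by
      intro L hL
      ext a
      constructor
      · rintro ⟨ha, haL⟩
        obtain ⟨L', hL', b, hb, hab⟩ := h4 _ ha
        have hb' := h3 L' hL' b hb
        have : L = L' := by
          rw [← haL, ← hb', labelLink_linkClass, labelLink_linkClass, hab]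
        subst this
        rwa [labelMap_injective hab]
      · intro ha
        refine ⟨?_, h3 L hL a ha⟩
        obtain ⟨F, hF, rfl⟩ := ha
        obtain ⟨H, hH⟩ := hΦ.exists_hyperplane (Sum.map Subtype.val id F.label)
        refine ⟨H, ?_, hH⟩
        rw [h2, Set.mem_iUnion₂]
        exact ⟨L, hL, F, hF, hH⟩
    -- For an `L` that is not the link of a partition, the conditions concern the empty set in the
    -- zero space.
    have h6 : ∀ L, L ∉ Set.range (fun i => (Φ i).lk) →
        linkLabels Φ (hyperplaneLabels 𝓗) L = ∅ ∧ IsEmpty {i // (Φ i).lk = L} := by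
      intro L hL
      refine ⟨Set.eq_empty_of_forall_notMem fun a ha => ?_, ⟨fun i => hL ⟨i, i.2⟩⟩⟩
      obtain ⟨i, hi⟩ := hlink _ ha.1
      exact hL ⟨i, by rw [← ha.2, labelLink_linkClass, ← hi]⟩
    refine ⟨hlink, fun L => ?_, fun L => ?_⟩
    · by_cases hL : L ∈ Set.range (fun i => (Φ i).lk)
      · rw [h5 L hL]
        exact (hΦ.isTreeLikeAt_iff.1 (h1 L hL)).2.1
      · rw [(h6 L hL).1]
        exact linearIndepOn_empty ℚ _
    · by_cases hL : L ∈ Set.range (fun i => (Φ i).lk)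
      · rw [h5 L hL]
        exact (hΦ.isTreeLikeAt_iff.1 (h1 L hL)).2.2
      · have := (h6 L hL).2
        exact Subsingleton.elim _ _
  · rintro ⟨h1, h2, h3⟩
    have h4 : ∀ L, hyperplaneLabels {F : (blowup (linkClass Φ L)).Hyperplane |
        F.label ∈ linkLabels Φ (hyperplaneLabels 𝓗) L} =
        linkLabels Φ (hyperplaneLabels 𝓗) L := by
      intro L
      ext a
      constructor
      · rintro ⟨F, hF, rfl⟩
        exact hF
      · intro ha
        obtain ⟨F, rfl⟩ := (hΦ.subfamily L).exists_hyperplane a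
        exact ⟨F, ha, rfl⟩
    refine ⟨fun L => {F | F.label ∈ linkLabels Φ (hyperplaneLabels 𝓗) L}, fun L _ => ?_, ?_⟩
    · rw [hΦ.isTreeLikeAt_iff, h4]
      exact ⟨fun a ha => ha.2, h2 L, h3 L⟩
    · ext H
      rw [Set.mem_iUnion₂]
      constructor
      · intro hH
        have ha : H.label ∈ hyperplaneLabels 𝓗 := ⟨H, hH, rfl⟩
        obtain ⟨i, hi⟩ := h1 _ ha
        refine ⟨_, ⟨i, rfl⟩, ?_⟩
        obtain ⟨a, haH⟩ : ∃ a : {j // (Φ j).lk = (Φ i).lk} ⊕ V,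
            Sum.map Subtype.val id a = H.label := by
          rcases hl : H.label with j | v
          · rw [hl] at hi
            exact ⟨Sum.inl ⟨j, hi.symm⟩, rfl⟩
          · exact ⟨Sum.inr v, rfl⟩
        obtain ⟨F, rfl⟩ := (hΦ.subfamily (Φ i).lk).exists_hyperplane a
        refine ⟨F, ⟨by rwa [haH], ?_⟩, haH.symm⟩
        rw [labelLink_linkClass, haH]
        exact hi.symm
      · rintro ⟨L, -, F, hF, hFH⟩
        rw [hΦ.mem_iff_label_mem, hFH]
        exact hF.1

end LinkClasses

/-! ### Joining regions by paths with labels in a tree-like set -/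

section Connectivity

variable {V : Type u} {ι : Type w} {Γ : SimpleGraph V} {Φ : ι → WhiteheadPartition Γ}

/-- A set of partitions that contains all partitions whose link contains the link of one of its
members. -/
def IsLinkUpper (Φ : ι → WhiteheadPartition Γ) (U : Set ι) : Prop :=
  ∀ i ∈ U, ∀ j, (Φ i).lk ⊆ (Φ j).lk → j ∈ U

/-- The labels in `T` that have the same link as a partition in `U`. -/
def labelsOver (Φ : ι → WhiteheadPartition Γ) (T : Set (ι ⊕ V)) (U : Set ι) : Set (ι ⊕ V) :=
  {a ∈ T | ∃ i ∈ U, (Φ i).lk = labelLink Φ a}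

theorem labelsOver_mono {T : Set (ι ⊕ V)} {U U' : Set ι} (h : U ⊆ U') :
    labelsOver Φ T U ⊆ labelsOver Φ T U' :=
  fun _ ⟨ha, i, hi, h'⟩ => ⟨ha, i, h hi, h'⟩

theorem IsLinkUpper.diff {U : Set ι} (hU : IsLinkUpper Φ U) {i₀ : ι}
    (hmin : ∀ j ∈ U, (Φ j).lk ⊆ (Φ i₀).lk → (Φ j).lk = (Φ i₀).lk) :
    IsLinkUpper Φ (U \ {i | (Φ i).lk = (Φ i₀).lk}) := by
  rintro i ⟨hi, hi'⟩ j hij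
  refine ⟨hU i hi j hij, fun hj => hi' (hmin i hi ?_)⟩
  rwa [← show (Φ j).lk = (Φ i₀).lk from hj]

theorem exists_minimal_link [Finite ι] {U : Set ι} (hU : U.Nonempty) :
    ∃ i₀ ∈ U, ∀ j ∈ U, (Φ j).lk ⊆ (Φ i₀).lk → (Φ j).lk = (Φ i₀).lk := by
  obtain ⟨i₀, hi₀, h⟩ := (Set.toFinite U).exists_minimalFor (fun i => (Φ i).lk) U hU
  exact ⟨i₀, hi₀, fun j hj hji => Set.Subset.antisymm hji (h hj hji)⟩

theorem commuting_iff_mem_lk (i j : ι) : (Φ i).Commuting (Φ j) ↔ (Φ j).m.1 ∈ (Φ i).lk := Iff.rfl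

theorem mem_lk_iff_of_labelLink_eq {a : ι ⊕ V} {i : ι} (h : labelLink Φ a = (Φ i).lk) (j : ι) :
    labelVertex Φ a ∈ (Φ j).lk ↔ (Φ i).Commuting (Φ j) := by
  rw [commuting_iff_mem_lk, ← h]
  exact Γ.adj_comm _ _

theorem IsRegion.linkClass {R : ι → Bool} (hR : IsRegion Φ R) (L : Set V) :
    IsRegion (linkClass Φ L) fun i => R i :=
  fun i j hij => hR i j fun h => hij (Subtype.ext h)

theorem mem_crossed_map {L : Set V} {a : {i // (Φ i).lk = L} ⊕ V} {i : {i // (Φ i).lk = L}} :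
    i.1 ∈ crossed Φ (Sum.map Subtype.val id a) ↔ i ∈ crossed (linkClass Φ L) a := by
  rcases a with j | v
  · exact Subtype.ext_iff.symm
  · rfl

theorem switch_map {L : Set V} (a : {i // (Φ i).lk = L} ⊕ V) (R : ι → Bool)
    (i : {i // (Φ i).lk = L}) : switch Φ (Sum.map Subtype.val id a) R i =
      switch (linkClass Φ L) a (fun j => R j) i := by
  by_cases h : i ∈ crossed (linkClass Φ L) a
  · rw [switch_of_mem _ h, switch_of_mem _ (mem_crossed_map.2 h)]
  · rw [switch_eq_of_notMem _ _ _ _ h, switch_eq_of_notMem _ _ _ _ (mt mem_crossed_map.1 h)]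

theorem gateSide_map {L : Set V} (a : {i // (Φ i).lk = L} ⊕ V) (i : {i // (Φ i).lk = L}) :
    gateSide Φ (Sum.map Subtype.val id a) i = gateSide (linkClass Φ L) a i := by
  rcases a with j | v
  · have h : i.1 ≠ j.1 ↔ i ≠ j := not_congr Subtype.ext_iff.symm
    simp only [gateSide, Sum.map_inl]
    exact decide_eq_decide.2 (and_congr h Iff.rfl)
  · rfl

/-- No two of the sides that two commuting partitions choose can be separated by a third partition
that commutes with none of them. -/
theorem not_disjoint_disjoint_of_commuting {p q r : WhiteheadPartition Γ} (hqr : q.Commuting r)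
    (hpq : ¬ p.Commuting q) (hpr : ¬ p.Commuting r) {b c d : Bool}
    (h1 : Disjoint (p.side b) (q.side c)) (h2 : Disjoint (p.side !b) (r.side d)) : False := by
  have e1 : q.base c ∈ p.side !b := p.mem_side_not
    (Set.disjoint_right.1 h1 (q.base_mem c))
    (WhiteheadPartition.base_notMem_lk (WhiteheadPartition.not_commuting_symm hpq) _)
  have e2 := p.mem_side_of_adj (y := r.m.1) (r.base d).2 e1
    (by rw [q.base_fst]; exact hqr) (fun h => hpr h)
  rw [← r.base_fst d] at e2
  exact Set.disjoint_left.1 h2 e2 (r.base_mem d)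

open Classical in
/-- Change the choice `r` of sides of the partitions with link `L` so that it becomes compatible
with the choice `R` of sides of the partitions outside `U`. -/
noncomputable def adjust (Φ : ι → WhiteheadPartition Γ) (U : Set ι) (R : ι → Bool) {L : Set V}
    (r : {i // (Φ i).lk = L} → Bool) : {i // (Φ i).lk = L} → Bool :=
  fun i => if ∃ j ∉ U, ¬ (Φ i).Commuting (Φ j) ∧ Disjoint ((Φ i).side (r i)) ((Φ j).side (R j))
    then !r i else r i

theorem adjust_eq_self {U : Set ι} {R S : ι → Bool} (hS : IsRegion Φ S)
    (hRS : ∀ i ∉ U, S i = R i) {L : Set V} (hL : ∀ i, (Φ i).lk = L → i ∈ U) :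
    adjust Φ U R (fun i : {i // (Φ i).lk = L} => S i) = fun i : {i // (Φ i).lk = L} => S i := by
  funext i
  refine if_neg ?_
  rintro ⟨j, hj, hnc, hd⟩
  have hij : i.1 ≠ j := by
    rintro rfl
    exact hj (hL _ i.2)
  rw [← hRS j hj] at hd
  exact hS.not_disjoint hij hnc hd

/-- If a choice fixed outside `U` prevents the edge `a` from being crossed, then for each partition
crossed by `a` exactly one side is compatible with the fixed choices. The adjustment picks this side
whatever `r` is, so the step in the tree becomes trivial after adjusting. -/
theorem IsCompatibleFamily.adjust_eq_of_forced (hΦ : IsCompatibleFamily Φ) {U : Set ι}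
    (hU : IsLinkUpper Φ U) {R : ι → Bool} (hR : IsRegion Φ R) {L : Set V}
    (hL : ∀ i, (Φ i).lk = L → i ∈ U) {r : {i // (Φ i).lk = L} → Bool}
    {a : {i // (Φ i).lk = L} ⊕ V} (ha : labelLink (linkClass Φ L) a = L) {j₀ : ι} (hj₀ : j₀ ∉ U)
    (haj : labelVertex Φ (Sum.map Subtype.val id a) ∉ (Φ j₀).lk)
    (hne : R j₀ ≠ gateSide Φ (Sum.map Subtype.val id a) j₀) :
    adjust Φ U R (switch (linkClass Φ L) a r) = adjust Φ U R r := by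
  classical
  funext i
  by_cases hi : i ∈ crossed (linkClass Φ L) a
  swap
  · simp only [adjust, switch_eq_of_notMem _ r a i hi]
  -- `F b`: some fixed choice outside `U` excludes the side `b` of the `i`-th partition.
  let F : Bool → Prop := fun b => ∃ j ∉ U, ¬ (Φ i).Commuting (Φ j) ∧
    Disjoint ((Φ i).side b) ((Φ j).side (R j))
  have hneU : ∀ j ∉ U, i.1 ≠ j := by
    rintro j hj rfl
    exact hj (hL _ i.2)
  -- If both sides were excluded, the two fixed sides responsible would be disjoint or belong to
  -- commuting partitions separated by the `i`-th, or one partition would give two disjoint pairs.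
  have hnot : ∀ b, F b → F (!b) → False := by
    rintro b ⟨j, hj, hnc, hd⟩ ⟨k, hk, hnc', hd'⟩
    by_cases hjk : j = k
    · subst hjk
      have := (hΦ.unique (hneU j hj) hnc hd hd').1
      simp at this
    · by_cases hc : (Φ j).Commuting (Φ k)
      · exact not_disjoint_disjoint_of_commuting hc hnc hnc' hd hd'
      · exact hR.not_disjoint hjk hc (WhiteheadPartition.disjoint_side_trans
          (WhiteheadPartition.not_commuting_symm hnc) hd.symm hd')
  have hlink : labelLink Φ (Sum.map Subtype.val id a) = (Φ i).lk := by
    rw [← labelLink_linkClass, ha, i.2]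
  have hnc : ¬ (Φ i).Commuting (Φ j₀) := by
    rwa [← mem_lk_iff_of_labelLink_eq hlink]
  have hR₀ : R j₀ = !(gateSide Φ (Sum.map Subtype.val id a) j₀) := by
    revert hne
    cases R j₀ <;> cases gateSide Φ (Sum.map Subtype.val id a) j₀ <;> simp
  have hex : ∃ b, F b := by
    suffices h : ∃ b, Disjoint ((Φ i).side b) ((Φ j₀).side (R j₀)) by
      obtain ⟨b, hb⟩ := h
      exact ⟨b, j₀, hj₀, hnc, hb⟩
    rw [hR₀]
    rcases a with i' | v
    · obtain rfl : i = i' := hi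
      exact hΦ.exists_disjoint_gateSide (hneU j₀ hj₀) hnc
    -- A singleton would give `L ⊆ lk j₀` and so `j₀ ∈ U`. Hence `v` and `v⁻¹` both lie in the gate
    -- side at `j₀`; as the `i`-th partition separates them, both its sides meet that gate side, and
    -- the disjoint pair involves `R j₀`.
    · have hv : v ∉ (Φ j₀).single := by
        intro hv
        refine hj₀ (hU i (hL i i.2) j₀ ?_)
        rw [← hlink]
        exact (Φ j₀).neighborSet_subset_lk hv
      have h1 : ∀ s, (v, s) ∈ (Φ j₀).side (gateSide Φ (Sum.inr v) j₀) := fun s =>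
        (Φ j₀).mem_side_of_notMem_single hv _ _ _ (mem_side_gateSide_inr haj)
      obtain ⟨b, c, hd⟩ := hΦ.exists_disjoint (hneU j₀ hj₀) hnc
      refine ⟨b, ?_⟩
      by_cases hc : c = gateSide Φ (Sum.inr v) j₀
      · exfalso
        obtain ⟨e, he, he'⟩ : v ∈ (Φ i).single := hi
        subst hc
        by_cases hbe : b = e
        · subst hbe
          exact Set.disjoint_left.1 hd he (h1 _)
        · have : b = !e := by revert hbe; cases b <;> cases e <;> simp
          subst this
          exact Set.disjoint_left.1 hd he' (h1 _)
      · have : c = !(gateSide Φ (Sum.inr v) j₀) := by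
          revert hc; cases c <;> cases gateSide Φ (Sum.inr v) j₀ <;> simp
        rw [this] at hd
        exact hd
  have key : ∀ b, (if F (!b) then !(!b) else !b) = if F b then !b else b := by
    intro b
    by_cases hb : F b
    · have : ¬ F (!b) := hnot b hb
      simp [hb, this]
    · have : F (!b) := by
        obtain ⟨c, hc⟩ := hex
        by_cases hcb : c = b
        · exact (hb (hcb ▸ hc)).elim
        · have : c = !b := by revert hcb; cases c <;> cases b <;> simp
          rwa [← this]
      simp [hb, this]
  have := key (r i)
  simp only [F] at this
  simp only [adjust, switch_of_mem r hi]
  convert this using 2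

/-- The partitions whose link contains the vertices of all labels in `A`. -/
def linkUpperOf (Φ : ι → WhiteheadPartition Γ) (A : Set (ι ⊕ V)) : Set ι :=
  {i | ∀ a ∈ A, labelVertex Φ a ∈ (Φ i).lk}

theorem isLinkUpper_linkUpperOf (A : Set (ι ⊕ V)) : IsLinkUpper Φ (linkUpperOf Φ A) :=
  fun _ hi _ hij a ha => hij (hi a ha)

theorem IsLinkUpper.inter {U U' : Set ι} (h : IsLinkUpper Φ U) (h' : IsLinkUpper Φ U') :
    IsLinkUpper Φ (U ∩ U') :=
  fun i hi j hij => ⟨h i hi.1 j hij, h' i hi.2 j hij⟩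

theorem labelsCommute_of_mem_labelsOver {T A : Set (ι ⊕ V)} {a b : ι ⊕ V} (ha : a ∈ A)
    (hb : b ∈ labelsOver Φ T (linkUpperOf Φ A)) : LabelsCommute Φ a b := by
  obtain ⟨-, i, hi, h⟩ := hb
  rw [labelsCommute_iff_mem, ← h]
  exact hi a ha

/-- A partition outside `linkUpperOf Φ A` fails to commute with some label of `A`, and that label
prescribes its side. -/
theorem IsCompatibleFamily.eq_of_edgeStarts (hΦ : IsCompatibleFamily Φ) {R R' : ι → Bool}
    (hR : IsRegion Φ R) (hR' : IsRegion Φ R') {A : Set (ι ⊕ V)}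
    (h : ∀ a ∈ A, EdgeStarts Φ R a) (h' : ∀ a ∈ A, EdgeStarts Φ R' a) (i : ι)
    (hi : i ∉ linkUpperOf Φ A) : R i = R' i := by
  have : ∃ a ∈ A, labelVertex Φ a ∉ (Φ i).lk := by
    by_contra hc
    push Not at hc
    exact hi hc
  obtain ⟨a, ha, hai⟩ := this
  rw [(hΦ.edgeStarts_iff hR a).1 (h a ha) i hai, (hΦ.edgeStarts_iff hR' a).1 (h' a ha) i hai]

theorem IsCompatibleFamily.edgeStarts_switch_iff (hΦ : IsCompatibleFamily Φ) {R : ι → Bool}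
    (hR : IsRegion Φ R) {a b : ι ⊕ V} (hab : LabelsCommute Φ a b) (hb : EdgeStarts Φ R b) :
    EdgeStarts Φ (switch Φ b R) a ↔ EdgeStarts Φ R a := by
  have hR' := isRegion_switch Φ R hR b hb
  exact ⟨hΦ.edgeStarts_congr hR' hR fun i hi => switch_eq_of_commute hab R hi,
    hΦ.edgeStarts_congr hR hR' fun i hi => (switch_eq_of_commute hab R hi).symm⟩

variable [Finite ι]

/-- Two regions that differ only for partitions in `U` are joined by a path with labels over `U`
in a tree-like set. -/
theorem IsCompatibleFamily.labelJoined_of_eqOn (hΦ : IsCompatibleFamily Φ) {T : Set (ι ⊕ V)}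
    (hT : IsTreeLikeLabels Φ T) (U : Set ι) (hU : IsLinkUpper Φ U) {R R' : ι → Bool}
    (hR : IsRegion Φ R) (hR' : IsRegion Φ R') (h : ∀ i ∉ U, R i = R' i) :
    LabelJoined Φ (labelsOver Φ T U) R R' := by
  induction hn : U.ncard using Nat.strong_induction_on generalizing U R R' with
  | _ n ih =>
    rcases U.eq_empty_or_nonempty with rfl | hne
    · rw [show R = R' from funext fun i => h i (Set.notMem_empty i)]
      exact .refl _
    obtain ⟨i₀, hi₀, hmin⟩ := exists_minimal_link (Φ := Φ) hne
    have hU' := hU.diff hmin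
    obtain ⟨L, hL⟩ : ∃ L, (Φ i₀).lk = L := ⟨_, rfl⟩
    rw [hL] at hmin hU'
    have hLU : ∀ i, (Φ i).lk = L → i ∈ U := fun i hi => hU i₀ hi₀ i (by rw [hL, hi])
    -- The induction hypothesis, after removing from `U` the partitions with the minimal link `L`.
    have ih' : ∀ {S S' : ι → Bool}, IsRegion Φ S → IsRegion Φ S' → (∀ i ∉ U, S i = S' i) →
        (∀ i, (Φ i).lk = L → S i = S' i) → LabelJoined Φ (labelsOver Φ T U) S S' := by
      intro S S' hS hS' h1 h2
      refine (ih _ ?_ (U \ {i | (Φ i).lk = L}) hU' hS hS' ?_ rfl).mono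
        (labelsOver_mono Set.sdiff_subset)
      · rw [← hn]
        exact Set.ncard_lt_ncard ⟨Set.sdiff_subset, fun hs => (hs hi₀).2 hL⟩ (Set.toFinite _)
      · intro i hi
        by_cases hiU : i ∈ U
        · exact h2 i (by_contra fun hc => hi ⟨hiU, hc⟩)
        · exact h1 i hiU
    -- regions over an adjusted choice of sides of the partitions with link `L`
    let Over : ({i // (Φ i).lk = L} → Bool) → (ι → Bool) → Prop := fun r S =>
      IsRegion Φ S ∧ (∀ i ∉ U, S i = R i) ∧ (fun i : {i // (Φ i).lk = L} => S i) = adjust Φ U R r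
    let Lift : ({i // (Φ i).lk = L} → Bool) → ({i // (Φ i).lk = L} → Bool) → Prop := fun r r' =>
      ∀ S, Over r S → ∃ S', Over r' S' ∧ LabelJoined Φ (labelsOver Φ T U) S S'
    -- Paths in the tree for the link `L` lift to paths of regions, up to adjustment. Both
    -- directions are carried along because the relation is generated symmetrically.
    have key : ∀ r r', LabelJoined (linkClass Φ L) (linkLabels Φ T L) r r' →
        Lift r r' ∧ Lift r' r := by
      intro r r' hr
      induction hr with
      | rel r r' h =>
        obtain ⟨hr, a, ⟨haT, haL⟩, hs, rfl⟩ := h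
        -- If a fixed choice blocks the edge, nothing moves; otherwise its gate changes only sides
        -- of partitions in `U`.
        by_cases hforced : ∃ j₀ ∉ U, labelVertex Φ (Sum.map Subtype.val id a) ∉ (Φ j₀).lk ∧
            R j₀ ≠ gateSide Φ (Sum.map Subtype.val id a) j₀
        · obtain ⟨j₀, hj₀, haj, hne⟩ := hforced
          have := hΦ.adjust_eq_of_forced hU hR hLU (r := r) haL hj₀ haj hne
          constructor
          · rintro S ⟨h1, h2, h3⟩
            exact ⟨S, ⟨h1, h2, h3.trans this.symm⟩, .refl _⟩
          · rintro S ⟨h1, h2, h3⟩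
            exact ⟨S, ⟨h1, h2, h3.trans this⟩, .refl _⟩
        · push Not at hforced
          obtain ⟨A, hA⟩ : ∃ A, A = (Sum.map Subtype.val id a : ι ⊕ V) := ⟨_, rfl⟩
          rw [← hA] at hforced haT
          have hAL : labelLink Φ A = L := by rw [hA, ← labelLink_linkClass, haL]
          -- The ends of the lifted edge need no adjustment, since they are restrictions of actual
          -- regions that agree with `R` outside `U`.
          have hgate : ∀ S, IsRegion Φ S → (∀ i ∉ U, S i = R i) →
              Over r (gate Φ A S) ∧ Over (switch (linkClass Φ L) a r)
                (switch Φ A (gate Φ A S)) := by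
            intro S hS hSR
            have hS1 := hΦ.isRegion_gate A hS
            have hs1 := hΦ.edgeStarts_gate A hS
            have hSR1 : ∀ i ∉ U, gate Φ A S i = R i := by
              intro i hi
              by_cases hl : labelVertex Φ A ∈ (Φ i).lk
              · rw [gate_of_mem S hl, hSR i hi]
              · rw [gate_of_notMem S hl, hforced i hi hl]
            have hres : (fun i : {i // (Φ i).lk = L} => gate Φ A S i) = r := by
              funext i
              rw [gate_of_notMem S (labelVertex_notMem_lk (hAL.trans i.2.symm)), hA, gateSide_map]
              refine (((hΦ.subfamily L).edgeStarts_iff hr a).1 hs i ?_).symm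
              exact labelVertex_notMem_lk (haL.trans i.2.symm)
            have hS2 := isRegion_switch Φ _ hS1 A hs1
            have hSR2 : ∀ i ∉ U, switch Φ A (gate Φ A S) i = R i := by
              intro i hi
              rw [switch_eq_of_notMem, hSR1 i hi]
              intro hc
              have := labelLink_subset_of_mem_crossed hc
              exact hi (hU i₀ hi₀ i (by rw [hL, ← hAL]; exact this))
            have hres2 : (fun i : {i // (Φ i).lk = L} => switch Φ A (gate Φ A S) i) =
                switch (linkClass Φ L) a r := by
              funext i
              rw [← hres, hA, switch_map]
            refine ⟨⟨hS1, hSR1, ?_⟩, ⟨hS2, hSR2, ?_⟩⟩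
            · have := adjust_eq_self hS1 hSR1 hLU
              rw [hres] at this
              rw [hres, this]
            · have := adjust_eq_self hS2 hSR2 hLU
              rw [hres2] at this
              rw [hres2, this]
          have hstep : ∀ S, IsRegion Φ S → LabelJoined Φ (labelsOver Φ T U) (gate Φ A S)
              (switch Φ A (gate Φ A S)) := fun S hS =>
            .rel _ _ ⟨hΦ.isRegion_gate A hS, A, ⟨haT, i₀, hi₀, hL.trans hAL.symm⟩,
              hΦ.edgeStarts_gate A hS, rfl⟩
          have hjoin : ∀ {r S S'}, Over r S → Over r S' →
              LabelJoined Φ (labelsOver Φ T U) S S' := by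
            rintro r S S' ⟨h1, h2, h3⟩ ⟨h1', h2', h3'⟩
            exact ih' h1 h1' (fun i hi => (h2 i hi).trans (h2' i hi).symm)
              fun i hi => congrFun (h3.trans h3'.symm) ⟨i, hi⟩
          constructor
          · intro S hS
            obtain ⟨h1, h2⟩ := hgate S hS.1 hS.2.1
            exact ⟨_, h2, .trans _ _ _ (hjoin hS h1) (hstep S hS.1)⟩
          · intro S hS
            obtain ⟨h1, h2⟩ := hgate S hS.1 hS.2.1
            exact ⟨_, h1, .trans _ _ _ (hjoin hS h2) (.symm _ _ (hstep S hS.1))⟩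
      | refl => exact ⟨fun S hS => ⟨S, hS, .refl _⟩, fun S hS => ⟨S, hS, .refl _⟩⟩
      | symm _ _ _ ih => exact ih.symm
      | trans _ _ _ _ _ ih1 ih2 =>
        constructor
        · intro S hS
          obtain ⟨S', hS', h1⟩ := ih1.1 S hS
          obtain ⟨S'', hS'', h2⟩ := ih2.1 S' hS'
          exact ⟨S'', hS'', .trans _ _ _ h1 h2⟩
        · intro S hS
          obtain ⟨S', hS', h1⟩ := ih2.2 S hS
          obtain ⟨S'', hS'', h2⟩ := ih1.2 S' hS'
          exact ⟨S'', hS'', .trans _ _ _ h1 h2⟩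
    have hcon := (hΦ.subfamily L).labelJoined_of_span (linkClass_not_commuting L)
      (hT.span_eq_top L) _ _ (hR.linkClass L) (hR'.linkClass L)
    obtain ⟨S, ⟨h1, h2, h3⟩, h4⟩ := (key _ _ hcon).1 R
      ⟨hR, fun _ _ => rfl, (adjust_eq_self hR (fun _ _ => rfl) hLU).symm⟩
    refine .trans _ _ _ h4 (ih' h1 hR' (fun i hi => (h2 i hi).trans (h i hi)) ?_)
    rw [adjust_eq_self hR' (fun i hi => (h i hi).symm) hLU] at h3
    exact fun i hi => congrFun h3 ⟨i, hi⟩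

end Connectivity

/-! ### Homotopies of edge paths, and carriers -/

namespace CubeComplex

section Homotopies

variable {Λ : Type u} {X : CubeComplex.{u, v} Λ}

theorem Move.append {p q : List X.Dart} (h : X.Move p q) (l r : List X.Dart) :
    X.Move (l ++ p ++ r) (l ++ q ++ r) := by
  cases h with
  | backtrack l' r' d =>
    have := Move.backtrack (l ++ l') (r' ++ r) d
    simpa using this
  | square l' r' s a b hab hs α β =>
    have := Move.square (l ++ l') (r' ++ r) s a b hab hs α β
    simpa using this

theorem Homotopic.append {p q : List X.Dart} {x y x' y' : X.Cube} (h : X.Homotopic x y p q)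
    {l r : List X.Dart} (hl : X.IsEdgePath x' l x) (hr : X.IsEdgePath y r y') :
    X.Homotopic x' y' (l ++ p ++ r) (l ++ q ++ r) := by
  induction h with
  | rel p q h =>
    refine .rel _ _ ⟨?_, ?_, h.2.2.append l r⟩
    · exact isEdgePath_append.2 ⟨y, isEdgePath_append.2 ⟨x, hl, h.1⟩, hr⟩
    · exact isEdgePath_append.2 ⟨y, isEdgePath_append.2 ⟨x, hl, h.2.1⟩, hr⟩
  | refl => exact .refl _
  | symm _ _ _ ih => exact .symm _ _ ih
  | trans _ _ _ _ _ ih1 ih2 => exact .trans _ _ _ ih1 ih2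

theorem Homotopic.append_left {p q : List X.Dart} {x y x' : X.Cube} (h : X.Homotopic x y p q)
    {l : List X.Dart} (hl : X.IsEdgePath x' l x) : X.Homotopic x' y (l ++ p) (l ++ q) := by
  simpa using h.append (r := []) hl rfl

theorem Homotopic.append_right {p q : List X.Dart} {x y y' : X.Cube} (h : X.Homotopic x y p q)
    {r : List X.Dart} (hr : X.IsEdgePath y r y') : X.Homotopic x y' (p ++ r) (q ++ r) := by
  simpa using h.append (l := []) rfl hr

theorem homotopic_backtrack (d : X.Dart) : X.Homotopic d.source d.source [d, d.symm] [] :=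
  .rel _ _ ⟨⟨rfl, rfl, d.target_symm⟩, rfl, Move.backtrack [] [] d⟩

theorem homotopic_reversePath {p : List X.Dart} {x y : X.Cube} (hp : X.IsEdgePath x p y) :
    X.Homotopic x x (p ++ reversePath p) [] := by
  induction p generalizing x with
  | nil => exact .refl _
  | cons d p ih =>
    obtain ⟨rfl, hp⟩ := hp
    have h1 := (ih hp).append (x' := d.source) (y' := d.source) (l := [d]) (r := [d.symm])
      ⟨rfl, rfl⟩ ⟨rfl, d.target_symm⟩
    rw [reversePath_cons]
    have h2 := homotopic_backtrack d
    refine .trans _ [d, d.symm] _ ?_ h2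
    simp only [List.cons_append, List.nil_append, List.append_nil] at h1
    rw [List.cons_append, ← List.append_assoc]
    exact h1

theorem reversePath_reversePath (p : List X.Dart) : reversePath (reversePath p) = p := by
  induction p with
  | nil => rfl
  | cons d p ih =>
    rw [reversePath_cons, ← ih]
    simp [reversePath, Dart.symm_symm]

theorem homotopic_of_homotopic_append_reversePath {p q : List X.Dart} {x y : X.Cube}
    (hp : X.IsEdgePath x p y) (hq : X.IsEdgePath x q y)
    (h : X.Homotopic x x (p ++ reversePath q) []) : X.Homotopic x y p q := by
  have h1 := (homotopic_reversePath (isEdgePath_reversePath hq)).append_left hp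
  rw [reversePath_reversePath, List.append_nil, ← List.append_assoc] at h1
  exact .trans _ _ _ (.symm _ _ h1) (h.append_right hq)

theorem homotopic_square (s : X.Cube) (a b : Λ) (hab : a ≠ b) (hs : X.dirs s = {a, b})
    (α β : Bool) :
    X.IsEdgePath (X.squareDart s a b hab hs α β).source
      [X.squareDart s b a hab.symm (hs.trans (Set.pair_comm a b)) β α,
        X.squareDart s a b hab hs α (!β)]
      (X.squareDart s b a hab.symm (hs.trans (Set.pair_comm a b)) β (!α)).target ∧
    X.Homotopic (X.squareDart s a b hab hs α β).source
      (X.squareDart s b a hab.symm (hs.trans (Set.pair_comm a b)) β (!α)).target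
      [X.squareDart s a b hab hs α β,
        X.squareDart s b a hab.symm (hs.trans (Set.pair_comm a b)) β (!α)]
      [X.squareDart s b a hab.symm (hs.trans (Set.pair_comm a b)) β α,
        X.squareDart s a b hab hs α (!β)] := by
  have h1 : X.IsEdgePath (X.squareDart s a b hab hs α β).source
      [X.squareDart s b a hab.symm (hs.trans (Set.pair_comm a b)) β α,
        X.squareDart s a b hab hs α (!β)]
      (X.squareDart s b a hab.symm (hs.trans (Set.pair_comm a b)) β (!α)).target :=
    ⟨X.face_comm s a b α β hab, X.face_comm s b a _ _ hab.symm, X.face_comm s b a _ _ hab.symm⟩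
  refine ⟨h1, .rel _ _ ⟨⟨rfl, ?_, rfl⟩, h1, Move.square [] [] s a b hab hs α β⟩⟩
  exact X.face_comm s a b _ _ hab

end Homotopies

section Carriers

variable {Λ : Type u} {X : CubeComplex.{u, v} Λ}

/-- Faces in different directions commute, so a face in the direction `a` can be taken last. This
gives surjectivity of the map from `H × [0,1]` to the carrier. -/
theorem mem_dirs_or_eq_face_of_isFaceOf {c d : X.Cube} (h : X.IsFaceOf d c) {a : Λ}
    (ha : a ∈ X.dirs c) : (X.IsFaceOf d c ∧ a ∈ X.dirs d) ∨
      ∃ d' ε, X.IsFaceOf d' c ∧ a ∈ X.dirs d' ∧ d = X.face d' a ε := by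
  unfold IsFaceOf at h
  induction h with
  | refl => exact Or.inl ⟨.refl, ha⟩
  | @tail x y hx hxy ih =>
    obtain ⟨b, δ, rfl⟩ := hxy
    rcases ih with ⟨h1, h2⟩ | ⟨d', ε, h1, h2, rfl⟩
    · by_cases hab : b = a
      · subst hab
        exact Or.inr ⟨x, δ, h1, h2, rfl⟩
      · exact Or.inl ⟨.tail h1 ⟨b, δ, rfl⟩, by rw [X.dirs_face]; exact ⟨h2, fun h => hab h.symm⟩⟩
    · by_cases hab : b = a
      · subst hab
        refine Or.inr ⟨d', ε, h1, h2, X.face_of_notMem _ _ _ ?_⟩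
        rw [X.dirs_face]
        exact fun h => h.2 rfl
      · refine Or.inr ⟨X.face d' b δ, ε, .tail h1 ⟨b, δ, rfl⟩, ?_, X.face_comm d' a b ε δ ?_⟩
        · rw [X.dirs_face]
          exact ⟨h2, fun h => hab h.symm⟩
        · exact fun h => hab h.symm

theorem hyperplane_of_isFaceOf {c d : X.Cube} (h : X.IsFaceOf d c) {a : Λ} (ha : a ∈ X.dirs c)
    (hd : a ∈ X.dirs d) :
    Midcube.hyperplane ⟨d, a, hd⟩ = Midcube.hyperplane ⟨c, a, ha⟩ := by
  unfold IsFaceOf at h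
  induction h with
  | refl => rfl
  | @tail x y hx hxy ih =>
    obtain ⟨b, δ, rfl⟩ := hxy
    have h2 := hd
    rw [X.dirs_face] at h2
    rw [← ih h2.1]
    exact X.hyperplane_of_face x a b δ h2.2 h2.1 hd

theorem dirs_thicken (p : X.Midcube) (t : Option Bool) {b : Λ} :
    b ∈ X.dirs (X.thicken p t) ↔ (b ∈ X.dirs p.cube ∧ b ≠ p.dir) ∨ (b = p.dir ∧ t = none) := by
  cases t with
  | none =>
    change b ∈ X.dirs p.cube ↔ _
    by_cases h : b = p.dir
    · simp [h, p.mem]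
    · simp [h]
  | some ε =>
    change b ∈ X.dirs (X.face p.cube p.dir ε) ↔ _
    rw [X.dirs_face]
    simp

/-- A hyperplane is a carrier retract if the canonical map to its carrier is injective. -/
theorem isCarrierRetract_of_injective (H : X.Hyperplane)
    (hinj : ∀ p q : X.Midcube, p.hyperplane = H → q.hyperplane = H → ∀ s t,
      X.thicken p s = X.thicken q t → p = q ∧ s = t) : X.IsCarrierRetract H := by
  have hface : ∀ (p : X.Midcube) (t : Option Bool), X.IsFaceOf (X.thicken p t) p.cube := by
    rintro p (_ | ε)
    · exact .refl
    · exact .single ⟨p.dir, ε, rfl⟩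
  let f : (X.hyperplaneComplex H).prodInterval.Cube → (X.carrier H).Cube :=
    fun c => ⟨X.thicken c.1.1 c.2, c.1.1, c.1.2, hface c.1.1 c.2⟩
  have hf : Function.Bijective f := by
    constructor
    · rintro ⟨⟨p, hp⟩, s⟩ ⟨⟨q, hq⟩, t⟩ h
      obtain ⟨rfl, rfl⟩ := hinj p q hp hq s t (congrArg Subtype.val h)
      rfl
    · rintro ⟨d, p, hp, hd⟩
      rcases mem_dirs_or_eq_face_of_isFaceOf hd p.mem with ⟨h1, h2⟩ | ⟨d', ε, h1, h2, rfl⟩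
      · exact ⟨(⟨⟨d, p.dir, h2⟩, (hyperplane_of_isFaceOf h1 p.mem h2).trans hp⟩, none), rfl⟩
      · exact ⟨(⟨⟨d', p.dir, h2⟩, (hyperplane_of_isFaceOf h1 p.mem h2).trans hp⟩, some ε), rfl⟩
  let g : ∀ c : (X.hyperplaneComplex H).prodInterval.Cube,
      (X.hyperplaneComplex H).prodInterval.dirs c → (X.carrier H).dirs (f c) := fun c a =>
    ⟨a.1.getD c.1.1.dir, by
      obtain ⟨a, ha⟩ := a
      refine (dirs_thicken c.1.1 c.2).2 ?_
      rcases ha with ⟨b, hb, rfl⟩ | ⟨rfl, h⟩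
      · exact Or.inl hb
      · exact Or.inr ⟨rfl, h⟩⟩
  have hg : ∀ c, Function.Bijective (g c) := by
    intro c
    constructor
    · rintro ⟨a, ha⟩ ⟨b, hb⟩ h
      have h' : a.getD c.1.1.dir = b.getD c.1.1.dir := congrArg Subtype.val h
      refine Subtype.ext ?_
      rcases ha with ⟨a, ha, rfl⟩ | ⟨rfl, ha⟩ <;> rcases hb with ⟨b, hb, rfl⟩ | ⟨rfl, hb⟩
      · exact congrArg some h'
      · exact (ha.2 h').elim
      · exact (hb.2 h'.symm).elim
      · rfl
    · rintro ⟨b, hb⟩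
      rcases (dirs_thicken c.1.1 c.2).1 hb with h | ⟨h, h'⟩
      · exact ⟨⟨some b, Or.inl ⟨b, h, rfl⟩⟩, rfl⟩
      · exact ⟨⟨none, Or.inr ⟨rfl, h'⟩⟩, Subtype.ext h.symm⟩
  refine ⟨{ cube := Equiv.ofBijective f hf
            dir := fun c => Equiv.ofBijective (g c) (hg c)
            flip := fun _ _ => false
            cube_face := ?_
            dir_face := ?_
            flip_face := fun _ _ _ _ _ => rfl }, fun _ _ => rfl⟩
  · rintro ⟨⟨p, hp⟩, t⟩ ⟨a, ha⟩ ε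
    rw [Bool.xor_false]
    refine Subtype.ext ?_
    rcases ha with ⟨b, hb, rfl⟩ | ⟨rfl, h⟩
    · have hne : b ≠ p.dir := hb.2
      change X.thicken (p.face b ε) t = X.face (X.thicken p t) b ε
      cases t with
      | none => exact p.face_cube ε hne
      | some δ =>
        change X.face (p.face b ε).cube p.dir δ = X.face (X.face p.cube p.dir δ) b ε
        rw [p.face_cube ε hne]
        exact X.face_comm _ _ _ _ _ hne
    · obtain rfl : t = none := h
      rfl
  · rintro ⟨⟨p, hp⟩, t⟩ ⟨a, ha⟩ b ε h
    rcases ha with ⟨c, hc, rfl⟩ | ⟨rfl, ha⟩ <;> rfl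

end Carriers

end CubeComplex

/-! ### Sliding edges across squares, and projecting paths to one link -/

section NullHomotopy

variable {V : Type u} {ι : Type w} {Γ : SimpleGraph V} {Φ : ι → WhiteheadPartition Γ}

open CubeComplex

theorem edgeStarts_linkClass {L : Set V} {a : {i // (Φ i).lk = L} ⊕ V} {R : ι → Bool}
    (h : EdgeStarts Φ R (Sum.map Subtype.val id a)) :
    EdgeStarts (linkClass Φ L) (fun i => R i) a := by
  rcases a with i | v
  · refine ⟨h.1, ?_⟩
    have := h.2.linkClass L
    convert this using 1
    funext j
    exact (switch_map (Sum.inl i) R j).symm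
  · exact fun i => h i

theorem switch_apply_congr {a : ι ⊕ V} {R S : ι → Bool} {i : ι} (h : R i = S i) :
    switch Φ a R i = switch Φ a S i := by
  simp only [switch, h]

theorem labelsCommute_symm {a b : ι ⊕ V} (h : LabelsCommute Φ a b) : LabelsCommute Φ b a :=
  (labelsCommute_iff Φ b a).2 (Γ.adj_symm ((labelsCommute_iff Φ a b).1 h))

theorem ne_of_labelsCommute {a b : ι ⊕ V} (h : LabelsCommute Φ a b) : a ≠ b := by
  rintro rfl
  exact Γ.loopless.irrefl _ ((labelsCommute_iff Φ a a).1 h)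

variable [Finite V] [Finite ι]

theorem dart_ext {d e : (blowup Φ).Dart} (h1 : d.label = e.label) (h2 : d.start = e.start)
    (h3 : BlowupCube.region d.source = BlowupCube.region e.source) : d = e := by
  refine Dart.ext' (BlowupCube.ext' ?_ ?_) h2
  · rw [dart_source_region, dart_source_region, h1, h2] at h3
    cases hs : e.start
    · simpa [hs] using h3
    · rw [hs] at h3
      have := congrArg (switch Φ e.label) h3
      simpa [switch_switch] using this
  · exact d.dirs_eq.trans (h1 ▸ e.dirs_eq.symm)

theorem source_eq_of_region_eq {x y : (blowup Φ).Cube} (hx : (blowup Φ).IsVertex x)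
    (hy : (blowup Φ).IsVertex y) (h : BlowupCube.region x = BlowupCube.region y) : x = y :=
  BlowupCube.ext' h (Eq.trans hx (Eq.symm hy))

/-- Two consecutive edges with commuting labels are two sides of a square. -/
theorem IsCompatibleFamily.exists_square (hΦ : IsCompatibleFamily Φ) {d e : (blowup Φ).Dart}
    (hde : e.source = d.target) (hc : LabelsCommute Φ d.label e.label) :
    ∃ e' d' : (blowup Φ).Dart, e'.label = e.label ∧ d'.label = d.label ∧ d'.start = d.start ∧
      e'.source = d.source ∧ e'.target = d'.source ∧ d'.target = e.target ∧
      (blowup Φ).Homotopic d.source e.target [d, e] [e', d'] := by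
  obtain ⟨⟨Ra, la, hRa, hca, hsa⟩, a, had, α⟩ := d
  obtain ⟨⟨Rb, lb, hRb, hcb, hsb⟩, b, hbd, β⟩ := e
  obtain rfl : la = {a} := had
  obtain rfl : lb = {b} := hbd
  have hab : a ≠ b := ne_of_labelsCommute hc
  have ha : EdgeStarts Φ Ra a := hsa a rfl
  have hb : EdgeStarts Φ Rb b := hsb b rfl
  have hreg := congrArg BlowupCube.region hde
  rw [dart_target_region, dart_source_region, dart_source_region] at hreg
  change (if β = true then switch Φ b Rb else Rb) =
    switch Φ a (if α = true then switch Φ a Ra else Ra) at hreg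
  -- The initial corner of the square is the gate of `a` seen from the start of the second edge;
  -- both labels start there.
  have hQ := hΦ.isRegion_gate a hRb
  have hQa := hΦ.edgeStarts_gate a hRb
  have hQb : EdgeStarts Φ (gate Φ a Rb) b := by
    refine (hΦ.edgeStarts_iff hQ b).2 fun i hi => ?_
    by_cases hai : labelVertex Φ a ∈ (Φ i).lk
    · rw [gate_of_mem Rb hai]
      exact (hΦ.edgeStarts_iff hRb b).1 hb i hi
    · rw [gate_of_notMem Rb hai]
      exact hΦ.gateSide_eq_of_commute ((labelsCommute_iff Φ a b).1 hc) hai hi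
  obtain ⟨Q, hQdef⟩ : ∃ Q, Q = gate Φ a Rb := ⟨_, rfl⟩
  have hQmem : ∀ i, labelVertex Φ a ∈ (Φ i).lk → Q i = Rb i := fun i hi => by
    rw [hQdef, gate_of_mem Rb hi]
  rw [← hQdef] at hQ hQa hQb
  have e1 : ∀ i, labelVertex Φ a ∈ (Φ i).lk →
      (if α = true then switch Φ a Ra else Ra) i = Ra i ∧
      switch Φ a (if α = true then switch Φ a Ra else Ra) i = Ra i := by
    intro i hi
    have hnot : i ∉ crossed Φ a := fun h => labelVertex_notMem_lk_of_mem_crossed h hi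
    cases α <;> simp [switch_eq_of_notMem Φ _ a i hnot]
  -- Partitions that commute with `a` are compared through the common vertex of the two edges; on
  -- the others the sides are prescribed by `a`.
  have e2 : Ra = if β = true then switch Φ b Q else Q := by
    funext i
    by_cases hi : labelVertex Φ a ∈ (Φ i).lk
    · rw [← (e1 i hi).2, ← hreg]
      cases β
      · exact (hQmem i hi).symm
      · exact (switch_apply_congr (hQmem i hi)).symm
    · rw [(hΦ.edgeStarts_iff hRa a).1 ha i hi, ← (hΦ.edgeStarts_iff hQ a).1 hQa i hi]
      cases β
      · rfl
      · exact (switch_eq_of_commute hc Q hi).symm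
  have e3 : Rb = if (!α) = true then switch Φ a Q else Q := by
    funext i
    by_cases hi : labelVertex Φ b ∈ (Φ i).lk
    · have hnot : i ∉ crossed Φ b := fun h => labelVertex_notMem_lk_of_mem_crossed h hi
      have h1 : Rb i = (if β = true then switch Φ b Rb else Rb) i := by
        cases β <;> simp [switch_eq_of_notMem Φ _ b i hnot]
      have h2 : Ra i = Q i := by
        rw [e2]
        cases β <;> simp [switch_eq_of_notMem Φ _ b i hnot]
      rw [h1, hreg]
      cases α
      · exact switch_apply_congr h2
      · simp only [if_true, switch_switch]
        exact h2
    · rw [(hΦ.edgeStarts_iff hRb b).1 hb i hi, ← (hΦ.edgeStarts_iff hQ b).1 hQb i hi]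
      cases α
      · exact (switch_eq_of_commute (labelsCommute_symm hc) Q hi).symm
      · rfl
  let s : BlowupCube Φ :=
    { region := Q
      labels := {a, b}
      isRegion := hQ
      commute := by
        rw [Set.pairwise_pair]
        exact fun _ => ⟨hc, labelsCommute_symm hc⟩
      starts := by rintro _ (rfl | rfl) <;> assumption }
  have hs : (blowup Φ).dirs s = {a, b} := rfl
  have hd : (⟨⟨Ra, {a}, hRa, hca, hsa⟩, a, rfl, α⟩ : (blowup Φ).Dart) =
      (blowup Φ).squareDart s a b hab hs α β := by
    refine Dart.ext' (Eq.symm (blowup_face_eq (c := s) (Or.inr rfl) e2.symm ?_)) rfl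
    exact ((blowup Φ).squareDart s a b hab hs α β).dirs_eq
  have he : (⟨⟨Rb, {b}, hRb, hcb, hsb⟩, b, rfl, β⟩ : (blowup Φ).Dart) =
      (blowup Φ).squareDart s b a hab.symm (hs.trans (Set.pair_comm a b)) β (!α) := by
    refine Dart.ext' (Eq.symm (blowup_face_eq (c := s) (Or.inl rfl) e3.symm ?_)) rfl
    exact ((blowup Φ).squareDart s b a hab.symm (hs.trans (Set.pair_comm a b)) β (!α)).dirs_eq
  obtain ⟨⟨h1, h2, h3⟩, h4⟩ := homotopic_square (X := blowup Φ) s a b hab hs α β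
  rw [hd, he]
  exact ⟨(blowup Φ).squareDart s b a hab.symm (hs.trans (Set.pair_comm a b)) β α,
    (blowup Φ).squareDart s a b hab hs α (!β), rfl, rfl, rfl, h1, h2.symm, h3, h4⟩

/-- An edge can be pushed along an edge path whose labels commute with its label. -/
theorem IsCompatibleFamily.exists_slide (hΦ : IsCompatibleFamily Φ) (d : (blowup Φ).Dart)
    (p : List (blowup Φ).Dart) {y : (blowup Φ).Cube} (hp : (blowup Φ).IsEdgePath d.target p y)
    (hc : ∀ e ∈ p, LabelsCommute Φ d.label e.label) :
    ∃ (q : List (blowup Φ).Dart) (d' : (blowup Φ).Dart), d'.label = d.label ∧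
      d'.start = d.start ∧ d'.target = y ∧ (blowup Φ).IsEdgePath d.source q d'.source ∧
      (∀ e ∈ q, ∃ f ∈ p, f.label = e.label) ∧
      (blowup Φ).Homotopic d.source y (d :: p) (q ++ [d']) := by
  induction p generalizing d with
  | nil => exact ⟨[], d, rfl, rfl, hp, rfl, by simp, .refl _⟩
  | cons e p ih =>
    obtain ⟨he, hp⟩ := hp
    obtain ⟨e', d', h1, h2, h3, h4, h5, h6, h7⟩ := hΦ.exists_square he (hc e List.mem_cons_self)
    rw [← h6] at hp
    obtain ⟨q, d'', g1, g2, g3, g4, g5, g6⟩ := ih d' hp fun f hf => by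
      rw [h2]
      exact hc f (List.mem_cons_of_mem e hf)
    refine ⟨e' :: q, d'', g1.trans h2, g2.trans h3, g3, ⟨h4, h5 ▸ g4⟩, ?_, ?_⟩
    · intro f hf
      rcases List.mem_cons.1 hf with rfl | hf
      · exact ⟨e, List.mem_cons_self, h1.symm⟩
      · obtain ⟨k, hk, hk'⟩ := g5 f hf
        exact ⟨k, List.mem_cons_of_mem e hk, hk'⟩
    · rw [← h6] at h7
      have k1 := h7.append_right hp
      have k2 := g6.append_left (l := [e']) (x' := d.source) ⟨h4, h5⟩
      exact .trans _ _ _ k1 k2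

theorem region_apply_eq_of_isEdgePath {p : List (blowup Φ).Dart} {x y : (blowup Φ).Cube}
    (hp : (blowup Φ).IsEdgePath x p y) {i : ι} (h : ∀ d ∈ p, i ∉ crossed Φ d.label) :
    BlowupCube.region x i = BlowupCube.region y i := by
  induction p generalizing x with
  | nil => rw [show x = y from hp]
  | cons d p ih =>
    rw [← ih hp.2 fun e he => h e (List.mem_cons_of_mem d he), dart_target_region, ← hp.1]
    exact (switch_eq_of_notMem Φ _ _ _ (h d List.mem_cons_self)).symm

/-! ### Projection to the blowup along the partitions with a given link -/

theorem exists_projDart {L : Set V} (d : (blowup Φ).Dart) (hd : labelLink Φ d.label = L) :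
    ∃ d' : (blowup (linkClass Φ L)).Dart, Sum.map Subtype.val id d'.label = d.label ∧
      d'.start = d.start ∧
      BlowupCube.region d'.source = (fun i : {i // (Φ i).lk = L} => BlowupCube.region d.source i) ∧
      BlowupCube.region d'.target = (fun i : {i // (Φ i).lk = L} => BlowupCube.region d.target i) := by
  obtain ⟨a, ha⟩ : ∃ a : {i // (Φ i).lk = L} ⊕ V, Sum.map Subtype.val id a = d.label := by
    rcases hl : d.label with i | v
    · rw [hl] at hd
      exact ⟨Sum.inl ⟨i, hd⟩, rfl⟩
    · exact ⟨Sum.inr v, rfl⟩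
  have hs := dart_starts d
  rw [← ha] at hs
  let d' : (blowup (linkClass Φ L)).Dart :=
    edgeDart ((BlowupCube.isRegion d.edge).linkClass L) (edgeStarts_linkClass hs) d.start
  have h1 : BlowupCube.region d'.source = (fun i : {i // (Φ i).lk = L} => BlowupCube.region d.source i) := by
    rw [dart_source_region, dart_source_region]
    change (if d.start = true then switch (linkClass Φ L) a _ else _) = _
    cases d.start
    · rfl
    · simp only [if_true]
      funext i
      rw [← ha, switch_map]
      rfl
  refine ⟨d', ha, rfl, h1, ?_⟩
  rw [dart_target_region, h1, dart_target_region]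
  funext i
  rw [← ha, switch_map]
  rfl

open Classical in
/-- The projection of an edge labelled by a label with link `L`. -/
noncomputable def projDart (L : Set V) (d : (blowup Φ).Dart) :
    Option (blowup (linkClass Φ L)).Dart :=
  if h : labelLink Φ d.label = L then some (exists_projDart d h).choose else none

theorem projDart_eq_none {L : Set V} {d : (blowup Φ).Dart} :
    projDart L d = none ↔ labelLink Φ d.label ≠ L := by
  unfold projDart
  split_ifs with h <;> simp [h]

theorem projDart_eq_some {L : Set V} {d : (blowup Φ).Dart} {d' : (blowup (linkClass Φ L)).Dart}
    (h : projDart L d = some d') : labelLink Φ d.label = L ∧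
      Sum.map Subtype.val id d'.label = d.label ∧ d'.start = d.start ∧
      BlowupCube.region d'.source = (fun i : {i // (Φ i).lk = L} => BlowupCube.region d.source i) ∧
      BlowupCube.region d'.target = (fun i : {i // (Φ i).lk = L} => BlowupCube.region d.target i) := by
  unfold projDart at h
  split_ifs at h with hd
  obtain rfl := Option.some_injective _ h
  exact ⟨hd, (exists_projDart d hd).choose_spec⟩

/-- Edges whose label has another link are dropped; by hypothesis they cross no partition with link
`L`, so the projected path stays connected. -/
theorem isEdgePath_filterMap_projDart {L : Set V} {p : List (blowup Φ).Dart}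
    {x y : (blowup Φ).Cube} (hp : (blowup Φ).IsEdgePath x p y)
    (h : ∀ d ∈ p, labelLink Φ d.label ≠ L → ∀ i, (Φ i).lk = L → i ∉ crossed Φ d.label) :
    (blowup (linkClass Φ L)).IsEdgePath
      (vertexCube ((BlowupCube.isRegion x).linkClass L)) (p.filterMap (projDart L))
      (vertexCube ((BlowupCube.isRegion y).linkClass L)) := by
  induction p generalizing x with
  | nil =>
    obtain rfl : x = y := hp
    rfl
  | cons d p ih =>
    obtain ⟨rfl, hp⟩ := hp
    have ih' := ih hp fun e he => h e (List.mem_cons_of_mem d he)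
    cases hd : projDart L d with
    | none =>
      rw [List.filterMap_cons_none hd]
      refine Eq.mpr (congrArg (fun z => IsEdgePath _ z _ _) ?_) ih'
      refine BlowupCube.ext' (funext fun i => ?_) rfl
      change BlowupCube.region d.source i = BlowupCube.region d.target i
      rw [dart_target_region, switch_eq_of_notMem]
      exact h d List.mem_cons_self (projDart_eq_none.1 hd) i i.2
    | some d' =>
      rw [List.filterMap_cons_some hd]
      obtain ⟨h1, h2, h3, h4, h5⟩ := projDart_eq_some hd
      refine ⟨source_eq_of_region_eq d'.isVertex_source (isVertex_vertexCube _) h4, ?_⟩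
      refine Eq.mpr (congrArg (fun z => IsEdgePath _ z _ _) ?_) ih'
      exact source_eq_of_region_eq d'.isVertex_target (isVertex_vertexCube _) h5

end NullHomotopy

/-! ### Tree-like sets have compatible carriers -/

section CompatibleCarriers

variable {V : Type u} {ι : Type w} {Γ : SimpleGraph V} {Φ : ι → WhiteheadPartition Γ}

open CubeComplex

/-- A label that crosses nothing has boundary zero, which no linearly independent family contains.
-/
theorem IsTreeLikeLabels.crossed_nonempty {T : Set (ι ⊕ V)} (hT : IsTreeLikeLabels Φ T)
    {a : ι ⊕ V} (ha : a ∈ T) : (crossed Φ a).Nonempty := by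
  rcases a with i | v
  · exact ⟨i, rfl⟩
  · by_contra hc
    obtain ⟨i, hi⟩ := hT.exists_link _ ha
    have hmem : (Sum.inr v : {j // (Φ j).lk = (Φ i).lk} ⊕ V) ∈ linkLabels Φ T (Φ i).lk :=
      ⟨ha, hi.symm⟩
    refine (hT.linearIndepOn (Φ i).lk).ne_zero hmem (funext fun j => ?_)
    exact boundary_of_notMem_crossed fun h => hc ⟨j, h⟩

variable [Finite V] [Finite ι]

theorem acyclic_linkLabels (hΦ : IsCompatibleFamily Φ) {T : Set (ι ⊕ V)}
    (hT : IsTreeLikeLabels Φ T) (L : Set V) (x : (blowup (linkClass Φ L)).Cube)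
    (q : List (blowup (linkClass Φ L)).Dart) (hq : (blowup (linkClass Φ L)).IsEdgePath x q x)
    (hqT : ∀ d ∈ q, d.label ∈ linkLabels Φ T L) (hc : q.IsChain fun d e => e ≠ d.symm) : q = [] :=
  (hΦ.subfamily L).acyclic_of_linearIndepOn
    (fun _ ha i => labelVertex_notMem_lk (ha.2.trans i.2.symm)) (hT.linearIndepOn L) x q hq hqT hc

open Classical in
/-- A closed edge path with labels in a tree-like set is null-homotopic. -/
theorem IsCompatibleFamily.homotopic_nil (hΦ : IsCompatibleFamily Φ) {T : Set (ι ⊕ V)}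
    (hT : IsTreeLikeLabels Φ T) (U : Set ι) (hU : IsLinkUpper Φ U) (x : (blowup Φ).Cube)
    (p : List (blowup Φ).Dart) (hp : (blowup Φ).IsEdgePath x p x)
    (hpU : ∀ d ∈ p, d.label ∈ labelsOver Φ T U) : (blowup Φ).Homotopic x x p [] := by
  induction hn : U.ncard using Nat.strong_induction_on generalizing U x p with
  | _ n ih =>
    rcases U.eq_empty_or_nonempty with rfl | hne
    · cases p with
      | nil => exact .refl _
      | cons d p =>
        obtain ⟨-, i, hi, -⟩ := hpU d List.mem_cons_self
        exact hi.elim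
    obtain ⟨i₀, hi₀, hmin⟩ := exists_minimal_link (Φ := Φ) hne
    have hU' := hU.diff hmin
    obtain ⟨L, hL⟩ : ∃ L, (Φ i₀).lk = L := ⟨_, rfl⟩
    rw [hL] at hmin hU'
    have hcard : (U \ {i | (Φ i).lk = L}).ncard < n := by
      rw [← hn]
      exact Set.ncard_lt_ncard ⟨Set.sdiff_subset, fun hs => (hs hi₀).2 hL⟩ (Set.toFinite _)
    have hU'label : ∀ a ∈ labelsOver Φ T U, labelLink Φ a ≠ L →
        a ∈ labelsOver Φ T (U \ {i | (Φ i).lk = L}) := by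
      rintro a ⟨ha, i, hi, hia⟩ hne
      exact ⟨ha, i, ⟨hi, fun h => hne (hia.symm.trans h)⟩, hia⟩
    have hU'ne : ∀ a ∈ labelsOver Φ T (U \ {i | (Φ i).lk = L}), labelLink Φ a ≠ L := by
      rintro a ⟨-, i, hi, hia⟩ h
      exact hi.2 (hia.trans h)
    -- Crossing a partition with link `L` would make the link of the label a subset of `L`, hence
    -- equal to it by minimality.
    have hcross : ∀ a ∈ labelsOver Φ T U, labelLink Φ a ≠ L → ∀ i, (Φ i).lk = L →
        i ∉ crossed Φ a := by
      rintro a ⟨-, j, hj, hja⟩ hne i hi hc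
      have := labelLink_subset_of_mem_crossed hc
      rw [← hja, hi] at this
      exact hne (hja.symm.trans (hmin j hj this))
    -- The inner induction is on the number of edges whose label has link `L`.
    induction hm : p.countP (fun d => labelLink Φ d.label = L) using Nat.strong_induction_on
      generalizing p with
    | _ m ih2 =>
      by_cases hall : ∀ d ∈ p, labelLink Φ d.label ≠ L
      · exact ih _ hcard _ hU' x p hp (fun d hd => hU'label _ (hpU d hd) (hall d hd)) rfl
      push Not at hall
      obtain ⟨d₀, hd₀, hd₀L⟩ := hall
      have hproj := isEdgePath_filterMap_projDart hp fun d hd h => hcross _ (hpU d hd) h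
      have hnc : ¬ (p.filterMap (projDart L)).IsChain fun d e => e ≠ d.symm := by
        intro hc
        have := acyclic_linkLabels hΦ hT L _ _ hproj ?_ hc
        · rw [List.filterMap_eq_nil_iff] at this
          exact projDart_eq_none.1 (this d₀ hd₀) hd₀L
        · intro d' hd'
          obtain ⟨d, hd, hdd'⟩ := List.mem_filterMap.1 hd'
          obtain ⟨h1, h2, -⟩ := projDart_eq_some hdd'
          refine ⟨by rw [h2]; exact (hpU d hd).1, ?_⟩
          rw [labelLink_linkClass, h2, h1]
      obtain ⟨q₁, d', e', q₂, hq, he'⟩ := List.exists_split_of_not_isChain hnc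
      obtain rfl : e' = d'.symm := not_not.1 he'
      obtain ⟨p₁, p', rfl, -, hp'⟩ := List.filterMap_eq_append_iff.1 hq
      obtain ⟨r, d, p'', rfl, -, hd, hp''⟩ := List.filterMap_eq_cons_iff.1 hp'
      obtain ⟨c, e, p₂, rfl, hcL, he, -⟩ := List.filterMap_eq_cons_iff.1 hp''
      obtain ⟨hdL, hd1, hd2, -⟩ := projDart_eq_some hd
      obtain ⟨heL, he1, he2, -⟩ := projDart_eq_some he
      have hlab : e.label = d.label := he1.symm.trans hd1
      have hstart : e.start = !d.start := he2.symm.trans (congrArg (!·) hd2)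
      obtain ⟨s, hs1, hs2⟩ := isEdgePath_append.1 hp
      obtain ⟨s', hs3, rfl, hs4⟩ := isEdgePath_append.1 hs2
      obtain ⟨s'', hs5, rfl, hs6⟩ := isEdgePath_append.1 hs4
      have hcU : ∀ f ∈ c, f.label ∈ labelsOver Φ T (U \ {i | (Φ i).lk = L}) := fun f hf =>
        hU'label _ (hpU f (by simp [hf])) (projDart_eq_none.1 (hcL f hf))
      -- The piece `c` crosses nothing outside the smaller family. A partition that does not commute
      -- with the label of `d` has the same side at the starts of `d` and `e`, which carry the same
      -- label in opposite directions.
      have hReq : ∀ i ∉ (U \ {i | (Φ i).lk = L}) ∩ linkUpperOf Φ {d.label},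
          BlowupCube.region d.target i = BlowupCube.region e.source i := by
        intro i hi
        by_cases hiU : i ∈ U \ {i | (Φ i).lk = L}
        · have hi' : i ∉ linkUpperOf Φ {d.label} := fun h => hi ⟨hiU, h⟩
          have h1 : BlowupCube.region d.edge i = BlowupCube.region e.edge i := by
            refine hΦ.eq_of_edgeStarts (BlowupCube.isRegion d.edge) (BlowupCube.isRegion e.edge)
              (A := {d.label}) ?_ ?_ i hi'
            · rintro _ rfl
              exact dart_starts d
            · rintro _ rfl
              exact hlab ▸ dart_starts e
          rw [dart_target_region, dart_source_region, dart_source_region, hlab, hstart]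
          cases d.start
          · exact switch_apply_congr h1
          · simp only [if_true, switch_switch]
            exact h1
        · refine region_apply_eq_of_isEdgePath hs5 fun f hf hfi => hiU ?_
          obtain ⟨-, j, hj, hjf⟩ := hcU f hf
          exact hU' j hj i (hjf ▸ labelLink_subset_of_mem_crossed hfi)
      -- A detour between the same vertices, all of whose labels commute with that of `d`.
      obtain ⟨c', hc', hc'U⟩ := (hΦ.labelJoined_of_eqOn hT _
        (hU'.inter (isLinkUpper_linkUpperOf {d.label})) (BlowupCube.isRegion d.target)
        (BlowupCube.isRegion e.source) hReq).exists_isEdgePath (BlowupCube.isRegion d.target)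
        (BlowupCube.isRegion e.source)
      rw [← eq_vertexCube d.isVertex_target, ← eq_vertexCube e.isVertex_source] at hc'
      have hc'U' : ∀ f ∈ c', f.label ∈ labelsOver Φ T (U \ {i | (Φ i).lk = L}) := fun f hf =>
        labelsOver_mono Set.inter_subset_left (hc'U f hf)
      -- The path `c` followed by the reverse of `c'` is closed with labels over the smaller family,
      -- so the outer induction contracts it.
      have hcc' : (blowup Φ).Homotopic d.target e.source c c' := by
        refine homotopic_of_homotopic_append_reversePath hs5 hc' ?_
        refine ih _ hcard _ hU' _ _ (isEdgePath_append.2 ⟨_, hs5, isEdgePath_reversePath hc'⟩)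
          (fun f hf => ?_) rfl
        rcases List.mem_append.1 hf with hf | hf
        · exact hcU f hf
        · obtain ⟨g, hg, hgf⟩ := label_of_mem_reversePath hf
          exact hgf ▸ hc'U' g hg
      -- After sliding along `c'`, the edge `d` arrives as the inverse of `e` and cancels it.
      obtain ⟨b, d'', hb1, hb2, hb3, hb4, hb5, hb6⟩ := hΦ.exists_slide d c' hc' fun f hf =>
        labelsCommute_of_mem_labelsOver (A := {d.label}) rfl
          (labelsOver_mono Set.inter_subset_right (hc'U f hf))
      obtain rfl : e = d''.symm := by
        refine dart_ext (hlab.trans hb1.symm) ?_ ?_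
        · rw [hstart, ← hb2]
          rfl
        · exact congrArg BlowupCube.region hb3.symm
      rw [d''.target_symm] at hs6
      have hbU : ∀ f ∈ b, f.label ∈ labelsOver Φ T (U \ {i | (Φ i).lk = L}) := by
        intro f hf
        obtain ⟨g, hg, hgf⟩ := hb5 f hf
        exact hgf ▸ hc'U' g hg
      -- the path `d c d⁻¹` is homotopic to `b`
      have hmid : (blowup Φ).Homotopic d.source d''.source (d :: (c ++ [d''.symm])) b := by
        have k1 := hcc'.append (l := [d]) (r := [d''.symm]) (x' := d.source) (y' := d''.source)
          ⟨rfl, rfl⟩ ⟨rfl, d''.target_symm⟩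
        have k2 := hb6.append_right (r := [d''.symm]) (y' := d''.source) ⟨hb3, d''.target_symm⟩
        have k3 := (homotopic_backtrack d'').append_left hb4
        rw [List.append_nil] at k3
        rw [List.append_assoc] at k2
        exact .trans _ _ _ k1 (.trans _ _ _ k2 k3)
      have hp₁ : (blowup Φ).IsEdgePath x (p₁ ++ r) d.source := isEdgePath_append.2 ⟨_, hs1, hs3⟩
      have hfull := hmid.append hp₁ hs6
      have e1 : p₁ ++ r ++ d :: (c ++ [d''.symm]) ++ p₂ =
          p₁ ++ (r ++ d :: (c ++ d''.symm :: p₂)) := by simp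
      rw [e1] at hfull
      refine .trans _ _ _ hfull (ih2 _ ?_ _ ?_ ?_ rfl)
      · rw [← hm]
        have hb0 : b.countP (fun d => labelLink Φ d.label = L) = 0 := by
          rw [List.countP_eq_zero]
          intro f hf
          simpa using hU'ne _ (hbU f hf)
        simp only [List.countP_append, List.countP_cons, hb0, hdL, heL, decide_true, if_true]
        omega
      · exact isEdgePath_append.2 ⟨_, isEdgePath_append.2 ⟨_, hp₁, hb4⟩, hs6⟩
      · intro f hf
        simp only [List.mem_append] at hf
        rcases hf with ((hf | hf) | hf) | hf
        · exact hpU f (by simp [hf])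
        · exact hpU f (by simp [hf])
        · exact labelsOver_mono Set.sdiff_subset (hbU f hf)
        · exact hpU f (by simp [hf])

/-- All edges with this label start in the same side of a crossed partition, so that partition
distinguishes the two ends of the carrier. Each end face then determines the cube, as its initial
region and its labels can be recovered. -/
theorem IsCompatibleFamily.isCarrierRetract (hΦ : IsCompatibleFamily Φ) (H : (blowup Φ).Hyperplane)
    (hH : (crossed Φ H.label).Nonempty) : (blowup Φ).IsCarrierRetract H := by
  obtain ⟨i, hi⟩ := hH
  refine isCarrierRetract_of_injective H ?_
  rintro ⟨c, a, ha⟩ ⟨d, b, hb⟩ rfl hq s t h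
  obtain rfl : b = a := congrArg Hyperplane.label hq
  change i ∈ crossed Φ b at hi
  have hstart : BlowupCube.region c i = BlowupCube.region d i := by
    have hl := labelVertex_notMem_lk_of_mem_crossed hi
    rw [(hΦ.edgeStarts_iff (BlowupCube.isRegion c) b).1 (BlowupCube.starts c b ha) i hl,
      (hΦ.edgeStarts_iff (BlowupCube.isRegion d) b).1 (BlowupCube.starts d b hb) i hl]
  have hmem : ∀ e : (blowup Φ).Cube, ∀ ε, b ∉ BlowupCube.labels ((blowup Φ).face e b ε) :=
    fun e ε h => h.2 rfl
  rcases s with _ | ε <;> rcases t with _ | δ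
  · exact ⟨Midcube.ext' h rfl, rfl⟩
  · exact (hmem d δ (congrArg BlowupCube.labels h ▸ ha)).elim
  · exact (hmem c ε (congrArg BlowupCube.labels h.symm ▸ hb)).elim
  · have h1 : (if ε = true then switch Φ b (BlowupCube.region c) else BlowupCube.region c) =
        if δ = true then switch Φ b (BlowupCube.region d) else BlowupCube.region d := by
      rw [← blowup_face_region c ha, ← blowup_face_region d hb]
      exact congrArg BlowupCube.region h
    have h2 : BlowupCube.labels c \ {b} = BlowupCube.labels d \ {b} := congrArg BlowupCube.labels h
    have h3 : ε = δ := by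
      have := congrFun h1 i
      revert this
      cases ε <;> cases δ <;> simp [switch_of_mem _ hi, hstart]
    subst h3
    have h4 : BlowupCube.region c = BlowupCube.region d := by
      cases ε
      · simpa using h1
      · have := congrArg (switch Φ b) h1
        simpa [switch_switch] using this
    have ha' : b ∈ BlowupCube.labels c := ha
    have hb' : b ∈ BlowupCube.labels d := hb
    have h5 : BlowupCube.labels c = BlowupCube.labels d := by
      rw [← Set.insert_sdiff_self_of_mem ha', ← Set.insert_sdiff_self_of_mem hb', h2]
    exact ⟨Midcube.ext' (BlowupCube.ext' h4 h5) rfl, rfl⟩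

theorem IsCompatibleFamily.hasCompatibleCarriers (hΦ : IsCompatibleFamily Φ)
    {𝓗 : Set (blowup Φ).Hyperplane} (hT : IsTreeLikeLabels Φ (hyperplaneLabels 𝓗)) :
    (blowup Φ).HasCompatibleCarriers 𝓗 := by
  refine ⟨fun H hH => hΦ.isCarrierRetract H (hT.crossed_nonempty ⟨H, hH, rfl⟩), ?_⟩
  intro x p _ hp hpH
  refine hΦ.homotopic_nil hT Set.univ (fun _ _ _ _ => Set.mem_univ _) x p hp fun d hd => ?_
  have hdT : d.label ∈ hyperplaneLabels 𝓗 := ⟨_, hpH d hd, rfl⟩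
  obtain ⟨i, hi⟩ := hT.exists_link _ hdT
  exact ⟨hdT, i, Set.mem_univ i, hi⟩

end CompatibleCarriers

/-! ### The collapse along a tree-like set is the Salvetti complex -/

section Collapse

variable {V : Type u} {ι : Type w} {Γ : SimpleGraph V} {Φ : ι → WhiteheadPartition Γ}

open CubeComplex

/-- The cube of the blowup at a region with a given set of labels. -/
def regionCube {R : ι → Bool} (hR : IsRegion Φ R) {B : Set (ι ⊕ V)}
    (hB : B.Pairwise (LabelsCommute Φ)) (hs : ∀ b ∈ B, EdgeStarts Φ R b) : BlowupCube Φ :=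
  ⟨R, B, hR, hB, hs⟩

theorem image_linkLabels (Φ : ι → WhiteheadPartition Γ) (T : Set (ι ⊕ V)) (L : Set V) :
    Sum.map Subtype.val id '' linkLabels Φ T L = T ∩ {a | labelLink Φ a = L} := by
  ext a
  constructor
  · rintro ⟨b, ⟨hb, hbL⟩, rfl⟩
    exact ⟨hb, (labelLink_linkClass L b).symm.trans hbL⟩
  · rintro ⟨haT, haL⟩
    rcases a with i | v
    · exact ⟨Sum.inl ⟨i, haL⟩, ⟨haT, haL⟩, rfl⟩
    · exact ⟨Sum.inr v, ⟨haT, haL⟩, rfl⟩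

variable [Finite ι]

/-- The boundaries and the standard basis are two bases of the same space. -/
theorem IsTreeLikeLabels.ncard_eq {T : Set (ι ⊕ V)} (hT : IsTreeLikeLabels Φ T) (L : Set V) :
    (T ∩ {a | labelLink Φ a = L}).ncard = {i | (Φ i).lk = L}.ncard := by
  have hli : LinearIndependent ℚ fun x : linkLabels Φ T L => boundary (linkClass Φ L) x :=
    hT.linearIndepOn L
  have hsp := hT.span_eq_top L
  rw [Set.image_eq_range] at hsp
  let b := Module.Basis.mk hli hsp.ge
  have e := b.indexEquiv (Pi.basisFun ℚ {i // (Φ i).lk = L})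
  rw [← image_linkLabels, Set.ncard_image_of_injective _ labelMap_injective]
  exact Nat.card_congr e

variable [Finite V]

theorem IsCompatibleFamily.keptDirs_eq (hΦ : IsCompatibleFamily Φ) (𝓗 : Set (blowup Φ).Hyperplane)
    (c : BlowupCube Φ) : (blowup Φ).keptDirs 𝓗 c = c.labels \ hyperplaneLabels 𝓗 := by
  ext a
  constructor
  · rintro ⟨h, hH⟩
    exact ⟨h, fun h' => hH (hΦ.mem_iff_label_mem.2 h')⟩
  · rintro ⟨h, hH⟩
    exact ⟨h, fun h' => hH (hΦ.mem_iff_label_mem.1 h')⟩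

/-- The class of a cube in the collapse. -/
def collapseMk (𝓗 : Set (blowup Φ).Hyperplane) (c : BlowupCube Φ) :
    ((blowup Φ).collapse 𝓗).Cube := Quot.mk _ c

theorem IsCompatibleFamily.collapseMk_face (hΦ : IsCompatibleFamily Φ)
    {𝓗 : Set (blowup Φ).Hyperplane} (c : BlowupCube Φ) {a : ι ⊕ V}
    (ha : a ∈ hyperplaneLabels 𝓗) (ε : Bool) :
    collapseMk 𝓗 ((blowup Φ).face c a ε) = collapseMk 𝓗 c :=
  (blowup Φ).mk_face_of_notMem_keptDirs 𝓗 c a ε (by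
    rw [hΦ.keptDirs_eq]
    exact fun h => h.2 ha)

theorem IsCompatibleFamily.collapse_dirs_mk (hΦ : IsCompatibleFamily Φ)
    (𝓗 : Set (blowup Φ).Hyperplane) (c : BlowupCube Φ) :
    ((blowup Φ).collapse 𝓗).dirs (collapseMk 𝓗 c) = c.labels \ hyperplaneLabels 𝓗 :=
  hΦ.keptDirs_eq 𝓗 c

/-- A cube is identified with its faces in collapsed directions; choosing the faces at coordinate
`0` keeps the region. -/
theorem IsCompatibleFamily.collapseMk_eq_regionCube (hΦ : IsCompatibleFamily Φ)
    (𝓗 : Set (blowup Φ).Hyperplane) (c : BlowupCube Φ) {B : Set (ι ⊕ V)}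
    (hB : c.labels \ hyperplaneLabels 𝓗 = B) (hc : B.Pairwise (LabelsCommute Φ))
    (hs : ∀ b ∈ B, EdgeStarts Φ c.region b) :
    collapseMk 𝓗 c = collapseMk 𝓗 (regionCube c.isRegion hc hs) := by
  induction hn : (c.labels ∩ hyperplaneLabels 𝓗).ncard using Nat.strong_induction_on
    generalizing c with
  | _ n ih =>
    rcases Set.eq_empty_or_nonempty (c.labels ∩ hyperplaneLabels 𝓗) with h | ⟨a, ha, haT⟩
    · refine congrArg (collapseMk 𝓗) (BlowupCube.ext' rfl ?_)
      exact (sdiff_eq_left.2 (Set.disjoint_iff_inter_eq_empty.2 h)).symm.trans hB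
    · rw [← hΦ.collapseMk_face c haT false]
      have hreg : BlowupCube.region ((blowup Φ).face c a false) = c.region :=
        blowup_face_region c ha false
      have key := ih _ ?_ ((blowup Φ).face c a false) ?_ (by rw [hreg]; exact hs) rfl
      · rw [key]
        exact congrArg (collapseMk 𝓗) (BlowupCube.ext' hreg rfl)
      · rw [← hn]
        refine Set.ncard_lt_ncard ⟨fun x hx => ⟨hx.1.1, hx.2⟩, fun h => ?_⟩ (Set.toFinite _)
        exact (h ⟨ha, haT⟩).1.2 rfl
      · rw [blowup_face_labels, ← hB]
        ext x
        constructor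
        · exact fun hx => ⟨hx.1.1, hx.2⟩
        · rintro ⟨hx, hx'⟩
          exact ⟨⟨hx, fun h => hx' (h ▸ haT)⟩, hx'⟩

/-- Each edge `a` of the path commutes with all of `B`, so the two cubes at its ends are opposite
faces of a cube with labels `insert a B`, collapsed in the direction `a`. -/
theorem IsCompatibleFamily.collapseMk_eq_of_labelJoined (hΦ : IsCompatibleFamily Φ)
    {𝓗 : Set (blowup Φ).Hyperplane} {B : Set (ι ⊕ V)}
    (hB : B.Pairwise (LabelsCommute Φ)) {R R' : ι → Bool}
    (h : LabelJoined Φ (labelsOver Φ (hyperplaneLabels 𝓗) (linkUpperOf Φ B)) R R') :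
    ((∀ b ∈ B, EdgeStarts Φ R b) ↔ ∀ b ∈ B, EdgeStarts Φ R' b) ∧
    ∀ (hR : IsRegion Φ R) (hR' : IsRegion Φ R') (hs : ∀ b ∈ B, EdgeStarts Φ R b)
      (hs' : ∀ b ∈ B, EdgeStarts Φ R' b),
      collapseMk 𝓗 (regionCube hR hB hs) = collapseMk 𝓗 (regionCube hR' hB hs') := by
  induction h with
  | rel R R' h =>
    obtain ⟨hR, a, ha, hsa, rfl⟩ := h
    have hcom : ∀ b ∈ B, LabelsCommute Φ b a := fun b hb =>
      labelsCommute_of_mem_labelsOver hb ha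
    refine ⟨forall₂_congr fun b hb => (hΦ.edgeStarts_switch_iff hR (hcom b hb) hsa).symm, ?_⟩
    intro _ hR' hs hs'
    let c : BlowupCube Φ :=
      { region := R
        labels := insert a B
        isRegion := hR
        commute := hB.insert fun b hb _ => ⟨labelsCommute_symm (hcom b hb), hcom b hb⟩
        starts := by
          rintro b (rfl | hb)
          · exact hsa
          · exact hs b hb }
    have haB : a ∉ B := fun h => ne_of_labelsCommute (hcom a h) rfl
    have hac : a ∈ c.labels := Set.mem_insert a B
    have hlab : c.labels \ {a} = B := Set.insert_sdiff_self_of_notMem haB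
    have h1 := hΦ.collapseMk_face (𝓗 := 𝓗) c ha.1 false
    have h2 := hΦ.collapseMk_face (𝓗 := 𝓗) c ha.1 true
    rw [blowup_face_eq (d := regionCube hR hB hs) hac rfl hlab] at h1
    rw [blowup_face_eq (d := regionCube hR' hB hs') hac rfl hlab] at h2
    rw [h1, h2]
  | refl => exact ⟨Iff.rfl, fun _ _ _ _ => rfl⟩
  | symm _ _ _ ih => exact ⟨ih.1.symm, fun hR hR' hs hs' => (ih.2 hR' hR hs' hs).symm⟩
  | trans R S R' h1 _ ih1 ih2 =>
    refine ⟨ih1.1.trans ih2.1, fun hR hR' hs hs' => ?_⟩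
    have hS := (LabelJoined.isRegion_iff h1).1 hR
    exact (ih1.2 hR hS hs (ih1.1.1 hs)).trans (ih2.2 hS hR' _ hs')

/-- With `B` the remaining labels, the two initial regions agree on every partition that fails to
commute with some label of `B`. They are therefore joined by labels in the tree-like set that
commute with `B`, along which the cube can be moved. -/
theorem IsCompatibleFamily.collapse_ext (hΦ : IsCompatibleFamily Φ)
    {𝓗 : Set (blowup Φ).Hyperplane} (hT : IsTreeLikeLabels Φ (hyperplaneLabels 𝓗))
    {x y : ((blowup Φ).collapse 𝓗).Cube}
    (h : ((blowup Φ).collapse 𝓗).dirs x = ((blowup Φ).collapse 𝓗).dirs y) : x = y := by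
  obtain ⟨c, rfl⟩ := Quot.exists_rep x
  obtain ⟨d, rfl⟩ := Quot.exists_rep y
  have hcd : BlowupCube.labels c \ hyperplaneLabels 𝓗 = BlowupCube.labels d \ hyperplaneLabels 𝓗 := by
    exact (hΦ.collapse_dirs_mk 𝓗 c).symm.trans (h.trans (hΦ.collapse_dirs_mk 𝓗 d))
  have hc := (BlowupCube.commute c).mono (Set.sdiff_subset (t := hyperplaneLabels 𝓗))
  have hs : ∀ b ∈ BlowupCube.labels c \ hyperplaneLabels 𝓗, EdgeStarts Φ (BlowupCube.region c) b :=
    fun b hb => BlowupCube.starts c b hb.1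
  have hs' : ∀ b ∈ BlowupCube.labels c \ hyperplaneLabels 𝓗,
      EdgeStarts Φ (BlowupCube.region d) b :=
    fun b hb => BlowupCube.starts d b (hcd ▸ hb).1
  change collapseMk 𝓗 c = collapseMk 𝓗 d
  rw [hΦ.collapseMk_eq_regionCube 𝓗 c rfl hc hs, hΦ.collapseMk_eq_regionCube 𝓗 d hcd.symm hc hs']
  refine (hΦ.collapseMk_eq_of_labelJoined hc ?_).2 _ _ _ _
  exact hΦ.labelJoined_of_eqOn hT _ (isLinkUpper_linkUpperOf _) c.isRegion d.isRegion
    (hΦ.eq_of_edgeStarts c.isRegion d.isRegion hs hs')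

/-! ### Counting labels -/

theorem ncard_labelLink_eq (Φ : ι → WhiteheadPartition Γ) (L : Set V) :
    {a | labelLink Φ a = L}.ncard =
      {i | (Φ i).lk = L}.ncard + {v | Γ.neighborSet v = L}.ncard := by
  have : {a | labelLink Φ a = L} =
      Sum.inl '' {i | (Φ i).lk = L} ∪ Sum.inr '' {v | Γ.neighborSet v = L} := by
    ext (i | v) <;> simp [labelLink, labelVertex, WhiteheadPartition.lk]
  rw [this, Set.ncard_union_eq, Set.ncard_image_of_injective _ Sum.inl_injective,
    Set.ncard_image_of_injective _ Sum.inr_injective]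
  rw [Set.disjoint_left]
  rintro _ ⟨i, -, rfl⟩ ⟨v, -, h⟩
  cases h

/-- Among the labels with link `L`, the tree-like set takes as many as there are partitions with
this link, which leaves as many as there are vertices of `Γ`. -/
theorem IsTreeLikeLabels.exists_equiv {T : Set (ι ⊕ V)} (hT : IsTreeLikeLabels Φ T) :
    ∃ σ : {a // a ∉ T} ≃ V, ∀ a, Γ.neighborSet (σ a) = labelLink Φ a := by
  have hcard : ∀ L : Set V, Nat.card {x : {a // a ∉ T} // labelLink Φ x = L} =
      Nat.card {v // Γ.neighborSet v = L} := by
    intro L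
    have h1 := ncard_labelLink_eq Φ L
    have h2 := hT.ncard_eq L
    have h3 := Set.ncard_inter_add_ncard_sdiff_eq_ncard {a | labelLink Φ a = L} T (Set.toFinite _)
    rw [Set.inter_comm] at h3
    have h4 : Nat.card {x : {a // a ∉ T} // labelLink Φ x = L} =
        ({a | labelLink Φ a = L} \ T).ncard := by
      refine Nat.card_congr ⟨fun x => ⟨x.1.1, x.2, x.1.2⟩, fun x => ⟨⟨x.1, x.2.2⟩, x.2.1⟩,
        fun _ => rfl, fun _ => rfl⟩
    have h5 : Nat.card {v // Γ.neighborSet v = L} = {v | Γ.neighborSet v = L}.ncard := rfl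
    rw [h4, h5]
    omega
  let σ : {a // a ∉ T} ≃ V := Equiv.ofFiberEquiv (f := fun x => labelLink Φ x)
    (g := fun v => Γ.neighborSet v) fun L => (Finite.card_eq.1 (hcard L)).some
  exact ⟨σ, fun a => Equiv.ofFiberEquiv_map _ a⟩

/-- A cube of the collapse is its set of remaining labels, and every pairwise commuting set of
remaining labels occurs; a bijection that preserves links turns these sets into the cliques of `Γ`.
-/
theorem IsCompatibleFamily.nonempty_iso (hΦ : IsCompatibleFamily Φ)
    {𝓗 : Set (blowup Φ).Hyperplane} (hT : IsTreeLikeLabels Φ (hyperplaneLabels 𝓗)) :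
    Nonempty (CubeComplex.Iso ((blowup Φ).collapse 𝓗) (salvetti Γ)) := by
  classical
  obtain ⟨σ₀, hσ₀⟩ := hT.exists_equiv
  obtain ⟨σ, hσ⟩ : ∃ σ : ι ⊕ V → V, ∀ a (h : a ∉ hyperplaneLabels 𝓗), σ a = σ₀ ⟨a, h⟩ :=
    ⟨fun a => if h : a ∉ hyperplaneLabels 𝓗 then σ₀ ⟨a, h⟩ else labelVertex Φ a,
      fun a h => dif_pos h⟩
  have hinj : Set.InjOn σ (hyperplaneLabels 𝓗)ᶜ := by
    intro a ha b hb h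
    rw [hσ a ha, hσ b hb] at h
    exact congrArg Subtype.val (σ₀.injective h)
  -- Equality of links suffices: adjacency is membership in a link, and it can be tested on either
  -- endpoint.
  have hadj : ∀ a ∉ hyperplaneLabels 𝓗, ∀ b ∉ hyperplaneLabels 𝓗,
      (Γ.Adj (σ a) (σ b) ↔ LabelsCommute Φ a b) := by
    intro a ha b hb
    have h1 : Γ.neighborSet (σ a) = labelLink Φ a := by rw [hσ a ha, hσ₀]
    have h2 : Γ.neighborSet (σ b) = labelLink Φ b := by rw [hσ b hb, hσ₀]
    rw [labelsCommute_iff_mem, ← h2]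
    change _ ↔ Γ.Adj (σ b) (labelVertex Φ a)
    rw [Γ.adj_comm (σ b)]
    change σ b ∈ Γ.neighborSet (σ a) ↔ σ b ∈ labelLink Φ a
    rw [h1]
  have hdirs : ∀ x : ((blowup Φ).collapse 𝓗).Cube,
      ((blowup Φ).collapse 𝓗).dirs x ⊆ (hyperplaneLabels 𝓗)ᶜ ∧
      (((blowup Φ).collapse 𝓗).dirs x).Pairwise (LabelsCommute Φ) := by
    intro x
    obtain ⟨c, rfl⟩ := Quot.exists_rep x
    have h := hΦ.collapse_dirs_mk 𝓗 c
    unfold collapseMk at h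
    rw [h]
    exact ⟨fun a ha => ha.2, c.commute.mono Set.sdiff_subset⟩
  let f : ((blowup Φ).collapse 𝓗).Cube → (salvetti Γ).Cube := fun x =>
    ⟨σ '' ((blowup Φ).collapse 𝓗).dirs x, by
      rintro _ ⟨a, ha, rfl⟩ _ ⟨b, hb, rfl⟩ hne
      refine (hadj a ((hdirs x).1 ha) b ((hdirs x).1 hb)).2 ((hdirs x).2 ha hb ?_)
      rintro rfl
      exact hne rfl⟩
  have hf : Function.Bijective f := by
    constructor
    · intro x y h
      refine hΦ.collapse_ext hT ?_
      exact (hinj.image_eq_image_iff (hdirs x).1 (hdirs y).1).1 (congrArg Subtype.val h)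
    · rintro ⟨A, hA⟩
      let B : Set (ι ⊕ V) := {b | ∃ h : b ∉ hyperplaneLabels 𝓗, σ₀ ⟨b, h⟩ ∈ A}
      have hBc : B.Pairwise (LabelsCommute Φ) := by
        rintro a ⟨ha, ha'⟩ b ⟨hb, hb'⟩ hne
        refine (hadj a ha b hb).1 ?_
        rw [hσ a ha, hσ b hb]
        refine hA ha' hb' fun h => hne ?_
        exact congrArg Subtype.val (σ₀.injective h)
      obtain ⟨R, hR, hs⟩ := hΦ.exists_edgeStarts_of_pairwise (Set.toFinite B) hBc
      refine ⟨collapseMk 𝓗 (regionCube hR hBc hs), Subtype.ext ?_⟩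
      change σ '' ((blowup Φ).collapse 𝓗).dirs _ = A
      rw [hΦ.collapse_dirs_mk]
      ext v
      constructor
      · rintro ⟨b, ⟨⟨hb, hb'⟩, -⟩, rfl⟩
        rwa [hσ b hb]
      · intro hv
        obtain ⟨⟨b, hb⟩, rfl⟩ := σ₀.surjective v
        exact ⟨b, ⟨⟨hb, hv⟩, hb⟩, hσ b hb⟩
  refine ⟨{ cube := Equiv.ofBijective f hf
            dir := fun x => Equiv.Set.imageOfInjOn σ _ (hinj.mono (hdirs x).1)
            flip := fun _ _ => false
            cube_face := ?_
            dir_face := fun _ _ _ _ _ => rfl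
            flip_face := fun _ _ _ _ _ => rfl }⟩
  rintro x ⟨a, ha⟩ ε
  refine Subtype.ext ?_
  change σ '' ((blowup Φ).collapse 𝓗).dirs _ = σ '' ((blowup Φ).collapse 𝓗).dirs x \ {σ a}
  rw [CubeComplex.dirs_face, (hinj.mono (hdirs x).1).image_sdiff_subset
    (Set.singleton_subset_iff.2 ha), Set.image_singleton]

end Collapse

/-! ### What an isomorphism with the Salvetti complex yields -/

section CollapseIso

variable {V : Type u} {ι : Type w} {Γ : SimpleGraph V} {Φ : ι → WhiteheadPartition Γ}

open CubeComplex

theorem pairwise_pair_labelsCommute {a b : ι ⊕ V} (h : LabelsCommute Φ a b) :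
    ({a, b} : Set (ι ⊕ V)).Pairwise (LabelsCommute Φ) := by
  rw [Set.pairwise_pair]
  exact fun _ => ⟨h, labelsCommute_symm h⟩

variable [Finite V] [Finite ι]

/-- An elementary identification moves the initial region along at most one edge, whose label is
collapsed. -/
theorem labelJoined_of_collapseMk_eq {𝓗 : Set (blowup Φ).Hyperplane} {c d : BlowupCube Φ}
    (h : collapseMk 𝓗 c = collapseMk 𝓗 d) :
    LabelJoined Φ (hyperplaneLabels 𝓗) c.region d.region := by
  have key : ∀ c d : BlowupCube Φ, Relation.EqvGen ((blowup Φ).CollapseRel 𝓗) c d →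
      LabelJoined Φ (hyperplaneLabels 𝓗) c.region d.region := by
    intro c d h
    induction h with
    | rel c d h =>
      obtain ⟨⟨c', a, ha⟩, hH, rfl, ε, rfl⟩ := h
      have haT : a ∈ hyperplaneLabels 𝓗 := ⟨_, hH, rfl⟩
      have hreg : BlowupCube.region ((blowup Φ).face c a ε) = _ := blowup_face_region c ha ε
      change LabelJoined Φ _ (BlowupCube.region c) (BlowupCube.region ((blowup Φ).face c a ε))
      rw [hreg]
      cases ε
      · exact .refl _
      · exact .rel _ _ ⟨BlowupCube.isRegion c, a, haT, BlowupCube.starts c a ha, rfl⟩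
    | refl => exact .refl _
    | symm _ _ _ ih => exact .symm _ _ ih
    | trans _ _ _ _ _ ih1 ih2 => exact .trans _ _ _ ih1 ih2
  exact key c d (Quot.eqvGen_exact h)

/-- A function of the cubes that takes the same value on opposite faces depends only on the label
of an edge. -/
theorem IsCompatibleFamily.edgeCube_eq_of_face_eq (hΦ : IsCompatibleFamily Φ) {α : Type*}
    {C : BlowupCube Φ → α}
    (hC : ∀ (c : BlowupCube Φ) b, C ((blowup Φ).face c b false) = C ((blowup Φ).face c b true))
    {R R' : ι → Bool} (hR : IsRegion Φ R) (hR' : IsRegion Φ R') {a : ι ⊕ V}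
    (ha : EdgeStarts Φ R a) (ha' : EdgeStarts Φ R' a) :
    C (edgeCube hR ha) = C (edgeCube hR' ha') := by
  -- Invariant under passing to faces of midcubes, so it descends to hyperplanes, and these are
  -- determined by their labels.
  let G : (blowup Φ).Midcube → α := fun p =>
    C (edgeCube (BlowupCube.isRegion p.cube) (BlowupCube.starts p.cube _ p.mem))
  have hG : ∀ p q : (blowup Φ).Midcube, p.HasFace q → G p = G q := by
    rintro ⟨c, a, ha⟩ ⟨d, a', ha'⟩ ⟨h1, b, ε, hb, h2⟩
    obtain rfl : a' = a := h1
    obtain rfl : d = (blowup Φ).face c b ε := h2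
    have hba : a' ≠ b := fun h => hb h.symm
    by_cases hbc : b ∈ BlowupCube.labels c
    · have hreg := blowup_face_region c hbc ε
      have hab : LabelsCommute Φ a' b := BlowupCube.commute c ha hbc hba
      let s : BlowupCube Φ := regionCube (BlowupCube.isRegion c) (pairwise_pair_labelsCommute hab)
        (by rintro _ (rfl | rfl); exacts [BlowupCube.starts c _ ha, BlowupCube.starts c _ hbc])
      have hlab : s.labels \ {b} = {a'} := by
        ext x
        constructor
        · rintro ⟨h | h, h'⟩
          · exact h
          · exact (h' h).elim
        · rintro rfl
          exact ⟨Or.inl rfl, hba⟩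
      have hbs : b ∈ s.labels := Or.inr rfl
      have h0 : (blowup Φ).face s b false =
          edgeCube (BlowupCube.isRegion c) (BlowupCube.starts c _ ha) :=
        blowup_face_eq hbs rfl hlab
      have h1 : (blowup Φ).face s b ε = edgeCube
          (BlowupCube.isRegion ((blowup Φ).face c b ε)) (BlowupCube.starts _ _ ha') :=
        blowup_face_eq hbs hreg.symm hlab
      change C (edgeCube _ _) = C (edgeCube _ _)
      rw [← h0, ← h1]
      cases ε
      · rfl
      · exact hC s b
    · have : (blowup Φ).face c b ε = c := (blowup Φ).face_of_notMem c b ε hbc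
      refine congrArg C (BlowupCube.ext' ?_ rfl)
      exact (congrArg BlowupCube.region this).symm
  have := hΦ.hyperplane_edge_unique hR hR' ha ha'
  exact congrArg (Quot.lift G hG) this

/-- The Salvetti complex has only one vertex, so all vertices of the blowup become equal in the
collapse. -/
theorem IsCompatibleFamily.labelJoined_of_iso (hΦ : IsCompatibleFamily Φ)
    {𝓗 : Set (blowup Φ).Hyperplane}
    (f : CubeComplex.Iso ((blowup Φ).collapse 𝓗) (salvetti Γ)) (R R' : ι → Bool)
    (hR : IsRegion Φ R) (hR' : IsRegion Φ R') : LabelJoined Φ (hyperplaneLabels 𝓗) R R' := by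
  have key : ∀ {R : ι → Bool} (hR : IsRegion Φ R),
      (f.cube (collapseMk 𝓗 (vertexCube hR))).1 = ∅ := by
    intro R hR
    refine Set.eq_empty_of_forall_notMem fun v hv => ?_
    have h := ((f.dir (collapseMk 𝓗 (vertexCube hR))).symm ⟨v, hv⟩).2
    exact ((hΦ.collapse_dirs_mk 𝓗 (vertexCube hR)).subset h).1
  refine labelJoined_of_collapseMk_eq (c := vertexCube hR) (d := vertexCube hR')
    (f.cube.injective (Subtype.ext ?_))
  rw [key, key]

/-- Opposite faces of a cube coincide in the Salvetti complex. -/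
theorem IsCompatibleFamily.iso_face_eq (hΦ : IsCompatibleFamily Φ)
    {𝓗 : Set (blowup Φ).Hyperplane} (f : CubeComplex.Iso ((blowup Φ).collapse 𝓗) (salvetti Γ))
    (c : BlowupCube Φ) (b : ι ⊕ V) :
    f.cube (collapseMk 𝓗 ((blowup Φ).face c b false)) =
      f.cube (collapseMk 𝓗 ((blowup Φ).face c b true)) := by
  by_cases hb : b ∈ c.labels
  · by_cases hbT : b ∈ hyperplaneLabels 𝓗
    · rw [hΦ.collapseMk_face c hbT, hΦ.collapseMk_face c hbT]
    · have h : b ∈ ((blowup Φ).collapse 𝓗).dirs (collapseMk 𝓗 c) := by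
        rw [hΦ.collapse_dirs_mk]
        exact ⟨hb, hbT⟩
      have h0 := f.cube_face (collapseMk 𝓗 c) ⟨b, h⟩ false
      have h1 := f.cube_face (collapseMk 𝓗 c) ⟨b, h⟩ true
      exact h0.trans h1.symm
  · have h : ∀ ε, (blowup Φ).face c b ε = c := fun ε => (blowup Φ).face_of_notMem c b ε hb
    rw [h, h]

/-- An isomorphism of the collapse with the Salvetti complex gives a bijection of the remaining
labels with the vertices of `Γ` that preserves adjacency. -/
theorem IsCompatibleFamily.exists_equiv_of_iso (hΦ : IsCompatibleFamily Φ)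
    {𝓗 : Set (blowup Φ).Hyperplane}
    (f : CubeComplex.Iso ((blowup Φ).collapse 𝓗) (salvetti Γ)) :
    ∃ σ : {a // a ∉ hyperplaneLabels 𝓗} ≃ V, ∀ a b, LabelsCommute Φ a.1 b.1 →
      Γ.Adj (σ a) (σ b) := by
  obtain ⟨R₀, hR₀⟩ := hΦ.exists_isRegion
  have hedge : ∀ {R : ι → Bool} (hR : IsRegion Φ R) {a : ι ⊕ V} (ha : EdgeStarts Φ R a),
      a ∉ hyperplaneLabels 𝓗 →
      ((blowup Φ).collapse 𝓗).dirs (collapseMk 𝓗 (edgeCube hR ha)) = {a} := by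
    intro R hR a ha haT
    rw [hΦ.collapse_dirs_mk]
    exact sdiff_eq_left.2 (Set.disjoint_singleton_left.2 haT)
  -- The vertex assigned to a label is that of the image of any edge carrying it.
  have hex : ∀ a : {a // a ∉ hyperplaneLabels 𝓗}, ∃ v : V, ∀ (R : ι → Bool) (hR : IsRegion Φ R)
      (ha : EdgeStarts Φ R a.1), (f.cube (collapseMk 𝓗 (edgeCube hR ha))).1 = {v} := by
    rintro ⟨a, haT⟩
    have hR := hΦ.isRegion_gate a hR₀
    have hs := hΦ.edgeStarts_gate a hR₀
    have hdirs := hedge hR hs haT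
    let e := f.dir (collapseMk 𝓗 (edgeCube hR hs))
    refine ⟨(e ⟨a, hdirs ▸ Set.mem_singleton a⟩).1, fun R' hR' ha' => ?_⟩
    rw [hΦ.edgeCube_eq_of_face_eq (C := fun c => f.cube (collapseMk 𝓗 c)) (hΦ.iso_face_eq f)
      hR' hR ha' hs]
    ext v
    constructor
    · intro hv
      have h1 := hdirs.subset (e.symm ⟨v, hv⟩).2
      have h2 : e.symm ⟨v, hv⟩ = ⟨a, hdirs ▸ Set.mem_singleton a⟩ := Subtype.ext h1
      rw [← h2, e.apply_symm_apply]
      rfl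
    · rintro rfl
      exact (e ⟨a, _⟩).2
  choose σ hσ using hex
  have hσ' : ∀ (a : ι ⊕ V) (ha : a ∉ hyperplaneLabels 𝓗),
      (f.cube (collapseMk 𝓗 (edgeCube (hΦ.isRegion_gate a hR₀) (hΦ.edgeStarts_gate a hR₀)))).1 =
        {σ ⟨a, ha⟩} := fun a ha => hσ ⟨a, ha⟩ _ _ _
  have hinj : Function.Injective σ := by
    rintro ⟨a, ha⟩ ⟨b, hb⟩ h
    have h1 := (hσ' a ha).trans ((congrArg _ h).trans (hσ' b hb).symm)
    have h2 := congrArg ((blowup Φ).collapse 𝓗).dirs (f.cube.injective (Subtype.ext h1))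
    rw [hedge _ _ ha, hedge _ _ hb] at h2
    exact Subtype.ext (Set.singleton_injective h2)
  have hsurj : Function.Surjective σ := by
    intro v
    let A : (salvetti Γ).Cube := ⟨{v}, Set.pairwise_singleton _ _⟩
    obtain ⟨x, hx⟩ := f.cube.surjective A
    obtain ⟨c, rfl⟩ := Quot.exists_rep x
    change f.cube (collapseMk 𝓗 c) = A at hx
    let e := f.dir (collapseMk 𝓗 c)
    have hv : v ∈ (salvetti Γ).dirs (f.cube (collapseMk 𝓗 c)) := by
      rw [hx]
      exact Set.mem_singleton v
    have hdirs := hΦ.collapse_dirs_mk 𝓗 c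
    obtain ⟨a, ha⟩ : ∃ a, BlowupCube.labels c \ hyperplaneLabels 𝓗 = {a} := by
      refine ⟨(e.symm ⟨v, hv⟩).1, ?_⟩
      rw [← hdirs]
      ext b
      constructor
      · intro hb
        have h1 : (e ⟨b, hb⟩).1 ∈ ({v} : Set V) :=
          (congrArg (salvetti Γ).dirs hx).subset (e ⟨b, hb⟩).2
        have h2 : e ⟨b, hb⟩ = ⟨v, hv⟩ := Subtype.ext h1
        rw [← h2, e.symm_apply_apply]
        rfl
      · rintro rfl
        exact (e.symm ⟨v, hv⟩).2
    have haT : a ∈ BlowupCube.labels c \ hyperplaneLabels 𝓗 := ha ▸ Set.mem_singleton a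
    have hs : EdgeStarts Φ (BlowupCube.region c) a := BlowupCube.starts c a haT.1
    refine ⟨⟨a, haT.2⟩, ?_⟩
    have h1 := hσ ⟨a, haT.2⟩ _ (BlowupCube.isRegion c) hs
    have h2 := hΦ.collapseMk_eq_regionCube 𝓗 c ha (Set.pairwise_singleton _ _)
      (by rintro _ rfl; exact hs)
    have h3 : (f.cube (collapseMk 𝓗 (edgeCube (BlowupCube.isRegion c) hs))).1 = {v} := by
      have := congrArg Subtype.val (congrArg f.cube h2)
      exact this.symm.trans (congrArg Subtype.val hx)
    exact Set.singleton_injective (h1.symm.trans h3)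
  refine ⟨Equiv.ofBijective σ ⟨hinj, hsurj⟩, ?_⟩
  -- Each side of a square with labels `a` and `b` maps to a face of the image clique, which
  -- therefore contains both assigned vertices.
  have hmem : ∀ (c : BlowupCube Φ) (a b : ι ⊕ V) (hab : a ≠ b) (hc : c.labels = {a, b})
      (ha : a ∉ hyperplaneLabels 𝓗) (hb : b ∉ hyperplaneLabels 𝓗),
      σ ⟨a, ha⟩ ∈ (f.cube (collapseMk 𝓗 c)).1 := by
    intro c a b hab hc ha hb
    have hac : a ∈ c.labels := hc ▸ Or.inl rfl
    have hbc : b ∈ c.labels := hc ▸ Or.inr rfl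
    have hlab : c.labels \ {b} = {a} := by
      rw [hc]
      ext x
      constructor
      · rintro ⟨h | h, h'⟩
        · exact h
        · exact (h' h).elim
      · rintro rfl
        exact ⟨Or.inl rfl, hab⟩
    have hface : (blowup Φ).face c b false = edgeCube c.isRegion (c.starts a hac) :=
      blowup_face_eq hbc rfl hlab
    have hbd : b ∈ ((blowup Φ).collapse 𝓗).dirs (collapseMk 𝓗 c) := by
      rw [hΦ.collapse_dirs_mk]
      exact ⟨hbc, hb⟩
    have h1 := congrArg Subtype.val (f.cube_face (collapseMk 𝓗 c) ⟨b, hbd⟩ false)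
    have h2 := hσ ⟨a, ha⟩ _ c.isRegion (c.starts a hac)
    rw [← hface] at h2
    have h3 := h2.symm.trans h1
    have h4 : σ ⟨a, ha⟩ ∈ ({σ ⟨a, ha⟩} : Set V) := rfl
    rw [h3] at h4
    exact h4.1
  rintro ⟨a, ha⟩ ⟨b, hb⟩ hab
  have hne := ne_of_labelsCommute hab
  obtain ⟨R, hR, hs⟩ := hΦ.exists_edgeStarts_of_pairwise (Set.toFinite {a, b})
    (pairwise_pair_labelsCommute hab)
  let c := regionCube hR (pairwise_pair_labelsCommute hab) hs
  refine (f.cube (collapseMk 𝓗 c)).2 (hmem c a b hne rfl ha hb)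
    (hmem c b a hne.symm (Set.pair_comm a b) hb ha) fun h => hne ?_
  exact congrArg Subtype.val (hinj h)

end CollapseIso

/-! ### Transversals, and a double count of adjacencies -/

section Transversal

/-- A nonsingular square matrix has a nonzero transversal. -/
theorem Matrix.exists_perm_forall_ne_zero {n R : Type*} [Fintype n] [DecidableEq n] [CommRing R]
    {M : Matrix n n R} (h : M.det ≠ 0) : ∃ τ : Equiv.Perm n, ∀ i, M (τ i) i ≠ 0 := by
  rw [Matrix.det_apply] at h
  obtain ⟨τ, -, hτ⟩ := Finset.exists_ne_zero_of_sum_ne_zero h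
  refine ⟨τ, fun i hi => hτ ?_⟩
  have h0 : ∏ j, M (τ j) j = 0 := Finset.prod_eq_zero (Finset.mem_univ i) hi
  rw [h0, smul_zero]

/-- Suppose that the vertices `x b` of a graph, for `b ∉ T`, can be rearranged to all vertices
without destroying edges, and that the rest have smaller links than the vertices `m i` replaced by
them. Then the links have not changed. -/
theorem SimpleGraph.neighborSet_eq_of_equiv {V : Type u} {ι : Type w} [Finite V] [Finite ι]
    (Γ : SimpleGraph V) (m : ι → V) {T : Set (ι ⊕ V)} (θ : ι ≃ T)
    (hθ : ∀ i, Γ.neighborSet (Sum.elim m id (θ i).1) ⊆ Γ.neighborSet (m i))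
    (σ : {a // a ∉ T} ≃ V)
    (hσ : ∀ a b, Γ.Adj (Sum.elim m id a.1) (Sum.elim m id b.1) → Γ.Adj (σ a) (σ b)) (i : ι) :
    Γ.neighborSet (Sum.elim m id (θ i).1) = Γ.neighborSet (m i) := by
  classical
  have := Fintype.ofFinite V
  have := Fintype.ofFinite ι
  set x : ι ⊕ V → V := Sum.elim m id with hx
  -- Both sides sum `g` over the vertices of all labels: split by membership in `T`, and by the two
  -- kinds of label.
  have total : ∀ g : V → ℕ, ∑ i, g (x (θ i)) + ∑ b : {a // a ∉ T}, g (x b) =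
      ∑ i, g (m i) + ∑ v, g v := by
    intro g
    have h1 := Fintype.sum_subtype_add_sum_subtype (· ∈ T) fun a => g (x a)
    rw [Fintype.sum_sum_type] at h1
    rw [← Equiv.sum_comp θ] at h1
    exact h1
  have mono : ∀ g : V → ℕ, (∀ v w, Γ.neighborSet v ⊆ Γ.neighborSet w → g v ≤ g w) →
      ∑ i, g (x (θ i)) ≤ ∑ i, g (m i) := fun g hg =>
    Finset.sum_le_sum fun i _ => hg _ _ (hθ i)
  -- The degree in `Γ`, and below it the number of labels outside `T` whose vertex is adjacent. Both
  -- are monotone in the link, so their sums over `V` are at most those over the labels outside `T`.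
  let g₁ : V → ℕ := fun v => ∑ w, if Γ.Adj v w then 1 else 0
  let g₂ : V → ℕ := fun v => ∑ b : {a // a ∉ T}, if Γ.Adj v (x b) then 1 else 0
  have hg : ∀ v w z, Γ.neighborSet v ⊆ Γ.neighborSet w →
      (if Γ.Adj v z then 1 else 0 : ℕ) ≤ if Γ.Adj w z then 1 else 0 := by
    intro v w z h
    by_cases hz : Γ.Adj v z
    · rw [if_pos hz, if_pos (show Γ.Adj w z from h hz)]
    · rw [if_neg hz]
      exact Nat.zero_le _
  have hg₁ : ∀ v w, Γ.neighborSet v ⊆ Γ.neighborSet w → g₁ v ≤ g₁ w := fun v w h =>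
    Finset.sum_le_sum fun z _ => hg v w z h
  have hg₂ : ∀ v w, Γ.neighborSet v ⊆ Γ.neighborSet w → g₂ v ≤ g₂ w := fun v w h =>
    Finset.sum_le_sum fun b _ => hg v w (x b) h
  have h₁ : ∑ v, g₂ v = ∑ b : {a // a ∉ T}, g₁ (x b) := by
    simp only [g₁, g₂, Γ.adj_comm (x _)]
    exact Finset.sum_comm
  have h₂ : ∑ b : {a // a ∉ T}, g₂ (x b) ≤ ∑ v, g₁ v := by
    rw [← Equiv.sum_comp σ]
    refine Finset.sum_le_sum fun a _ => ?_
    simp only [g₁, g₂]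
    rw [← Equiv.sum_comp σ]
    refine Finset.sum_le_sum fun b _ => ?_
    by_cases hb : Γ.Adj (x a) (x b)
    · rw [if_pos hb, if_pos (hσ a b hb)]
    · rw [if_neg hb]
      exact Nat.zero_le _
  -- The sums form a cycle of inequalities: `g₁` over `V`, `g₁` over the complement of `T`, which
  -- equals `g₂` over `V`, then `g₂` over the complement, and back to `g₁` over `V`. Hence equality
  -- holds throughout.
  have heq : ∑ i, g₁ (x (θ i)) = ∑ i, g₁ (m i) := by
    have := total g₁
    have := total g₂
    have := mono g₁ hg₁
    have := mono g₂ hg₂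
    omega
  have hi := (Finset.sum_eq_sum_iff_of_le fun i _ => hg₁ _ _ (hθ i)).1 heq i (Finset.mem_univ i)
  have hcard : ∀ v, (Γ.neighborSet v).ncard = g₁ v := by
    intro v
    rw [Set.ncard_eq_toFinset_card']
    refine Eq.trans ?_ (Finset.card_filter _ _)
    exact congrArg _ (Finset.ext fun w => by simp)
  refine Set.eq_of_subset_of_ncard_le (hθ i) ?_ (Set.toFinite _)
  rw [hcard, hcard]
  exact hi.ge

end Transversal

/-! ### From the isomorphism to a tree-like set -/

section Converse

variable {V : Type u} {ι : Type w} {Γ : SimpleGraph V} {Φ : ι → WhiteheadPartition Γ}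

theorem boundary_linkClass (L : Set V) (a : {i // (Φ i).lk = L} ⊕ V) (i : {i // (Φ i).lk = L}) :
    boundary (linkClass Φ L) a i = boundary Φ (Sum.map Subtype.val id a) i.1 := by
  classical
  rcases a with j | v
  · simp only [boundary, Sum.map_inl, Pi.single_apply, Subtype.ext_iff]
  · rfl

/-- A basis of labels that respects links is tree-like, since the matrix of its boundaries is block
triangular. -/
theorem isTreeLikeLabels_of_linearIndependent [Finite ι] {T : Set (ι ⊕ V)} (θ : ι ≃ T)
    (hlink : ∀ i, labelLink Φ (θ i).1 = (Φ i).lk)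
    (hli : LinearIndependent ℚ fun i => boundary Φ (θ i).1) : IsTreeLikeLabels Φ T := by
  classical
  have := Fintype.ofFinite ι
  let M : Matrix ι ι ℚ := Matrix.of fun i j => boundary Φ (θ i).1 j
  have hM : M.det ≠ 0 :=
    ((Matrix.isUnit_iff_isUnit_det M).1 (Matrix.linearIndependent_rows_iff_isUnit.1 hli)).ne_zero
  -- Links are only partially ordered by inclusion; a linear extension provides the order of the
  -- blocks, one for each link.
  let b : ι → LinearExtension (Set V) := fun i => toLinearExtension (Φ i).lk
  have htri : M.BlockTriangular b := by
    intro i j hij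
    by_contra h
    have hj : j ∈ crossed Φ (θ i).1 := by
      by_contra hj
      exact h (boundary_of_notMem_crossed hj)
    have hsub := labelLink_subset_of_mem_crossed hj
    rw [hlink] at hsub
    exact (toLinearExtension.monotone hsub).not_gt hij
  have hblock : ∀ L : Set V, LinearIndependent ℚ
      fun (i : {i // (Φ i).lk = L}) (j : {i // (Φ i).lk = L}) => boundary Φ (θ i.1).1 j.1 := by
    intro L
    by_cases hL : ∃ i, (Φ i).lk = L
    · obtain ⟨i, rfl⟩ := hL
      rw [htri.det] at hM
      have := Finset.prod_ne_zero_iff.1 hM (b i) (Finset.mem_image_of_mem b (Finset.mem_univ i))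
      have h1 := Matrix.linearIndependent_rows_iff_isUnit.2
        ((Matrix.isUnit_iff_isUnit_det _).2 this.isUnit)
      exact h1
    · have : IsEmpty {i // (Φ i).lk = L} := ⟨fun i => hL ⟨i.1, i.2⟩⟩
      exact linearIndependent_empty_type
  have hex : ∀ L (i : {i // (Φ i).lk = L}), ∃ a : {i // (Φ i).lk = L} ⊕ V,
      Sum.map Subtype.val id a = (θ i.1).1 := by
    rintro _ ⟨i, rfl⟩
    have hi := hlink i
    rcases hl : (θ i).1 with j | v
    · rw [hl] at hi
      exact ⟨Sum.inl ⟨j, hi⟩, rfl⟩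
    · exact ⟨Sum.inr v, rfl⟩
  choose l hl using hex
  have hinj : ∀ L, Function.Injective (l L) := by
    intro L i j h
    have := (hl L i).symm.trans ((congrArg _ h).trans (hl L j))
    exact Subtype.ext (θ.injective (Subtype.ext this))
  have hrange : ∀ L, linkLabels Φ T L = Set.range (l L) := by
    intro L
    ext a
    constructor
    · rintro ⟨h1, h2⟩
      obtain ⟨i, hi⟩ := θ.surjective ⟨_, h1⟩
      have hi' := congrArg Subtype.val hi
      have hiL : (Φ i).lk = L := by rw [← hlink, hi', ← labelLink_linkClass, h2]
      exact ⟨⟨i, hiL⟩, labelMap_injective ((hl L _).trans hi')⟩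
    · rintro ⟨i, rfl⟩
      refine ⟨?_, ?_⟩
      · rw [hl]
        exact (θ i.1).2
      · rw [labelLink_linkClass, hl, hlink, i.2]
  have hLI : ∀ L, LinearIndependent ℚ (boundary (linkClass Φ L) ∘ l L) := by
    intro L
    convert hblock L using 1
    funext i j
    rw [Function.comp_apply, boundary_linkClass, hl]
  refine ⟨fun a ha => ?_, fun L => ?_, fun L => ?_⟩
  · obtain ⟨i, hi⟩ := θ.surjective ⟨a, ha⟩
    exact ⟨i, by rw [← hlink, hi]⟩
  · rw [hrange, linearIndepOn_range_iff (hinj L)]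
    exact hLI L
  · rw [hrange, ← Set.range_comp]
    exact (hLI L).span_eq_top_of_card_eq_finrank' (Module.finrank_fintype_fun_eq_card ℚ).symm

variable [Finite V] [Finite ι]

/-- If the labels in `T` span, and the other labels can be matched with the vertices of `Γ` without
destroying adjacency, then `T` is tree-like. -/
theorem isTreeLikeLabels_of_equiv {T : Set (ι ⊕ V)}
    (hspan : Submodule.span ℚ (boundary Φ '' T) = ⊤) (σ : {a // a ∉ T} ≃ V)
    (hσ : ∀ a b, LabelsCommute Φ a.1 b.1 → Γ.Adj (σ a) (σ b)) : IsTreeLikeLabels Φ T := by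
  classical
  have := Fintype.ofFinite V
  have := Fintype.ofFinite ι
  -- The labels outside `T` are as many as the vertices, so `T` has as many labels as there are
  -- partitions, and spanning becomes independence.
  have hcard : Fintype.card T = Fintype.card ι := by
    have h1 := Fintype.card_subtype_compl (· ∈ T)
    have h2 := Fintype.card_subtype_le (· ∈ T)
    have h3 := Fintype.card_congr σ
    rw [Fintype.card_sum] at h1 h2
    change Fintype.card {a // a ∈ T} = _
    omega
  have e : T ≃ ι := Fintype.equivOfCardEq hcard
  let M : Matrix ι ι ℚ := Matrix.of fun i j => boundary Φ (e.symm i).1 j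
  have hrange : ∀ f : ι ≃ T, Set.range (fun i => boundary Φ (f i).1) = boundary Φ '' T := by
    intro f
    rw [Set.image_eq_range]
    exact f.surjective.range_comp fun a : T => boundary Φ a
  have hli : ∀ f : ι ≃ T, LinearIndependent ℚ fun i => boundary Φ (f i).1 := by
    intro f
    refine linearIndependent_of_top_le_span_of_card_eq_finrank ?_
      (Module.finrank_fintype_fun_eq_card ℚ).symm
    rw [hrange, hspan]
  have hM : M.det ≠ 0 := ((Matrix.isUnit_iff_isUnit_det M).1
    (Matrix.linearIndependent_rows_iff_isUnit.1 (hli e.symm))).ne_zero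
  -- A nonzero transversal assigns to each partition a label in `T` that crosses it, hence has a
  -- smaller or equal link.
  obtain ⟨τ, hτ⟩ := Matrix.exists_perm_forall_ne_zero hM
  have hcross : ∀ i, i ∈ crossed Φ (e.symm (τ i)).1 := by
    intro i
    by_contra h
    exact hτ i (boundary_of_notMem_crossed h)
  have hx : ∀ a, labelVertex Φ a = Sum.elim (fun i => (Φ i).m.1) id a := by
    rintro (i | v) <;> rfl
  refine isTreeLikeLabels_of_linearIndependent (τ.trans e.symm) ?_ (hli _)
  intro i
  have := Γ.neighborSet_eq_of_equiv (fun i => (Φ i).m.1) (τ.trans e.symm)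
    (fun i => by rw [← hx]; exact labelLink_subset_of_mem_crossed (hcross i)) σ
    (fun a b h => hσ a b (by rwa [labelsCommute_iff, hx, hx])) i
  rwa [← hx] at this

open CubeComplex in
theorem IsCompatibleFamily.isTreeLikeLabels_of_iso (hΦ : IsCompatibleFamily Φ)
    {𝓗 : Set (blowup Φ).Hyperplane}
    (f : CubeComplex.Iso ((blowup Φ).collapse 𝓗) (salvetti Γ)) :
    IsTreeLikeLabels Φ (hyperplaneLabels 𝓗) := by
  obtain ⟨σ, hσ⟩ := hΦ.exists_equiv_of_iso f
  exact isTreeLikeLabels_of_equiv (hΦ.span_boundary_eq_top (hΦ.labelJoined_of_iso f)) σ hσ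

end Converse

theorem mainTheorem7 {V : Type*} [Finite V] (Γ : SimpleGraph V) {ι : Type*} [Finite ι]
    (Φ : ι → WhiteheadPartition Γ)
    (hdistinct : ∀ i j, i ≠ j → ¬ (Φ i).SamePartition (Φ j))
    (hcompatible : ∀ i j, i ≠ j → (Φ i).Compatible (Φ j))
    (𝓗 : Set (blowup Φ).Hyperplane) :
    IsTreeLike Φ 𝓗 ↔
      (blowup Φ).HasCompatibleCarriers 𝓗 ∧
        Nonempty (CubeComplex.Iso ((blowup Φ).collapse 𝓗) (salvetti Γ)) := by
  have hΦ : IsCompatibleFamily Φ := fun i j h => ⟨hdistinct i j h, hcompatible i j h⟩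
  rw [hΦ.isTreeLike_iff]
  refine ⟨fun hT => ⟨hΦ.hasCompatibleCarriers hT, hΦ.nonempty_iso hT⟩, ?_⟩
  rintro ⟨-, ⟨f⟩⟩
  exact hΦ.isTreeLikeLabels_of_iso f
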